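/- **Setting.** On $\mathbb R^{2n}$ with coordinates $(q,p)=(q^1,\dots,q^n,p_1,\dots,p_n)$ (we also write $q_i=q^i$) and Poisson bracket $\{F,G\}=\sum_j(\partial_{q^j}F\,\partial_{p_j}G-\partial_{p_j}F\,\partial_{q^j}G)$, let $*$ be the Weyl (Moyal) star product on $C^\infty(\mathbb R^{2n},\mathbb C)[[\hbar]]$, $$F*G=\exp\Big(\tfrac{i\hbar}{2}\sum_j\big(\partial_{q^j}\partial_{p'_j}-\partial_{q'^j}\partial_{p_j}\big)\Big)F(q,p)\,G(q',p')\Big|_{q'=q,\;p'=p},$$ extended bilinearly over the Laurent polynomials in formal spectral parameters $\lambda,\mu$. **Lax matrices.** Let $U(\lambda)$ be one of the following matrices of functions of $(q,p)\in\mathbb R^2$, where $\sigma,\tau\in\{1,-1\}$ and $g,\delta,\epsilon\in\mathbb C$: $$\begin{pmatrix}-\lambda+p&-e^{-q}\\e^{q}&0\end{pmatrix},\quad \begin{pmatrix}-\lambda+p&\sigma e^{-q}\\ \tau p e^{q}&\sigma\tau\end{pmatrix},\quad \begin{pmatrix}\frac1\lambda-\lambda e^p&-e^{-q}\\e^q&-\lambda\end{pmatrix},\quad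 \begin{pmatrix}\frac1\lambda-\lambda e^p&-g^2e^{-q+p}\\e^q&0\end{pmatrix},$$ $$\begin{pmatrix}\frac1\lambda-\lambda e^p&-g^2(e^p+\delta)e^{-q}\\e^q&-\lambda\delta g^2\end{pmatrix},\quad \begin{pmatrix}\frac1\lambda-\lambda e^{\epsilon p}&-\epsilon e^{-q}\\ \epsilon e^q&-\epsilon^2\lambda\end{pmatrix},\quad \begin{pmatrix}\frac1\lambda-\lambda e^{\epsilon p}&-(e^{\epsilon p}-1)e^{-q}\\ \epsilon e^q&\lambda\epsilon\end{pmatrix}.$$ Let $U^k(\lambda)$ be $U(\lambda)$ with $(q,p)$ replaced by $(q^k,p_k)$, and put $\chi_n(\lambda)=\operatorname{tr}(U^n(\lambda)\cdots U^1(\lambda))$ and $\tilde\chi_n(\lambda)=\operatorname{tr}(E_{11}U^n(\lambda)\cdots U^1(\lambda))$. **Definitions.** A star product on $\mathbb R^{2n}$ is an associative $\mathbb C[[\hbar]]$-bilinear product $F*'G=\sum_m\hbar^mM_m(F,G)$ on $C^\infty(\mathbb R^{2n},\mathbb C)[[\hbar]]$ with unit $1$, where the $M_m$ are bidifferential operators,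 $M_0(F,G)=FG$ and $M_1(F,G)-M_1(G,F)=i\{F,G\}$. A Hamiltonian $H$ and functions $f_1,\dots,f_n$ on $\mathbb R^{2n}$ form a classical completely integrable system if $\{f_i,H\}=0$ and $\{f_i,f_j\}=0$ for all $i,j$ and $f_1,\dots,f_n$ are functionally independent, i.e. $df_1,\dots,df_n$ are linearly independent (over $\mathbb C$) on a dense set. It is quantum integrable if for some star product there are series $F_i\in C^\infty(\mathbb R^{2n},\mathbb C)[[\hbar]]$ with $F_i|_{\hbar=0}=f_i$ that star commute with $H$ and with each other. We use the same terminology, and say that $H$ and the $F_i$ define a quantum integrable system by means of the given star product, if $H$ itself is a series in $\hbar$, the classical Hamiltonian then being $H|_{\hbar=0}$. A star polynomial in some functions is an element obtained from them and from scalars in $\mathbb C[[\hbar]]$ by sums and $*$-products. **Theorem 4.6.** Let $U$ be any of these matrices and $n\ge1$. 1. $\chi_n(\lambda)*\chi_n(\mu)=\chi_n(\mu)*\chi_n(\lambda)$ and $\tilde\chi_n(\lambda)*\tilde\chi_n(\mu)=\tilde\chi_n(\mu)*\tilde\chi_n(\lambda)$. 2. Assume $\epsilon\ne0$ in the last two families.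 The Weyl product $*$ is a star product, and the following holds for $P=\chi_n$ and for $P=\tilde\chi_n$. All but $n$ of the coefficients of $P$ (as a Laurent polynomial in $\lambda$) are constant, and these $n$ coefficients $f_1,\dots,f_n$ are functionally independent. For every star polynomial $H$ in the coefficients of $P$, the Hamiltonian $H$ and the series $F_i=f_i$ define a quantum integrable system by means of $*$. More generally, so do $H$ and any star polynomials $F_1,\dots,F_n$ in the coefficients of $P$ whose classical limits $F_i|_{\hbar=0}$ are functionally independent. 3. In particular, for the first matrix $U$, the nonperiodic Toda chain $H=\frac12\sum_{i=1}^np_i^2+\sum_{i=1}^{n-1}e^{q_i-q_{i+1}}$, with the coefficients of $\lambda^0,\dots,\lambda^{n-1}$ in $\tilde\chi_n$ as conserved quantities, and the periodic Toda chain $H=\frac12\sum_{i=1}^np_i^2+\sum_{i=1}^{n}e^{q_i-q_{i+1}}$ ($q_{n+1}=q_1$), with the coefficients of $\lambda^0,\dots,\lambda^{n-1}$ in $\chi_n$ as conserved quantities, are quantum integrable by means of $*$ (and without quantum corrections). -/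

import Mathlib

open scoped ContDiff LaurentPolynomial TensorProduct

noncomputable section

namespace QToda

/-! ### Classical observables on flat phase space -/

/-- The phase space `ℝ²ⁿ` with coordinates `x = (q, p)`. -/
abbrev Phase (n : ℕ) : Type := (Fin n → ℝ) × (Fin n → ℝ)

/-- The smooth complex valued functions on `ℝ²ⁿ`, with the pointwise operations. -/
def smoothFunctions (n : ℕ) : Subalgebra ℂ (Phase n → ℂ) where
  carrier := {f | ContDiff ℝ ∞ f}
  mul_mem' {f g} (hf : ContDiff ℝ ∞ f) (hg : ContDiff ℝ ∞ g) :=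
    show ContDiff ℝ ∞ (f * g) from hf.mul hg
  add_mem' {f g} (hf : ContDiff ℝ ∞ f) (hg : ContDiff ℝ ∞ g) :=
    show ContDiff ℝ ∞ (f + g) from hf.add hg
  algebraMap_mem' c := show ContDiff ℝ ∞ (fun _ : Phase n => c) from contDiff_const

/-- The algebra `C^∞(ℝ²ⁿ)` of classical observables. -/
def Obs (n : ℕ) : Type := smoothFunctions n

instance (n : ℕ) : CommRing (Obs n) := inferInstanceAs (CommRing (smoothFunctions n))

instance (n : ℕ) : Algebra ℂ (Obs n) := inferInstanceAs (Algebra ℂ (smoothFunctions n))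

/-- The derivative of an observable in the constant direction `v`. -/
def pd {n : ℕ} (v : Phase n) : Obs n →ₗ[ℂ] Obs n where
  toFun f := ⟨fun x => fderiv ℝ f.1 x v, by
    have hf : ContDiff ℝ ∞ f.1 := f.2
    exact (hf.fderiv_right (m := ∞) (by simp)).clm_apply contDiff_const⟩
  map_add' f g := by
    have hf : Differentiable ℝ f.1 :=
      ContDiff.differentiable (n := ∞) f.2 (by simp)
    have hg : Differentiable ℝ g.1 :=
      ContDiff.differentiable (n := ∞) g.2 (by simp)
    refine Subtype.ext (funext fun x => ?_)
    change fderiv ℝ (f.1 + g.1) x v = _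
    rw [fderiv_add (hf x) (hg x)]
    rfl
  map_smul' c f := by
    have hf : Differentiable ℝ f.1 :=
      ContDiff.differentiable (n := ∞) f.2 (by simp)
    refine Subtype.ext (funext fun x => ?_)
    change fderiv ℝ (c • f.1) x v = _
    rw [fderiv_const_smul (hf x)]
    rfl

/-- `∂/∂q^j`. -/
def dq {n : ℕ} (j : Fin n) : Obs n →ₗ[ℂ] Obs n := pd (Pi.single j 1, 0)

/-- `∂/∂p_j`. -/
def dp {n : ℕ} (j : Fin n) : Obs n →ₗ[ℂ] Obs n := pd (0, Pi.single j 1)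

/-- The canonical Poisson bracket. -/
def poisson {n : ℕ} (f g : Obs n) : Obs n := ∑ j, (dq j f * dp j g - dp j f * dq j g)

/-- Functional independence of `n` observables: their differentials are linearly independent on a
dense set of points.  (This set is automatically open; for real valued observables, independence
over `ℂ` is the same as independence over `ℝ`.) -/
def FunctionallyIndependent {n : ℕ} (f : Fin n → Obs n) : Prop :=
  Dense {x : Phase n | LinearIndependent ℂ fun i => fderiv ℝ (f i).1 x}

/-- A classical completely integrable system with Hamilton function `H` and conserved
quantities `f`. -/
structure IsClassicallyIntegrable {n : ℕ} (H : Obs n) (f : Fin n → Obs n) : Prop where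
  conserved : ∀ i, poisson (f i) H = 0
  involution : ∀ i j, poisson (f i) (f j) = 0
  independent : FunctionallyIndependent f

/-! ### Star products -/

/-- The formal power series `C^∞(ℝ²ⁿ)[[ħ]]`. -/
abbrev QObs (n : ℕ) : Type := PowerSeries (Obs n)

/-- A classical observable as a series that is constant in `ħ`. -/
def cl {n : ℕ} (f : Obs n) : QObs n := PowerSeries.C f

/-- The `ħ`-bilinear product `F * G = ∑_m ħ^m M_m(F, G)` on `C^∞(ℝ²ⁿ)[[ħ]]`. -/
def starMul {n : ℕ} (M : ℕ → Obs n →ₗ[ℂ] Obs n →ₗ[ℂ] Obs n) (F G : QObs n) : QObs n :=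
  PowerSeries.mk fun m => ∑ c ∈ Finset.HasAntidiagonal.antidiagonal m, ∑ ab ∈ Finset.HasAntidiagonal.antidiagonal c.1,
    M c.2 (PowerSeries.coeff ab.1 F) (PowerSeries.coeff ab.2 G)

/-- The iterated derivative of `f` along a list of constant directions. -/
def iterPd {n : ℕ} (w : List (Phase n)) (f : Obs n) : Obs n := w.foldr (fun v g => pd v g) f

/-- Star products on `ℝ²ⁿ`: associative deformations of the pointwise product by bidifferential
operators, with unit `1`, whose commutator is `iħ` times the Poisson bracket to first order. -/
structure IsStarProduct {n : ℕ} (M : ℕ → Obs n →ₗ[ℂ] Obs n →ₗ[ℂ] Obs n) : Prop where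
  bidifferential : ∀ m, ∃ (s : Finset (List (Phase n) × List (Phase n)))
    (c : List (Phase n) × List (Phase n) → Obs n),
    ∀ f g, M m f g = ∑ w ∈ s, c w * iterPd w.1 f * iterPd w.2 g
  classical : ∀ f g, M 0 f g = f * g
  commutator : ∀ f g, M 1 f g - M 1 g f = Complex.I • poisson f g
  one_left : ∀ m, 1 ≤ m → ∀ f, M m 1 f = 0
  one_right : ∀ m, 1 ≤ m → ∀ f, M m f 1 = 0
  assoc : ∀ F G H : QObs n, starMul M (starMul M F G) H = starMul M F (starMul M G H)

/-- The operator `∑_j ∂_{q^j} ⊗ ∂_{p_j} - ∂_{p_j} ⊗ ∂_{q^j}` on functions of two copies of the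
phase space variables. -/
def poissonTensor (n : ℕ) : Obs n ⊗[ℂ] Obs n →ₗ[ℂ] Obs n ⊗[ℂ] Obs n :=
  ∑ j : Fin n, (TensorProduct.map (dq j) (dp j) - TensorProduct.map (dp j) (dq j))

/-- The Weyl (Moyal) star product: the coefficient of `ħ^m` in
`exp((iħ/2) ∑_j (∂_{q^j} ∂_{p'_j} - ∂_{q'^j} ∂_{p_j})) F(q,p) G(q',p')` on the diagonal
`q = q'`, `p = p'`. -/
def weyl (n : ℕ) (m : ℕ) : Obs n →ₗ[ℂ] Obs n →ₗ[ℂ] Obs n :=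
  (TensorProduct.mk ℂ (Obs n) (Obs n)).compr₂
    (((m.factorial : ℂ)⁻¹ * (Complex.I / 2) ^ m) •
      (LinearMap.mul' ℂ (Obs n) ∘ₗ (poissonTensor n) ^ m))

/-- Two formal observables commute for the star product given by `M`. -/
def StarCommute {n : ℕ} (M : ℕ → Obs n →ₗ[ℂ] Obs n →ₗ[ℂ] Obs n) (F G : QObs n) : Prop :=
  starMul M F G = starMul M G F

/-- The series `F_i`, together with the star product `M`, exhibit the classical system with
Hamiltonian `H` and conserved quantities `F_i|_{ħ=0}` as quantum integrable.
The Hamiltonian is allowed to depend on `ħ` (its classical limit is then the Hamilton function of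
the classical system); an undeformed Hamiltonian is of the form `cl H`. -/
structure QuantumIntegrableBy {n : ℕ} (M : ℕ → Obs n →ₗ[ℂ] Obs n →ₗ[ℂ] Obs n)
    (H : QObs n) (F : Fin n → QObs n) : Prop where
  isStarProduct : IsStarProduct M
  classical : IsClassicallyIntegrable (PowerSeries.constantCoeff H)
    (fun i => PowerSeries.constantCoeff (F i))
  comm_hamiltonian : ∀ i, StarCommute M (F i) H
  comm : ∀ i j, StarCommute M (F i) (F j)

/-- Quantum integrability of the system with Hamilton function `H` and classical conserved
quantities `f`. -/
def IsQuantumIntegrable {n : ℕ} (H : Obs n) (f : Fin n → Obs n) : Prop :=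
  ∃ (M : ℕ → Obs n →ₗ[ℂ] Obs n →ₗ[ℂ] Obs n) (F : Fin n → QObs n),
    (∀ i, PowerSeries.constantCoeff (F i) = f i) ∧ QuantumIntegrableBy M (cl H) F

/-! ### The spectral parameters -/

/-- Laurent polynomials in two formal spectral parameters `λ`, `μ` over `C^∞(ℝ²ⁿ)[[ħ]]`; the
basis element with index `(a, b)` is `λ^a μ^b`. -/
abbrev Spectral (n : ℕ) : Type := AddMonoidAlgebra (QObs n) (ℤ × ℤ)

/-- `P(λ)`. -/
def atLam {n : ℕ} (P : (Obs n)[T;T⁻¹]) : Spectral n :=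
  P.coeff.sum fun k f => AddMonoidAlgebra.single (k, 0) (cl f)

/-- `P(μ)`. -/
def atMu {n : ℕ} (P : (Obs n)[T;T⁻¹]) : Spectral n :=
  P.coeff.sum fun k f => AddMonoidAlgebra.single (0, k) (cl f)

/-- The Weyl star product, extended bilinearly over the Laurent polynomials in `λ`, `μ`. -/
def spectralStar {n : ℕ} (F G : Spectral n) : Spectral n :=
  F.coeff.sum fun a f => G.coeff.sum fun b g =>
    AddMonoidAlgebra.single (a + b) (starMul (weyl n) f g)

/-! ### The Lax matrices -/

/-- The momentum coordinate on `ℝ²`. -/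
def mom : Obs 1 := ⟨fun x => (x.2 0 : ℂ), by
  change ContDiff ℝ ∞ (fun x : Phase 1 => ((x.2 0 : ℝ) : ℂ))
  exact Complex.ofRealCLM.contDiff.comp (by fun_prop)⟩

/-- The function `e^{a q}` on `ℝ²`. -/
def expQ (a : ℂ) : Obs 1 := ⟨fun x => Complex.exp (a * (x.1 0 : ℂ)), by
  change ContDiff ℝ ∞ (fun x : Phase 1 => Complex.exp (a * ((x.1 0 : ℝ) : ℂ)))
  exact (contDiff_const.mul (Complex.ofRealCLM.contDiff.comp (by fun_prop))).cexp⟩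

/-- The function `e^{a p}` on `ℝ²`. -/
def expP (a : ℂ) : Obs 1 := ⟨fun x => Complex.exp (a * (x.2 0 : ℂ)), by
  change ContDiff ℝ ∞ (fun x : Phase 1 => Complex.exp (a * ((x.2 0 : ℝ) : ℂ)))
  exact (contDiff_const.mul (Complex.ofRealCLM.contDiff.comp (by fun_prop))).cexp⟩

/-- The list of Lax matrices, with their parameters; in `toda'` the parameters `σ`, `τ` are
signs. -/
inductive Lax : Type
  | toda
  | toda' (σ τ : ℤˣ)
  | relToda
  | relToda' (g : ℂ)
  | relToda'' (g δ : ℂ)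
  | discToda (ε : ℂ)
  | discToda' (ε : ℂ)

/-- The scalar `c`, as a Laurent polynomial with coefficients in `C^∞(ℝ²)`. -/
def cst (c : ℂ) : (Obs 1)[T;T⁻¹] := LaurentPolynomial.C (algebraMap ℂ (Obs 1) c)

open LaurentPolynomial in
/-- The Lax matrices `U(λ)`; the spectral parameter `λ` is `T 1` and `1/λ` is `T (-1)`. -/
def Lax.mat : Lax → Matrix (Fin 2) (Fin 2) (Obs 1)[T;T⁻¹]
  | .toda => !![-T 1 + C mom, -C (expQ (-1)); C (expQ 1), 0]
  | .toda' σ τ => !![-T 1 + C mom, cst ((σ : ℤ) : ℂ) * C (expQ (-1));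
      cst ((τ : ℤ) : ℂ) * C (mom * expQ 1), cst (((σ * τ : ℤˣ) : ℤ) : ℂ)]
  | .relToda => !![T (-1) - T 1 * C (expP 1), -C (expQ (-1)); C (expQ 1), -T 1]
  | .relToda' g => !![T (-1) - T 1 * C (expP 1), -(cst (g ^ 2) * C (expQ (-1) * expP 1));
      C (expQ 1), 0]
  | .relToda'' g δ => !![T (-1) - T 1 * C (expP 1),
        -(cst (g ^ 2) * (C (expP 1) + cst δ) * C (expQ (-1)));
      C (expQ 1), -(T 1 * cst (δ * g ^ 2))]
  | .discToda ε => !![T (-1) - T 1 * C (expP ε), -(cst ε * C (expQ (-1)));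
      cst ε * C (expQ 1), -(cst (ε ^ 2) * T 1)]
  | .discToda' ε => !![T (-1) - T 1 * C (expP ε), -((C (expP ε) - 1) * C (expQ (-1)));
      cst ε * C (expQ 1), T 1 * cst ε]

/-- The condition `ε ≠ 0` on the two discretized families, whose Lax matrices do not depend on
the phase space variables if `ε = 0`. -/
def Lax.Nondegenerate : Lax → Prop
  | .discToda ε => ε ≠ 0
  | .discToda' ε => ε ≠ 0
  | _ => True

/-- Pull-back of functions along the projection `ℝ²ⁿ → ℝ²`, `(q, p) ↦ (q^k, p_k)`. -/
def pull {n : ℕ} (k : Fin n) : Obs 1 →+* Obs n where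
  toFun f := ⟨fun x => f.1 (fun _ => x.1 k, fun _ => x.2 k), by
    have hf : ContDiff ℝ ∞ f.1 := f.2
    exact hf.comp (g := f.1)
      (f := fun x : Phase n => ((fun _ => x.1 k, fun _ => x.2 k) : Phase 1)) (by fun_prop)⟩
  map_one' := rfl
  map_mul' _ _ := rfl
  map_zero' := rfl
  map_add' _ _ := rfl

/-- The matrix `U^k(λ)`. -/
def Lax.site (U : Lax) {n : ℕ} (k : Fin n) : Matrix (Fin 2) (Fin 2) (Obs n)[T;T⁻¹] :=
  U.mat.map (AddMonoidAlgebra.mapRingHom ℤ (pull k))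

/-- The product `U^n(λ) ⋯ U^1(λ)`. -/
def Lax.prod (U : Lax) (n : ℕ) : Matrix (Fin 2) (Fin 2) (Obs n)[T;T⁻¹] :=
  (List.ofFn fun k : Fin n => U.site k).reverse.prod

/-- `χ_n(λ) = tr (U^n(λ) ⋯ U^1(λ))`. -/
def chi (U : Lax) (n : ℕ) : (Obs n)[T;T⁻¹] := (U.prod n).trace

/-- `χ̃_n(λ) = tr (E_11 U^n(λ) ⋯ U^1(λ))`. -/
def chiTilde (U : Lax) (n : ℕ) : (Obs n)[T;T⁻¹] :=
  (Matrix.single (0 : Fin 2) (0 : Fin 2) 1 * U.prod n).trace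

/-- The star polynomials in the coefficients of `P`, for the Weyl star product: the elements
obtained from the coefficients and the scalars in `ℂ[[ħ]]` by sums and star products. -/
inductive IsStarPolynomial {n : ℕ} (P : (Obs n)[T;T⁻¹]) : QObs n → Prop
  | coeff (k : ℤ) : IsStarPolynomial P (cl (P.coeff k))
  | scalar (c : PowerSeries ℂ) : IsStarPolynomial P (PowerSeries.map (algebraMap ℂ (Obs n)) c)
  | add {F G : QObs n} : IsStarPolynomial P F → IsStarPolynomial P G → IsStarPolynomial P (F + G)
  | mul {F G : QObs n} : IsStarPolynomial P F → IsStarPolynomial P G →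
      IsStarPolynomial P (starMul (weyl n) F G)

/-! ### The Toda chains -/

/-- The Hamilton function of the nonperiodic Toda chain,
`(1/2) ∑_{i=1}^n p_i^2 + ∑_{i=1}^{n-1} e^{q_i - q_{i+1}}`. -/
def todaH (n : ℕ) : Obs n :=
  ⟨fun x => (((1 / 2) * ∑ i, x.2 i ^ 2 +
      ∑ i : Fin n, ∑ j : Fin n, if (i : ℕ) + 1 = j then Real.exp (x.1 i - x.1 j) else 0 : ℝ) : ℂ), by
    change ContDiff ℝ ∞ _
    refine Complex.ofRealCLM.contDiff.comp (ContDiff.add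
      (contDiff_const.mul (ContDiff.sum fun i _ => ContDiff.pow (by fun_prop) 2)) ?_)
    refine ContDiff.sum fun i _ => ContDiff.sum fun j _ => ?_
    split_ifs <;> fun_prop⟩

/-- The Hamilton function of the periodic Toda chain,
`(1/2) ∑_{i=1}^n p_i^2 + ∑_{i=1}^n e^{q_i - q_{i+1}}` with `q_{n+1} = q_1`. -/
def periodicTodaH (n : ℕ) : Obs n :=
  ⟨fun x => (((1 / 2) * ∑ i, x.2 i ^ 2 +
      ∑ i : Fin n, Real.exp (x.1 i - x.1 (finRotate n i)) : ℝ) : ℂ), by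
    change ContDiff ℝ ∞ _
    refine Complex.ofRealCLM.contDiff.comp (ContDiff.add
      (contDiff_const.mul (ContDiff.sum fun i _ => ContDiff.pow (by fun_prop) 2)) ?_)
    exact ContDiff.sum fun i _ => by fun_prop⟩

end QToda

end

noncomputable section

namespace QToda

/-! ### Partial derivatives of observables -/

/-! The Weyl product is multiplication after exp(iħP/2), where P is the Poisson tensor. By the
Leibniz rule, both bracketings of a triple product are multiplication after the exponential of P₁₂ +
P₁₃ + P₂₃. Constant coefficient operators commute, so the exponents add (`weyl_assoc`).

Commutation rests on an exchange relation R A₁B₂ = B₂A₁R in the Weyl algebra, where A and B are the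
Lax matrix at spectral values z and w, and R is a six-vertex matrix with entries in ℂ[[ħ]]. All Lax
matrices lie in two families. In one, [p, e^{aq}] = -iħa e^{aq} yields a rational R
(`exchange_todaLax`). In the other, e^{εp} and e^{±q} commute up to a factor exp(±iεħ), which yields
a trigonometric R (`exchange_relLax`). Observables of different sites commute and have a pointwise
star product, so the monodromy matrix needs no ordering corrections and inherits the relation
(`Lax.exchange_prod`). If z² ≠ w², then R is invertible because it is so at ħ = 0. Conjugating by R
shows that the traces commute, and the corner of R does the same for the upper left entries. Both
are Laurent polynomials in the spectral parameter, so commutation at infinitely many values gives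
commutation of all coefficients (`Lax.commute_coeff`). Commutation passes to star polynomials, and
at first order in ħ it gives the classical involution.

For independence, a power of λ and a diagonal gauge turn the Lax matrix at a point into a pencil
Y(q) + zφ(p)X(q) of degree at most 1 in z = λ^d (`Pencil`). The coefficient of z⁰ in the spectral
polynomial is constant, and those of z¹, …, zⁿ are multi-affine in the φ(p_k), the one of z^j having
degree at most j. For a dense set of q the monomial φ(p_1)⋯φ(p_j) occurs in it. Setting φ(p_i) =
t^{w_i} with decreasing weights and letting t → ∞, the rescaled Jacobian becomes triangular and
invertible. Its determinant is therefore a nonzero polynomial, which cannot vanish on a box of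
infinite sets (`functionallyIndependent_of_multiaffine`).

For the Toda chains, the two highest nonconstant coefficients are, up to sign, the total momentum
and half its square minus the Hamiltonian. The momentum has the same star square and pointwise
square, so H is a star polynomial without quantum corrections (`isStarPolynomial_toda_of_eq`). -/

lemma Obs.ext {n : ℕ} {f g : Obs n} (h : ∀ x, f.1 x = g.1 x) : f = g :=
  Subtype.ext (funext h)

lemma Obs.differentiable {n : ℕ} (f : Obs n) : Differentiable ℝ f.1 :=
  ContDiff.differentiable (n := ∞) f.2 (by simp)

lemma pd_mul {n : ℕ} (v : Phase n) (f g : Obs n) :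
    pd v (f * g) = pd v f * g + f * pd v g := by
  refine Obs.ext fun x => ?_
  change fderiv ℝ (f.1 * g.1) x v = fderiv ℝ f.1 x v * g.1 x + f.1 x * fderiv ℝ g.1 x v
  rw [fderiv_mul (f.differentiable x) (g.differentiable x)]
  simp [mul_comm, add_comm]

lemma pd_algebraMap {n : ℕ} (v : Phase n) (c : ℂ) : pd v (algebraMap ℂ (Obs n) c) = 0 := by
  refine Obs.ext fun x => ?_
  change fderiv ℝ (fun _ : Phase n => c) x v = 0
  simp

lemma pd_one {n : ℕ} (v : Phase n) : pd v (1 : Obs n) = 0 := by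
  rw [← map_one (algebraMap ℂ (Obs n)), pd_algebraMap]

lemma pd_comm {n : ℕ} (v w : Phase n) (f : Obs n) : pd v (pd w f) = pd w (pd v f) := by
  refine Obs.ext fun x => ?_
  have hf : ContDiff ℝ ∞ f.1 := f.2
  have hd : Differentiable ℝ (fderiv ℝ f.1) :=
    (hf.fderiv_right (m := ∞) (by simp)).differentiable (by simp)
  have key : ∀ a b : Phase n, (pd a (pd b f)).1 x = fderiv ℝ (fderiv ℝ f.1) x a b := by
    intro a b
    change fderiv ℝ (fun y => fderiv ℝ f.1 y b) x a = _
    rw [fderiv_clm_apply (hd x) (by fun_prop)]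
    simp
  rw [key, key]
  have hs : IsSymmSndFDerivAt ℝ f.1 x :=
    hf.contDiffAt.isSymmSndFDerivAt (by
      rw [minSmoothness_of_isRCLikeNormedField]; exact WithTop.coe_le_coe.mpr le_top)
  exact hs v w

/-! ### The Weyl product is given by bidifferential operators -/

/-- Bidifferential operators, as sums of products of iterated derivatives. -/
def IsBidifferential {n : ℕ} (B : Obs n → Obs n → Obs n) : Prop :=
  ∃ c : (List (Phase n) × List (Phase n)) →₀ Obs n,
    ∀ f g, B f g = c.sum fun w a => a * iterPd w.1 f * iterPd w.2 g

lemma IsBidifferential.add {n : ℕ} {B B' : Obs n → Obs n → Obs n} (h : IsBidifferential B)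
    (h' : IsBidifferential B') : IsBidifferential fun f g => B f g + B' f g := by
  classical
  obtain ⟨c, hc⟩ := h
  obtain ⟨c', hc'⟩ := h'
  refine ⟨c + c', fun f g => ?_⟩
  rw [Finsupp.sum_add_index' (by simp) (by intros; ring), ← hc, ← hc']

lemma IsBidifferential.smul {n : ℕ} {B : Obs n → Obs n → Obs n} (h : IsBidifferential B)
    (a : ℂ) : IsBidifferential fun f g => a • B f g := by
  obtain ⟨c, hc⟩ := h
  refine ⟨a • c, fun f g => ?_⟩
  rw [Finsupp.sum_smul_index' (by simp)]
  simp only [hc, Finsupp.smul_sum, smul_mul_assoc]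

lemma IsBidifferential.zero {n : ℕ} : IsBidifferential fun _ _ : Obs n => 0 :=
  ⟨0, by simp⟩

lemma IsBidifferential.sum {n : ℕ} {ι : Type*} (s : Finset ι) {B : ι → Obs n → Obs n → Obs n}
    (h : ∀ i, IsBidifferential (B i)) : IsBidifferential fun f g => ∑ i ∈ s, B i f g := by
  classical
  induction s using Finset.induction_on with
  | empty => simpa using IsBidifferential.zero
  | insert i s hi ih => simpa [Finset.sum_insert hi] using (h i).add ih

lemma iterPd_append {n : ℕ} (w : List (Phase n)) (v : Phase n) (f : Obs n) :
    iterPd (w ++ [v]) f = iterPd w (pd v f) := by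
  simp [iterPd]

/-- `iterPd` folds from the right, so a derivative applied first is appended at the end of the list.
-/
lemma IsBidifferential.comp_pd {n : ℕ} {B : Obs n → Obs n → Obs n} (h : IsBidifferential B)
    (v w : Phase n) : IsBidifferential fun f g => B (pd v f) (pd w g) := by
  classical
  obtain ⟨c, hc⟩ := h
  refine ⟨c.mapDomain fun u => (u.1 ++ [v], u.2 ++ [w]), fun f g => ?_⟩
  rw [Finsupp.sum_mapDomain_index (by simp) (by intros; ring)]
  simp only [hc, iterPd_append]

lemma poissonTensor_tmul {n : ℕ} (f g : Obs n) :
    poissonTensor n (f ⊗ₜ g) = ∑ j, (dq j f ⊗ₜ dp j g - dp j f ⊗ₜ dq j g) := by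
  simp [poissonTensor, LinearMap.sum_apply]

lemma isBidifferential_poissonTensor_pow {n : ℕ} (m : ℕ) :
    IsBidifferential fun f g : Obs n =>
      LinearMap.mul' ℂ (Obs n) ((poissonTensor n ^ m) (f ⊗ₜ g)) := by
  induction m with
  | zero =>
    refine ⟨Finsupp.single ([], []) 1, fun f g => ?_⟩
    rw [Finsupp.sum_single_index (by simp)]
    simp [iterPd]
  | succ m ih =>
    have h := IsBidifferential.sum Finset.univ (fun j : Fin n =>
      (ih.comp_pd (Pi.single j 1, 0) (0, Pi.single j 1)).add
        ((ih.comp_pd (0, Pi.single j 1) (Pi.single j 1, 0)).smul (-1)))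
    convert h using 3 with f g
    rw [pow_succ, Module.End.mul_apply, poissonTensor_tmul, map_sum, map_sum]
    refine Finset.sum_congr rfl fun j _ => ?_
    rw [map_sub, map_sub, neg_one_smul, sub_eq_add_neg]
    rfl

lemma weyl_apply {n : ℕ} (m : ℕ) (f g : Obs n) : weyl n m f g =
    ((m.factorial : ℂ)⁻¹ * (Complex.I / 2) ^ m) •
      LinearMap.mul' ℂ (Obs n) ((poissonTensor n ^ m) (f ⊗ₜ g)) := rfl

lemma weyl_zero {n : ℕ} (f g : Obs n) : weyl n 0 f g = f * g := by
  simp [weyl_apply]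

lemma weyl_one {n : ℕ} (f g : Obs n) : weyl n 1 f g = (Complex.I / 2) • poisson f g := by
  simp [weyl_apply, poissonTensor_tmul, poisson]

lemma poisson_antisymm {n : ℕ} (f g : Obs n) : poisson g f = -poisson f g := by
  simp only [poisson, ← Finset.sum_neg_distrib]
  exact Finset.sum_congr rfl fun j _ => by ring

/-- If the Poisson tensor annihilates `f ⊗ g`, then their Weyl product is the pointwise one. -/
lemma weyl_eq_zero {n m : ℕ} (hm : 1 ≤ m) {f g : Obs n} (h : poissonTensor n (f ⊗ₜ g) = 0) :
    weyl n m f g = 0 := by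
  obtain ⟨k, rfl⟩ := Nat.exists_eq_add_of_le' hm
  rw [weyl_apply, pow_succ (poissonTensor n), Module.End.mul_apply, h]
  simp

/-! ### Associativity of the Weyl product -/

/-- The coproduct `d ⊗ 1 + 1 ⊗ d` of an operator. -/
def leibniz {n : ℕ} (d : Obs n →ₗ[ℂ] Obs n) : Obs n ⊗[ℂ] Obs n →ₗ[ℂ] Obs n ⊗[ℂ] Obs n :=
  TensorProduct.map d LinearMap.id + TensorProduct.map LinearMap.id d

lemma mul'_comp_leibniz {n : ℕ} (v : Phase n) :
    pd v ∘ₗ LinearMap.mul' ℂ (Obs n) = LinearMap.mul' ℂ (Obs n) ∘ₗ leibniz (pd v) := by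
  ext f g
  simp [leibniz, pd_mul]

/-- The sum of the Poisson tensors of the factors 1, 3 and 2, 3. -/
def poissonLeft (n : ℕ) : (Obs n ⊗[ℂ] Obs n) ⊗[ℂ] Obs n →ₗ[ℂ] (Obs n ⊗[ℂ] Obs n) ⊗[ℂ] Obs n :=
  ∑ j : Fin n, (TensorProduct.map (leibniz (dq j)) (dp j) -
    TensorProduct.map (leibniz (dp j)) (dq j))

/-- The sum of the Poisson tensors of the factors 1, 2 and 1, 3. -/
def poissonRight (n : ℕ) : Obs n ⊗[ℂ] (Obs n ⊗[ℂ] Obs n) →ₗ[ℂ] Obs n ⊗[ℂ] (Obs n ⊗[ℂ] Obs n) :=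
  ∑ j : Fin n, (TensorProduct.map (dq j) (leibniz (dp j)) -
    TensorProduct.map (dp j) (leibniz (dq j)))

/-- The multiplication of the first two factors. -/
def mulLeft (n : ℕ) : (Obs n ⊗[ℂ] Obs n) ⊗[ℂ] Obs n →ₗ[ℂ] Obs n ⊗[ℂ] Obs n :=
  TensorProduct.map (LinearMap.mul' ℂ (Obs n)) LinearMap.id

/-- The multiplication of the last two factors. -/
def mulRight (n : ℕ) : Obs n ⊗[ℂ] (Obs n ⊗[ℂ] Obs n) →ₗ[ℂ] Obs n ⊗[ℂ] Obs n :=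
  TensorProduct.map LinearMap.id (LinearMap.mul' ℂ (Obs n))

lemma mul'_leibniz_apply {n : ℕ} (v : Phase n) (t : Obs n ⊗[ℂ] Obs n) :
    LinearMap.mul' ℂ (Obs n) (leibniz (pd v) t) = pd v (LinearMap.mul' ℂ (Obs n) t) :=
  (LinearMap.congr_fun (mul'_comp_leibniz v) t).symm

/-- By the Leibniz rule a derivative passes through multiplication as its coproduct. Hence the
Poisson tensor, pulled through the product of the first two factors, becomes P₁₃ + P₂₃. -/
lemma poissonTensor_mulLeft (n : ℕ) (t : (Obs n ⊗[ℂ] Obs n) ⊗[ℂ] Obs n) :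
    poissonTensor n (mulLeft n t) = mulLeft n (poissonLeft n t) := by
  induction t with
  | zero => simp
  | add a b ha hb => simp only [map_add, ha, hb]
  | tmul t h =>
    have h1 : mulLeft n (t ⊗ₜ h) = (LinearMap.mul' ℂ (Obs n) t) ⊗ₜ h := rfl
    rw [h1, poissonTensor_tmul, poissonLeft, LinearMap.sum_apply, map_sum]
    refine Finset.sum_congr rfl fun j _ => ?_
    simp [mulLeft, dq, dp, mul'_leibniz_apply]

lemma poissonTensor_mulRight (n : ℕ) (t : Obs n ⊗[ℂ] (Obs n ⊗[ℂ] Obs n)) :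
    poissonTensor n (mulRight n t) = mulRight n (poissonRight n t) := by
  induction t with
  | zero => simp
  | add a b ha hb => simp only [map_add, ha, hb]
  | tmul h t =>
    have h1 : mulRight n (h ⊗ₜ t) = h ⊗ₜ (LinearMap.mul' ℂ (Obs n) t) := rfl
    rw [h1, poissonTensor_tmul, poissonRight, LinearMap.sum_apply, map_sum]
    refine Finset.sum_congr rfl fun j _ => ?_
    simp [mulRight, dq, dp, mul'_leibniz_apply]

lemma pow_intertwine {V W : Type*} [AddCommGroup V] [Module ℂ V] [AddCommGroup W] [Module ℂ W]
    {φ : V →ₗ[ℂ] W} {a : V →ₗ[ℂ] V} {b : W →ₗ[ℂ] W} (h : ∀ t, b (φ t) = φ (a t)) (m : ℕ) (t : V) :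
    (b ^ m) (φ t) = φ ((a ^ m) t) := by
  induction m generalizing t with
  | zero => rfl
  | succ m ih => rw [pow_succ, pow_succ, Module.End.mul_apply, Module.End.mul_apply, h, ih]

lemma leibniz_comm_poissonTensor {n : ℕ} (v : Phase n) :
    poissonTensor n ∘ₗ leibniz (pd v) = leibniz (pd v) ∘ₗ poissonTensor n := by
  ext f g
  simp only [leibniz, TensorProduct.AlgebraTensorModule.curry_apply, LinearMap.restrictScalars_self,
    TensorProduct.curry_apply, LinearMap.comp_apply, LinearMap.add_apply, TensorProduct.map_tmul,
    LinearMap.id_apply, map_add, poissonTensor_tmul, map_sum, map_sub, dq, dp, pd_comm v,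
    Finset.sum_sub_distrib, Finset.sum_add_distrib]
  abel

lemma commute_poissonLeft (n : ℕ) :
    Commute (poissonLeft n) (LinearMap.rTensor (Obs n) (poissonTensor n)) := by
  refine LinearMap.ext fun t => ?_
  induction t with
  | zero => simp
  | add a b ha hb => rw [map_add, map_add, ha, hb]
  | tmul t h =>
    have key : ∀ v, poissonTensor n (leibniz (pd v) t) = leibniz (pd v) (poissonTensor n t) :=
      fun v => LinearMap.congr_fun (leibniz_comm_poissonTensor v) t
    simp only [poissonLeft, Module.End.mul_apply, LinearMap.rTensor_tmul, LinearMap.sum_apply,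
      LinearMap.sub_apply, TensorProduct.map_tmul, map_sum, map_sub, dq, dp, key]

lemma commute_poissonRight (n : ℕ) :
    Commute (poissonRight n) (LinearMap.lTensor (Obs n) (poissonTensor n)) := by
  refine LinearMap.ext fun t => ?_
  induction t with
  | zero => simp
  | add a b ha hb => rw [map_add, map_add, ha, hb]
  | tmul h t =>
    have key : ∀ v, poissonTensor n (leibniz (pd v) t) = leibniz (pd v) (poissonTensor n t) :=
      fun v => LinearMap.congr_fun (leibniz_comm_poissonTensor v) t
    simp only [poissonRight, Module.End.mul_apply, LinearMap.lTensor_tmul, LinearMap.sum_apply,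
      LinearMap.sub_apply, TensorProduct.map_tmul, map_sum, map_sub, dq, dp, key]

/-- Both bracketings carry the same operator P₁₂ + P₁₃ + P₂₃. -/
lemma assoc_poisson (n : ℕ) (t : (Obs n ⊗[ℂ] Obs n) ⊗[ℂ] Obs n) :
    (poissonRight n + LinearMap.lTensor (Obs n) (poissonTensor n))
        (TensorProduct.assoc ℂ (Obs n) (Obs n) (Obs n) t) =
      TensorProduct.assoc ℂ (Obs n) (Obs n) (Obs n)
        ((poissonLeft n + LinearMap.rTensor (Obs n) (poissonTensor n)) t) := by
  have : (poissonRight n + LinearMap.lTensor (Obs n) (poissonTensor n)) ∘ₗ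
        (TensorProduct.assoc ℂ (Obs n) (Obs n) (Obs n)).toLinearMap =
      (TensorProduct.assoc ℂ (Obs n) (Obs n) (Obs n)).toLinearMap ∘ₗ
        (poissonLeft n + LinearMap.rTensor (Obs n) (poissonTensor n)) := by
    refine TensorProduct.ext_threefold fun f g h => ?_
    simp only [poissonRight, poissonLeft, LinearMap.comp_apply, LinearMap.add_apply,
      LinearEquiv.coe_coe, TensorProduct.assoc_tmul, LinearMap.lTensor_tmul,
      LinearMap.rTensor_tmul, LinearMap.sum_apply, LinearMap.sub_apply, TensorProduct.map_tmul,
      leibniz, poissonTensor_tmul, TensorProduct.sum_tmul, TensorProduct.tmul_sum,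
      TensorProduct.sub_tmul, TensorProduct.tmul_sub, TensorProduct.add_tmul,
      TensorProduct.tmul_add, LinearMap.id_apply, map_add, map_sum, map_sub,
      ← Finset.sum_add_distrib]
    exact Finset.sum_congr rfl fun j _ => by abel
  exact LinearMap.congr_fun this t

lemma mul'_mulLeft (n : ℕ) (t : (Obs n ⊗[ℂ] Obs n) ⊗[ℂ] Obs n) :
    LinearMap.mul' ℂ (Obs n) (mulLeft n t) = LinearMap.mul' ℂ (Obs n)
      (mulRight n (TensorProduct.assoc ℂ (Obs n) (Obs n) (Obs n) t)) := by
  have : LinearMap.mul' ℂ (Obs n) ∘ₗ mulLeft n = LinearMap.mul' ℂ (Obs n) ∘ₗ mulRight n ∘ₗ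
      (TensorProduct.assoc ℂ (Obs n) (Obs n) (Obs n)).toLinearMap :=
    TensorProduct.ext_threefold fun f g h => by simp [mulLeft, mulRight, mul_assoc]
  exact LinearMap.congr_fun this t

/-- The coefficients of the exponential `exp(i ħ x / 2)`. -/
def expCoeff (m : ℕ) : ℂ := (m.factorial : ℂ)⁻¹ * (Complex.I / 2) ^ m

/-- This is exp(x) exp(y) = exp(x + y) in degree m, by the binomial theorem for commuting elements.
-/
lemma sum_expCoeff_of_commute {R : Type*} [Semiring R] [Algebra ℂ R] {x y : R} (h : Commute x y)
    (m : ℕ) : ∑ c ∈ Finset.HasAntidiagonal.antidiagonal m,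
      (expCoeff c.1 * expCoeff c.2) • (x ^ c.1 * y ^ c.2) = expCoeff m • (x + y) ^ m := by
  rw [h.add_pow', Finset.smul_sum]
  refine Finset.sum_congr rfl fun c hc => ?_
  rw [Finset.HasAntidiagonal.mem_antidiagonal] at hc
  rw [← Nat.cast_smul_eq_nsmul ℂ, smul_smul]
  congr 1
  subst hc
  have h1 : ((c.1 + c.2).choose c.1 : ℂ) * (c.1.factorial : ℂ) * (c.2.factorial : ℂ) =
      ((c.1 + c.2).factorial : ℂ) := by
    rw [Nat.choose_symm_add]
    exact_mod_cast Nat.add_choose_mul_factorial_mul_factorial c.1 c.2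
  have h2 : (c.1.factorial : ℂ) ≠ 0 := by exact_mod_cast c.1.factorial_ne_zero
  have h3 : (c.2.factorial : ℂ) ≠ 0 := by exact_mod_cast c.2.factorial_ne_zero
  have h4 : ((c.1 + c.2).factorial : ℂ) ≠ 0 := by exact_mod_cast (c.1 + c.2).factorial_ne_zero
  simp only [expCoeff]
  rw [pow_add]
  field_simp
  linear_combination -h1

/-- The inner product contributes exp(P₁₂) or exp(P₂₃) and the outer one the exponential of the two
remaining terms. The commuting exponentials combine into the same symmetric expression on both
sides. -/
lemma weyl_assoc {n : ℕ} (m : ℕ) (f g h : Obs n) :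
    ∑ c ∈ Finset.HasAntidiagonal.antidiagonal m, weyl n c.1 (weyl n c.2 f g) h =
      ∑ c ∈ Finset.HasAntidiagonal.antidiagonal m, weyl n c.1 f (weyl n c.2 g h) := by
  have hl : ∀ c : ℕ × ℕ, weyl n c.1 (weyl n c.2 f g) h =
      LinearMap.mul' ℂ (Obs n) (mulLeft n (((expCoeff c.1 * expCoeff c.2) • (poissonLeft n ^ c.1 *
        LinearMap.rTensor (Obs n) (poissonTensor n) ^ c.2)) ((f ⊗ₜ g) ⊗ₜ h))) := by
    intro c
    have h1 : LinearMap.mul' ℂ (Obs n) ((poissonTensor n ^ c.2) (f ⊗ₜ g)) ⊗ₜ[ℂ] h =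
        mulLeft n (((LinearMap.rTensor (Obs n) (poissonTensor n)) ^ c.2) ((f ⊗ₜ g) ⊗ₜ h)) := by
      rw [LinearMap.rTensor_pow, LinearMap.rTensor_tmul]; rfl
    rw [weyl_apply, weyl_apply, ← TensorProduct.smul_tmul', h1, map_smul, map_smul,
      pow_intertwine (poissonTensor_mulLeft n), smul_smul, LinearMap.smul_apply, map_smul,
      map_smul]
    rfl
  have hr : ∀ c : ℕ × ℕ, weyl n c.1 f (weyl n c.2 g h) =
      LinearMap.mul' ℂ (Obs n) (mulRight n (((expCoeff c.1 * expCoeff c.2) •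
        (poissonRight n ^ c.1 *
        LinearMap.lTensor (Obs n) (poissonTensor n) ^ c.2)) (f ⊗ₜ (g ⊗ₜ h)))) := by
    intro c
    have h1 : f ⊗ₜ[ℂ] LinearMap.mul' ℂ (Obs n) ((poissonTensor n ^ c.2) (g ⊗ₜ h)) =
        mulRight n (((LinearMap.lTensor (Obs n) (poissonTensor n)) ^ c.2) (f ⊗ₜ (g ⊗ₜ h))) := by
      rw [LinearMap.lTensor_pow, LinearMap.lTensor_tmul]; rfl
    rw [weyl_apply, weyl_apply, TensorProduct.tmul_smul, h1, map_smul, map_smul,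
      pow_intertwine (poissonTensor_mulRight n), smul_smul, LinearMap.smul_apply, map_smul,
      map_smul]
    rfl
  simp only [hl, hr]
  have el := sum_expCoeff_of_commute (commute_poissonLeft n) m
  have er := sum_expCoeff_of_commute (commute_poissonRight n) m
  replace el := LinearMap.congr_fun el ((f ⊗ₜ g) ⊗ₜ h)
  replace er := LinearMap.congr_fun er (f ⊗ₜ (g ⊗ₜ h))
  rw [LinearMap.sum_apply] at el er
  rw [← map_sum, ← map_sum, ← map_sum, ← map_sum]
  refine (congrArg _ (congrArg _ el)).trans (Eq.trans ?_ (congrArg _ (congrArg _ er)).symm)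
  rw [mul'_mulLeft]
  simp only [LinearMap.smul_apply, map_smul]
  rw [← TensorProduct.assoc_tmul]
  exact congrArg (fun t => expCoeff m • LinearMap.mul' ℂ (Obs n) (mulRight n t))
    (pow_intertwine (φ := (TensorProduct.assoc ℂ (Obs n) (Obs n) (Obs n)).toLinearMap)
      (assoc_poisson n) m _).symm

/-! ### Products of formal series -/

section Series

variable {n : ℕ} (M : ℕ → Obs n →ₗ[ℂ] Obs n →ₗ[ℂ] Obs n)

lemma coeff_starMul (F G : QObs n) (m : ℕ) : PowerSeries.coeff m (starMul M F G) =
    ∑ c ∈ Finset.HasAntidiagonal.antidiagonal m,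
      ∑ ab ∈ Finset.HasAntidiagonal.antidiagonal c.1,
        M c.2 (PowerSeries.coeff ab.1 F) (PowerSeries.coeff ab.2 G) := by
  simp [starMul]

lemma starMul_add (F G H : QObs n) : starMul M F (G + H) = starMul M F G + starMul M F H := by
  ext1 m
  simp [coeff_starMul, Finset.sum_add_distrib]

lemma add_starMul (F G H : QObs n) : starMul M (F + G) H = starMul M F H + starMul M G H := by
  ext1 m
  simp [coeff_starMul, Finset.sum_add_distrib]

lemma X_mul_starMul (F G : QObs n) :
    starMul M (PowerSeries.X * F) G = PowerSeries.X * starMul M F G := by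
  ext1 m
  cases m with
  | zero => simp [coeff_starMul]
  | succ m =>
    rw [PowerSeries.coeff_succ_X_mul, coeff_starMul, coeff_starMul,
      Finset.Nat.antidiagonal_succ, Finset.sum_cons]
    simp [Finset.Nat.antidiagonal_succ]

lemma starMul_X_mul (F G : QObs n) :
    starMul M F (PowerSeries.X * G) = PowerSeries.X * starMul M F G := by
  ext1 m
  cases m with
  | zero => simp [coeff_starMul]
  | succ m =>
    rw [PowerSeries.coeff_succ_X_mul, coeff_starMul, coeff_starMul,
      Finset.Nat.antidiagonal_succ, Finset.sum_cons]
    simp [Finset.Nat.antidiagonal_succ']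

lemma coeff_cl (f : Obs n) (m : ℕ) :
    PowerSeries.coeff m (cl f) = if m = 0 then f else 0 := by
  rw [cl, PowerSeries.coeff_C]

lemma coeff_cl_starMul (f : Obs n) (G : QObs n) (m : ℕ) :
    PowerSeries.coeff m (starMul M (cl f) G) =
      ∑ c ∈ Finset.HasAntidiagonal.antidiagonal m, M c.2 f (PowerSeries.coeff c.1 G) := by
  rw [coeff_starMul]
  refine Finset.sum_congr rfl fun c _ => ?_
  rw [Finset.sum_eq_single (0, c.1)]
  · simp [coeff_cl]
  · rintro ⟨a, b⟩ hab hne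
    rw [Finset.HasAntidiagonal.mem_antidiagonal] at hab
    have : a ≠ 0 := by rintro rfl; simp_all
    simp [coeff_cl, this]
  · simp

lemma coeff_starMul_cl (F : QObs n) (g : Obs n) (m : ℕ) :
    PowerSeries.coeff m (starMul M F (cl g)) =
      ∑ c ∈ Finset.HasAntidiagonal.antidiagonal m, M c.2 (PowerSeries.coeff c.1 F) g := by
  rw [coeff_starMul]
  refine Finset.sum_congr rfl fun c _ => ?_
  rw [Finset.sum_eq_single (c.1, 0)]
  · simp [coeff_cl]
  · rintro ⟨a, b⟩ hab hne
    rw [Finset.HasAntidiagonal.mem_antidiagonal] at hab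
    have : b ≠ 0 := by rintro rfl; simp_all
    simp [coeff_cl, this]
  · simp

lemma coeff_cl_starMul_cl (f g : Obs n) (m : ℕ) :
    PowerSeries.coeff m (starMul M (cl f) (cl g)) = M m f g := by
  rw [coeff_cl_starMul, Finset.sum_eq_single (0, m)]
  · simp [coeff_cl]
  · rintro ⟨a, b⟩ hab hne
    rw [Finset.HasAntidiagonal.mem_antidiagonal] at hab
    have : a ≠ 0 := by rintro rfl; simp_all
    simp [coeff_cl, this]
  · simp

lemma exists_eq_cl_add (F : QObs n) : ∃ f F', F = cl f + PowerSeries.X * F' := by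
  obtain ⟨F', hF'⟩ := PowerSeries.X_dvd_iff.mpr
    (show PowerSeries.constantCoeff (F - cl (PowerSeries.constantCoeff F)) = 0 by simp [cl])
  exact ⟨PowerSeries.constantCoeff F, F', by rw [← hF']; ring⟩

/-- Each argument splits as its classical part plus ħ times a series. A factor ħ comes out of the
product and lowers the order to be checked, so strong induction on the order disposes of it, one
argument at a time. -/
lemma starMul_assoc_of_classical
    (h : ∀ m f g k, ∑ c ∈ Finset.HasAntidiagonal.antidiagonal m, M c.1 (M c.2 f g) k =
      ∑ c ∈ Finset.HasAntidiagonal.antidiagonal m, M c.1 f (M c.2 g k)) (F G H : QObs n) :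
    starMul M (starMul M F G) H = starMul M F (starMul M G H) := by
  ext1 m
  induction m using Nat.strong_induction_on generalizing F G H with
  | _ m ih =>
    have hX : ∀ F G H : QObs n,
        PowerSeries.coeff m (PowerSeries.X * starMul M (starMul M F G) H) =
          PowerSeries.coeff m (PowerSeries.X * starMul M F (starMul M G H)) := by
      intro F G H
      cases m with
      | zero => simp
      | succ m => simpa [PowerSeries.coeff_succ_X_mul] using ih m (Nat.lt_succ_self m) F G H
    have h1 : ∀ f g k : Obs n,
        PowerSeries.coeff m (starMul M (starMul M (cl f) (cl g)) (cl k)) =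
          PowerSeries.coeff m (starMul M (cl f) (starMul M (cl g) (cl k))) := by
      intro f g k
      rw [coeff_starMul_cl, coeff_cl_starMul]
      simp only [coeff_cl_starMul_cl]
      -- The coefficient formulas list the order of the outer operator second, the hypothesis lists
      -- it first.
      rw [← Finset.Nat.sum_antidiagonal_swap,
        ← Finset.Nat.sum_antidiagonal_swap (f := fun c => M c.2 f (M c.1 g k))]
      exact h m f g k
    have h2 : ∀ (f g : Obs n) (H : QObs n),
        PowerSeries.coeff m (starMul M (starMul M (cl f) (cl g)) H) =
          PowerSeries.coeff m (starMul M (cl f) (starMul M (cl g) H)) := by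
      intro f g H
      obtain ⟨k, H', rfl⟩ := exists_eq_cl_add H
      simp only [starMul_add, starMul_X_mul, map_add, hX, h1]
    have h3 : ∀ (f : Obs n) (G H : QObs n),
        PowerSeries.coeff m (starMul M (starMul M (cl f) G) H) =
          PowerSeries.coeff m (starMul M (cl f) (starMul M G H)) := by
      intro f G H
      obtain ⟨g, G', rfl⟩ := exists_eq_cl_add G
      simp only [starMul_add, add_starMul, X_mul_starMul, starMul_X_mul, map_add, hX, h2]
    obtain ⟨f, F', rfl⟩ := exists_eq_cl_add F
    simp only [add_starMul, X_mul_starMul, map_add, hX, h3]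

end Series

lemma isStarProduct_weyl (n : ℕ) : IsStarProduct (weyl n) where
  bidifferential m := by
    obtain ⟨c, hc⟩ := (isBidifferential_poissonTensor_pow (n := n) m).smul
      ((m.factorial : ℂ)⁻¹ * (Complex.I / 2) ^ m)
    exact ⟨c.support, c, hc⟩
  classical := weyl_zero
  commutator f g := by
    rw [weyl_one, weyl_one, poisson_antisymm f g, smul_neg, sub_neg_eq_add, ← add_smul]
    congr 1
    ring
  one_left m hm f := weyl_eq_zero hm (by simp [poissonTensor_tmul, dq, dp, pd_one])
  one_right m hm f := weyl_eq_zero hm (by simp [poissonTensor_tmul, dq, dp, pd_one])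
  assoc := starMul_assoc_of_classical _ weyl_assoc

/-! ### The Weyl algebra as a ring -/

lemma weyl_algebraMap_left {n m : ℕ} (hm : 1 ≤ m) (z : ℂ) (f : Obs n) :
    weyl n m (algebraMap ℂ (Obs n) z) f = 0 :=
  weyl_eq_zero hm (by simp [poissonTensor_tmul, dq, dp, pd_algebraMap])

lemma weyl_algebraMap_right {n m : ℕ} (hm : 1 ≤ m) (z : ℂ) (f : Obs n) :
    weyl n m f (algebraMap ℂ (Obs n) z) = 0 :=
  weyl_eq_zero hm (by simp [poissonTensor_tmul, dq, dp, pd_algebraMap])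

lemma starMul_eq_mul {n : ℕ} {F G : QObs n} (h : ∀ m, 1 ≤ m → ∀ a b,
    weyl n m (PowerSeries.coeff a F) (PowerSeries.coeff b G) = 0) :
    starMul (weyl n) F G = F * G := by
  ext1 m
  rw [coeff_starMul, Finset.sum_eq_single (m, 0)]
  · simp [weyl_zero, PowerSeries.coeff_mul]
  · rintro ⟨a, b⟩ hab hne
    rw [Finset.HasAntidiagonal.mem_antidiagonal] at hab
    have hb : b ≠ 0 := by rintro rfl; simp_all
    exact Finset.sum_eq_zero fun c _ => h b (Nat.one_le_iff_ne_zero.mpr hb) _ _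
  · simp

/-- The scalars `ℂ[[ħ]]` inside the formal observables. -/
def scalar (n : ℕ) : PowerSeries ℂ →+* QObs n := PowerSeries.map (algebraMap ℂ (Obs n))

lemma scalar_starMul {n : ℕ} (c : PowerSeries ℂ) (F : QObs n) :
    starMul (weyl n) (scalar n c) F = scalar n c * F :=
  starMul_eq_mul fun m hm a b => by simpa [scalar] using weyl_algebraMap_left hm _ _

lemma starMul_scalar {n : ℕ} (c : PowerSeries ℂ) (F : QObs n) :
    starMul (weyl n) F (scalar n c) = F * scalar n c :=
  starMul_eq_mul fun m hm a b => by simpa [scalar] using weyl_algebraMap_right hm _ _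

lemma one_starMul {n : ℕ} (F : QObs n) : starMul (weyl n) 1 F = F := by
  rw [← map_one (scalar n), scalar_starMul, map_one, one_mul]

lemma starMul_one {n : ℕ} (F : QObs n) : starMul (weyl n) F 1 = F := by
  rw [← map_one (scalar n), starMul_scalar, map_one, mul_one]

lemma zero_starMul {n : ℕ} (F : QObs n) : starMul (weyl n) 0 F = 0 := by
  rw [← map_zero (scalar n), scalar_starMul, map_zero, zero_mul]

lemma starMul_zero {n : ℕ} (F : QObs n) : starMul (weyl n) F 0 = 0 := by
  rw [← map_zero (scalar n), starMul_scalar, map_zero, mul_zero]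

/-- The formal observables, with the Weyl star product as multiplication. -/
def WeylAlgebra (n : ℕ) : Type := QObs n

instance (n : ℕ) : Ring (WeylAlgebra n) where
  __ := (inferInstanceAs (AddCommGroup (QObs n)) : AddCommGroup (WeylAlgebra n))
  mul := starMul (weyl n)
  one := (1 : QObs n)
  mul_assoc := (isStarProduct_weyl n).assoc
  left_distrib := starMul_add _
  right_distrib := add_starMul _
  one_mul := one_starMul
  mul_one := starMul_one
  zero_mul := zero_starMul
  mul_zero := starMul_zero

/-- The inclusion of the scalars in the Weyl algebra. -/
def scalarHom (n : ℕ) : PowerSeries ℂ →+* WeylAlgebra n where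
  toFun := scalar n
  map_one' := map_one (scalar n)
  map_zero' := map_zero (scalar n)
  map_add' := map_add (scalar n)
  map_mul' c d := (map_mul (scalar n) c d).trans (scalar_starMul c _).symm

instance (n : ℕ) : Algebra (PowerSeries ℂ) (WeylAlgebra n) :=
  (scalarHom n).toAlgebra' fun c F =>
    (scalar_starMul c F).trans ((mul_comm _ _).trans (starMul_scalar c F).symm)

lemma smul_eq_scalar_mul {n : ℕ} (c : PowerSeries ℂ) (F : WeylAlgebra n) :
    c • F = (show QObs n from scalar n c * (show QObs n from F)) :=
  (Algebra.smul_def c F).trans (scalar_starMul c F)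

/-- A classical observable as an element of the Weyl algebra. -/
def quant (n : ℕ) : Obs n →+ WeylAlgebra n where
  toFun f := cl f
  map_zero' := map_zero (PowerSeries.C : Obs n →+* QObs n)
  map_add' := map_add (PowerSeries.C : Obs n →+* QObs n)

lemma quant_mul_quant {n : ℕ} (f g : Obs n) :
    quant n f * quant n g = starMul (weyl n) (cl f) (cl g) := rfl

/-- The coefficient of `ħ^m`. -/
def wcoeff {n : ℕ} (m : ℕ) : WeylAlgebra n →+ Obs n where
  toFun F := PowerSeries.coeff m (show QObs n from F)
  map_zero' := map_zero (PowerSeries.coeff m)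
  map_add' := map_add (PowerSeries.coeff m)

lemma WeylAlgebra.ext {n : ℕ} {F G : WeylAlgebra n}
    (h : ∀ m, wcoeff m F = wcoeff m G) : F = G :=
  PowerSeries.ext h

lemma coeff_quant_mul_quant {n : ℕ} (f g : Obs n) (m : ℕ) :
    wcoeff m (quant n f * quant n g) = weyl n m f g :=
  coeff_cl_starMul_cl _ f g m

lemma quant_one {n : ℕ} : quant n 1 = 1 := map_one (PowerSeries.C : Obs n →+* QObs n)

lemma coeff_quant {n : ℕ} (f : Obs n) (m : ℕ) :
    wcoeff m (quant n f) = if m = 0 then f else 0 := coeff_cl f m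

lemma coeff_smul_quant {n : ℕ} (c : PowerSeries ℂ) (f : Obs n) (m : ℕ) :
    wcoeff m (c • quant n f) = PowerSeries.coeff m c • f := by
  have h : wcoeff m (c • quant n f) =
      PowerSeries.coeff m (scalar n c * PowerSeries.C f : QObs n) :=
    congrArg (wcoeff m) (smul_eq_scalar_mul c (quant n f))
  rw [h, PowerSeries.coeff_mul_C]
  simp [scalar, Algebra.smul_def]

lemma quant_smul {n : ℕ} (z : ℂ) (f : Obs n) :
    quant n (z • f) = (PowerSeries.C z : PowerSeries ℂ) • quant n f := by
  refine WeylAlgebra.ext fun m => ?_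
  refine (coeff_quant _ m).trans (Eq.trans ?_ (coeff_smul_quant _ f m).symm)
  rw [PowerSeries.coeff_C]
  split_ifs <;> simp

lemma quant_mul_of_poissonTensor_eq_zero {n : ℕ} {f g : Obs n}
    (h : poissonTensor n (f ⊗ₜ g) = 0) : quant n f * quant n g = quant n (f * g) := by
  refine WeylAlgebra.ext fun m => ?_
  refine (coeff_quant_mul_quant f g m).trans (Eq.trans ?_ (coeff_quant _ m).symm)
  split_ifs with hm
  · rw [hm, weyl_zero]
  · exact weyl_eq_zero (Nat.one_le_iff_ne_zero.mpr hm) h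

/-- The formal exponential `exp(i z ħ / 2)`. -/
def hexp (z : ℂ) : PowerSeries ℂ := PowerSeries.rescale (Complex.I / 2 * z) (PowerSeries.exp ℂ)

lemma hexp_add (z w : ℂ) : hexp (z + w) = hexp z * hexp w := by
  rw [hexp, mul_add, ← PowerSeries.exp_mul_exp_eq_exp_add]
  rfl

lemma hexp_zero : hexp 0 = 1 := by simp [hexp]

lemma constantCoeff_hexp (z : ℂ) : PowerSeries.constantCoeff (hexp z) = 1 := by
  rw [← PowerSeries.coeff_zero_eq_constantCoeff_apply, hexp, PowerSeries.coeff_rescale]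
  simp

/-- On an eigenvector of the Poisson tensor the exponential acts as the scalar series exp(izħ/2). -/
lemma quant_mul_of_eigen {n : ℕ} {f g : Obs n} {z : ℂ}
    (h : poissonTensor n (f ⊗ₜ g) = z • (f ⊗ₜ g)) :
    quant n f * quant n g = hexp z • quant n (f * g) := by
  refine WeylAlgebra.ext fun m => ?_
  refine (coeff_quant_mul_quant f g m).trans (Eq.trans ?_ (coeff_smul_quant _ _ m).symm)
  have hp : (poissonTensor n ^ m) (f ⊗ₜ g) = z ^ m • (f ⊗ₜ g) := by
    induction m with
    | zero => simp
    | succ m ih => rw [pow_succ (poissonTensor n), Module.End.mul_apply, h, map_smul, ih,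
        smul_smul, pow_succ' z]
  rw [weyl_apply, hp, map_smul, smul_smul, LinearMap.mul'_apply, hexp,
    PowerSeries.coeff_rescale, PowerSeries.coeff_exp]
  congr 1
  simp [mul_pow]
  ring

/-- The deformation parameter `iħ`. -/
def ihbar : PowerSeries ℂ := PowerSeries.C Complex.I * PowerSeries.X

/-- The exponential series stops after its linear term, so the first order formula is exact. -/
lemma quant_mul_of_sq_eq_zero {n : ℕ} {f g : Obs n}
    (h : poissonTensor n (poissonTensor n (f ⊗ₜ g)) = 0) :
    quant n f * quant n g = quant n (f * g) +
      (PowerSeries.C (1 / 2 : ℂ) * ihbar) • quant n (poisson f g) := by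
  refine WeylAlgebra.ext fun m => ?_
  refine (coeff_quant_mul_quant f g m).trans ?_
  rw [map_add, coeff_quant, coeff_smul_quant]
  rw [ihbar, ← mul_assoc, ← map_mul, PowerSeries.coeff_C_mul, PowerSeries.coeff_X]
  match m with
  | 0 => simp [weyl_zero]
  | 1 =>
    rw [weyl_one]
    simp only [one_ne_zero, if_false, if_true, zero_add, mul_one]
    congr 1
    ring
  | m + 2 =>
    rw [weyl_apply, pow_add (poissonTensor n), Module.End.mul_apply, pow_two,
      Module.End.mul_apply, h]
    simp

/-! ### The Weyl algebra of a single site -/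

lemma pd_pull {n : ℕ} (k : Fin n) (v : Phase n) (f : Obs 1) :
    pd v (pull k f) = pull k (pd (fun _ => v.1 k, fun _ => v.2 k) f) := by
  refine Obs.ext fun x => ?_
  let L : Phase n →L[ℝ] Phase 1 := ContinuousLinearMap.prod
    (ContinuousLinearMap.pi fun _ => (ContinuousLinearMap.proj k).comp
      (ContinuousLinearMap.fst ℝ (Fin n → ℝ) (Fin n → ℝ)))
    (ContinuousLinearMap.pi fun _ => (ContinuousLinearMap.proj k).comp
      (ContinuousLinearMap.snd ℝ (Fin n → ℝ) (Fin n → ℝ)))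
  change fderiv ℝ (f.1 ∘ L) x v = fderiv ℝ f.1 (L x) (L v)
  rw [fderiv_comp x (f.differentiable _) L.differentiableAt, L.fderiv]
  rfl

lemma pd_zero {n : ℕ} (f : Obs n) : pd (0 : Phase n) f = 0 :=
  Obs.ext fun x => map_zero (fderiv ℝ f.1 x)

lemma dq_pull_self {n : ℕ} (k : Fin n) (f : Obs 1) : dq k (pull k f) = pull k (dq 0 f) := by
  rw [dq, pd_pull, dq]
  congr 3
  ext i
  · simp [Subsingleton.elim i 0]
  · rfl

lemma dp_pull_self {n : ℕ} (k : Fin n) (f : Obs 1) : dp k (pull k f) = pull k (dp 0 f) := by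
  rw [dp, pd_pull, dp]
  congr 3
  ext i
  · rfl
  · simp [Subsingleton.elim i 0]

lemma dq_pull_of_ne {n : ℕ} {j k : Fin n} (h : j ≠ k) (f : Obs 1) : dq j (pull k f) = 0 := by
  rw [dq, pd_pull, ← map_zero (pull k), ← pd_zero f]
  congr 3
  ext i
  · simp [h.symm]
  · rfl

lemma dp_pull_of_ne {n : ℕ} {j k : Fin n} (h : j ≠ k) (f : Obs 1) : dp j (pull k f) = 0 := by
  rw [dp, pd_pull, ← map_zero (pull k), ← pd_zero f]
  congr 3
  ext i
  · rfl
  · simp [h.symm]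

lemma pull_algebraMap {n : ℕ} (k : Fin n) (z : ℂ) :
    pull k (algebraMap ℂ (Obs 1) z) = algebraMap ℂ (Obs n) z := rfl

/-- `pull` as a linear map. -/
def pullLinear {n : ℕ} (k : Fin n) : Obs 1 →ₗ[ℂ] Obs n where
  toFun := pull k
  map_add' := map_add (pull k)
  map_smul' _ _ := rfl

/-- Only the summand of the site k sees functions of (q^k, p_k). This makes the pull-back
multiplicative for the star products. -/
lemma poissonTensor_pull {n : ℕ} (k : Fin n) (t : Obs 1 ⊗[ℂ] Obs 1) :
    poissonTensor n (TensorProduct.map (pullLinear k) (pullLinear k) t) =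
      TensorProduct.map (pullLinear k) (pullLinear k) (poissonTensor 1 t) := by
  induction t with
  | zero => simp
  | add a b ha hb => simp only [map_add, ha, hb]
  | tmul f g =>
    have h1 : ∀ f, pullLinear k f = pull k f := fun _ => rfl
    rw [TensorProduct.map_tmul, poissonTensor_tmul, poissonTensor_tmul, Finset.sum_eq_single k]
    · simp [h1, dq_pull_self, dp_pull_self]
    · intro j _ hj
      simp [h1, dq_pull_of_ne hj, dp_pull_of_ne hj]
    · simp

lemma weyl_pull {n : ℕ} (k : Fin n) (m : ℕ) (f g : Obs 1) :
    weyl n m (pull k f) (pull k g) = pull k (weyl 1 m f g) := by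
  have h : ∀ t, LinearMap.mul' ℂ (Obs n) (TensorProduct.map (pullLinear k) (pullLinear k) t) =
      pullLinear k (LinearMap.mul' ℂ (Obs 1) t) := by
    intro t
    induction t with
    | zero => simp
    | add a b ha hb => simp only [map_add, ha, hb]
    | tmul f g => exact (map_mul (pull k) f g).symm
  rw [weyl_apply, weyl_apply]
  have h2 := pow_intertwine (poissonTensor_pull k) m (f ⊗ₜ g)
  rw [TensorProduct.map_tmul] at h2
  change _ • LinearMap.mul' ℂ (Obs n) ((poissonTensor n ^ m)
    (pullLinear k f ⊗ₜ[ℂ] pullLinear k g)) = pullLinear k _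
  rw [h2, h, map_smul]

lemma map_pull_starMul {n : ℕ} (k : Fin n) (F G : QObs 1) :
    PowerSeries.map (pull k) (starMul (weyl 1) F G) =
      starMul (weyl n) (PowerSeries.map (pull k) F) (PowerSeries.map (pull k) G) := by
  ext1 m
  simp [coeff_starMul, weyl_pull]

/-- The embedding of the Weyl algebra of a single site. -/
def pullHom {n : ℕ} (k : Fin n) : WeylAlgebra 1 →ₐ[PowerSeries ℂ] WeylAlgebra n where
  toFun F := (show QObs n from PowerSeries.map (pull k) (show QObs 1 from F))
  map_one' := map_one (PowerSeries.map (pull k))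
  map_zero' := map_zero (PowerSeries.map (pull k))
  map_add' := map_add (PowerSeries.map (pull k))
  map_mul' := map_pull_starMul k
  commutes' c := by
    refine WeylAlgebra.ext fun m => ?_
    change PowerSeries.coeff m (PowerSeries.map (pull k) (scalar 1 c)) =
      PowerSeries.coeff m (scalar n c)
    simp [scalar, pull_algebraMap]

lemma pullHom_quant {n : ℕ} (k : Fin n) (f : Obs 1) :
    pullHom k (quant 1 f) = quant n (pull k f) :=
  PowerSeries.map_C (pull k) f

/-! ### Star products of p, e^{aq} and e^{ap} -/

lemma poissonTensor_one_tmul (f g : Obs 1) :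
    poissonTensor 1 (f ⊗ₜ g) = dq 0 f ⊗ₜ dp 0 g - dp 0 f ⊗ₜ dq 0 g := by
  simp [poissonTensor_tmul]

lemma dp_mom : dp 0 mom = 1 := by
  refine Obs.ext fun x => ?_
  let L : Phase 1 →L[ℝ] ℂ := Complex.ofRealCLM.comp
    ((ContinuousLinearMap.proj 0).comp (ContinuousLinearMap.snd ℝ (Fin 1 → ℝ) (Fin 1 → ℝ)))
  change fderiv ℝ L x (0, Pi.single 0 1) = 1
  rw [L.fderiv]
  simp [L]

lemma dq_mom : dq 0 mom = 0 := by
  refine Obs.ext fun x => ?_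
  let L : Phase 1 →L[ℝ] ℂ := Complex.ofRealCLM.comp
    ((ContinuousLinearMap.proj 0).comp (ContinuousLinearMap.snd ℝ (Fin 1 → ℝ) (Fin 1 → ℝ)))
  change fderiv ℝ L x (Pi.single 0 1, 0) = 0
  rw [L.fderiv]
  simp [L]

lemma fderiv_cexp_linear (L : Phase 1 →L[ℝ] ℂ) (a : ℂ) (x v : Phase 1) :
    fderiv ℝ (fun x => Complex.exp (a * L x)) x v = a * L v * Complex.exp (a * L x) := by
  have h : HasFDerivAt (fun x => Complex.exp (a * L x)) (Complex.exp (a * L x) • (a • L)) x :=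
    (L.hasFDerivAt.const_mul a).cexp
  rw [h.fderiv]
  simp
  ring

lemma pd_expQ (a : ℂ) (v : Phase 1) : pd v (expQ a) = (a * v.1 0) • expQ a := by
  refine Obs.ext fun x => ?_
  exact fderiv_cexp_linear (Complex.ofRealCLM.comp
    ((ContinuousLinearMap.proj 0).comp (ContinuousLinearMap.fst ℝ (Fin 1 → ℝ) (Fin 1 → ℝ)))) a x v

lemma pd_expP (a : ℂ) (v : Phase 1) : pd v (expP a) = (a * v.2 0) • expP a := by
  refine Obs.ext fun x => ?_
  exact fderiv_cexp_linear (Complex.ofRealCLM.comp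
    ((ContinuousLinearMap.proj 0).comp (ContinuousLinearMap.snd ℝ (Fin 1 → ℝ) (Fin 1 → ℝ)))) a x v

lemma dq_expQ (a : ℂ) : dq 0 (expQ a) = a • expQ a := by simp [dq, pd_expQ]
lemma dp_expQ (a : ℂ) : dp 0 (expQ a) = 0 := by simp [dp, pd_expQ]
lemma dq_expP (a : ℂ) : dq 0 (expP a) = 0 := by simp [dq, pd_expP]
lemma dp_expP (a : ℂ) : dp 0 (expP a) = a • expP a := by simp [dp, pd_expP]

lemma expQ_mul_expQ_neg (a : ℂ) : expQ a * expQ (-a) = 1 := by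
  refine Obs.ext fun x => ?_
  change Complex.exp _ * Complex.exp _ = 1
  rw [← Complex.exp_add]
  simp

lemma quant_expQ_mul_expQ_neg (a : ℂ) : quant 1 (expQ a) * quant 1 (expQ (-a)) = 1 := by
  rw [quant_mul_of_poissonTensor_eq_zero, expQ_mul_expQ_neg, quant_one]
  simp [poissonTensor_one_tmul, dp_expQ]

lemma quant_mom_mul_expQ (a : ℂ) : quant 1 mom * quant 1 (expQ a) =
    quant 1 (mom * expQ a) - (PowerSeries.C (a / 2) * ihbar) • quant 1 (expQ a) := by
  have hd : dq 0 (1 : Obs 1) = 0 ∧ dp 0 (1 : Obs 1) = 0 := ⟨pd_one _, pd_one _⟩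
  rw [quant_mul_of_sq_eq_zero, poisson]
  · simp only [Finset.univ_unique, Fin.default_eq_zero, Finset.sum_singleton, dq_mom, dp_mom,
      dq_expQ, zero_mul, one_mul, zero_sub, map_neg (quant 1), quant_smul, smul_neg, smul_smul]
    rw [sub_eq_add_neg]
    congr 3
    rw [mul_right_comm, ← map_mul]
    congr 2
    ring
  · simp [poissonTensor_one_tmul, dq_mom, dp_mom, hd]

lemma quant_expQ_mul_mom (a : ℂ) : quant 1 (expQ a) * quant 1 mom =
    quant 1 (mom * expQ a) + (PowerSeries.C (a / 2) * ihbar) • quant 1 (expQ a) := by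
  have hd : dq 0 (1 : Obs 1) = 0 ∧ dp 0 (1 : Obs 1) = 0 := ⟨pd_one _, pd_one _⟩
  rw [quant_mul_of_sq_eq_zero, poisson]
  · simp only [Finset.univ_unique, Fin.default_eq_zero, Finset.sum_singleton, dq_mom, dp_mom,
      dq_expQ, mul_zero, mul_one, sub_zero, quant_smul, smul_smul, mul_comm (expQ a) mom]
    congr 2
    rw [mul_right_comm, ← map_mul]
    congr 2
    ring
  · simp [poissonTensor_one_tmul, dq_mom, dp_mom, hd]

lemma quant_expQ_mul_expP (a b : ℂ) : quant 1 (expQ a) * quant 1 (expP b) =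
    hexp (a * b) • quant 1 (expP b * expQ a) := by
  rw [quant_mul_of_eigen (z := a * b), mul_comm (expQ a)]
  simp [poissonTensor_one_tmul, dq_expQ, dp_expQ, dp_expP, ← TensorProduct.smul_tmul', smul_smul,
    mul_comm]

lemma quant_expP_mul_expQ (a b : ℂ) : quant 1 (expP b) * quant 1 (expQ a) =
    hexp (-(a * b)) • quant 1 (expP b * expQ a) := by
  rw [quant_mul_of_eigen (z := -(a * b))]
  simp [poissonTensor_one_tmul, dq_expQ, dp_expP, dq_expP, ← TensorProduct.smul_tmul', smul_smul]

/-! ### Exchange relations -/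

section Exchange

variable {K W : Type*} [CommRing K] [Ring W] [Algebra K W]

/-- The Kronecker product over a noncommutative ring. -/
def kron (A B : Matrix (Fin 2) (Fin 2) W) : Matrix (Fin 2 × Fin 2) (Fin 2 × Fin 2) W :=
  Matrix.of fun i k => A i.1 k.1 * B i.2 k.2

/-- The Kronecker product with the entries multiplied in the opposite order. -/
def kronOp (A B : Matrix (Fin 2) (Fin 2) W) : Matrix (Fin 2 × Fin 2) (Fin 2 × Fin 2) W :=
  Matrix.of fun i k => B i.2 k.2 * A i.1 k.1

/-- The exchange relation `R A₁ B₂ = B₂ A₁ R`. -/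
def Exchange (R : Matrix (Fin 2 × Fin 2) (Fin 2 × Fin 2) K) (A B : Matrix (Fin 2) (Fin 2) W) :
    Prop := R.map (algebraMap K W) * kron A B = kronOp A B * R.map (algebraMap K W)

/-- The entries of B must move past those of A'; over a noncommutative ring this is exactly what the
commutation hypothesis supplies. -/
lemma kron_mul {A B A' B' : Matrix (Fin 2) (Fin 2) W} (h : ∀ i j k l, Commute (B i j) (A' k l)) :
    kron (A * A') (B * B') = kron A B * kron A' B' := by
  ext ⟨i, j⟩ ⟨k, l⟩
  simp only [kron, Matrix.of_apply, Matrix.mul_apply, Fintype.sum_prod_type, Finset.sum_mul_sum]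
  refine Finset.sum_congr rfl fun a _ => Finset.sum_congr rfl fun b _ => ?_
  rw [mul_assoc, ← mul_assoc (A' a k), ← (h j b a k).eq]
  simp only [mul_assoc]

lemma kronOp_mul {A B A' B' : Matrix (Fin 2) (Fin 2) W}
    (h : ∀ i j k l, Commute (A i j) (B' k l)) :
    kronOp (A * A') (B * B') = kronOp A B * kronOp A' B' := by
  ext ⟨i, j⟩ ⟨k, l⟩
  simp only [kronOp, Matrix.of_apply, Matrix.mul_apply, Fintype.sum_prod_type,
    Finset.sum_mul_sum]
  rw [Finset.sum_comm]
  refine Finset.sum_congr rfl fun a _ => Finset.sum_congr rfl fun b _ => ?_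
  rw [mul_assoc, ← mul_assoc (B' b l), ← (h i a b l).eq]
  simp only [mul_assoc]

/-- R is moved through one factor at a time. This is the step that adds a site to the chain. -/
lemma Exchange.mul {R : Matrix (Fin 2 × Fin 2) (Fin 2 × Fin 2) K}
    {A B A' B' : Matrix (Fin 2) (Fin 2) W} (h : Exchange R A B) (h' : Exchange R A' B')
    (hBA : ∀ i j k l, Commute (B i j) (A' k l)) (hAB : ∀ i j k l, Commute (A i j) (B' k l)) :
    Exchange R (A * A') (B * B') := by
  unfold Exchange at *
  rw [kron_mul hBA, kronOp_mul hAB, ← mul_assoc, h, mul_assoc, h', mul_assoc]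

lemma Exchange.one (R : Matrix (Fin 2 × Fin 2) (Fin 2 × Fin 2) K) :
    Exchange R (1 : Matrix (Fin 2) (Fin 2) W) 1 := by
  have h1 : kron (1 : Matrix (Fin 2) (Fin 2) W) 1 = 1 := by
    ext ⟨i, j⟩ ⟨k, l⟩
    simp only [kron, Matrix.of_apply, Matrix.one_apply, Prod.mk.injEq]
    split_ifs <;> simp_all
  have h2 : kronOp (1 : Matrix (Fin 2) (Fin 2) W) 1 = 1 := by
    ext ⟨i, j⟩ ⟨k, l⟩
    simp only [kronOp, Matrix.of_apply, Matrix.one_apply, Prod.mk.injEq]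
    split_ifs <;> simp_all
  rw [Exchange, h1, h2, mul_one, one_mul]

lemma Exchange.map {W' : Type*} [Ring W'] [Algebra K W']
    {R : Matrix (Fin 2 × Fin 2) (Fin 2 × Fin 2) K} {A B : Matrix (Fin 2) (Fin 2) W}
    (h : Exchange R A B) (φ : W →ₐ[K] W') : Exchange R (A.map φ) (B.map φ) := by
  have hR : R.map (algebraMap K W') = (R.map (algebraMap K W)).map φ := by
    ext i j
    simp
  have h1 : kron (A.map φ) (B.map φ) = (kron A B).map φ := by
    ext i j
    simp [kron]
  have h2 : kronOp (A.map φ) (B.map φ) = (kronOp A B).map φ := by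
    ext i j
    simp [kronOp]
  rw [Exchange, hR, h1, h2, ← Matrix.map_mul, ← Matrix.map_mul, h]

lemma Exchange.smul {R : Matrix (Fin 2 × Fin 2) (Fin 2 × Fin 2) K}
    {A B : Matrix (Fin 2) (Fin 2) W} (h : Exchange R A B) (a b : K) :
    Exchange R (a • A) (b • B) := by
  have h1 : kron (a • A) (b • B) = (a * b) • kron A B := by
    ext i j
    simp [kron, smul_smul, mul_comm]
  have h2 : kronOp (a • A) (b • B) = (a * b) • kronOp A B := by
    ext i j
    simp [kronOp, smul_smul]
  rw [Exchange, h1, h2, Matrix.mul_smul, Matrix.smul_mul, h]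

/-- For an invertible `R`, the exchange relation implies that the traces commute. -/
lemma Exchange.trace_commute {R R' : Matrix (Fin 2 × Fin 2) (Fin 2 × Fin 2) K}
    {A B : Matrix (Fin 2) (Fin 2) W} (h : Exchange R A B) (hR : R * R' = 1) :
    Commute A.trace B.trace := by
  have h1 : (kron A B).trace = A.trace * B.trace := by
    simp only [Matrix.trace, kron, Fintype.sum_prod_type, Finset.sum_mul_sum, Matrix.diag_apply,
      Matrix.of_apply]
  have h2 : (kronOp A B).trace = B.trace * A.trace := by
    simp only [Matrix.trace, kronOp, Fintype.sum_prod_type, Finset.sum_mul_sum, Matrix.diag_apply,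
      Matrix.of_apply]
    exact Finset.sum_comm
  -- The trace is not cyclic over a noncommutative ring, but it is so against a matrix with central
  -- entries.
  have hc : ∀ X : Matrix (Fin 2 × Fin 2) (Fin 2 × Fin 2) W,
      (R'.map (algebraMap K W) * X).trace = (X * R'.map (algebraMap K W)).trace := by
    intro X
    simp only [Matrix.trace, Matrix.diag_apply, Matrix.mul_apply, Matrix.map_apply]
    rw [Finset.sum_comm]
    exact Finset.sum_congr rfl fun i _ => Finset.sum_congr rfl fun j _ => Algebra.commutes _ _
  have hmap : ∀ X Y : Matrix (Fin 2 × Fin 2) (Fin 2 × Fin 2) K, X * Y = 1 →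
      X.map (algebraMap K W) * Y.map (algebraMap K W) = 1 := by
    intro X Y hXY
    rw [← Matrix.map_mul, hXY, Matrix.map_one _ (map_zero _) (map_one _)]
  rw [Commute, SemiconjBy, ← h1, ← h2]
  calc (kron A B).trace
      = (R'.map (algebraMap K W) * (R.map (algebraMap K W) * kron A B)).trace := by
        rw [← mul_assoc, hmap _ _ (mul_eq_one_comm.mp hR), one_mul]
    _ = (kronOp A B * (R.map (algebraMap K W) * R'.map (algebraMap K W))).trace := by
        rw [hc, h, mul_assoc]
    _ = (kronOp A B).trace := by rw [hmap _ _ hR, mul_one]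

/-- The `R`-matrix of a six vertex model. -/
def sixVertex (a b b' c : K) : Matrix (Fin 2 × Fin 2) (Fin 2 × Fin 2) K :=
  Matrix.of fun i k =>
    if i = k then if i.1 = i.2 then a else if i.1 = 0 then b else b'
    else if i.1 = k.2 ∧ i.2 = k.1 then c else 0

/-- The matrix splits into two 1×1 blocks a and one 2×2 block of determinant bb' - c², and the
inverse has the same shape. -/
lemma sixVertex_mul_inverse {a b b' c u v : K} (hu : a * u = 1) (hv : (b * b' - c * c) * v = 1) :
    sixVertex a b b' c * sixVertex u (b' * v) (b * v) (-(c * v)) = 1 := by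
  ext ⟨i, j⟩ ⟨r, s⟩
  fin_cases i <;> fin_cases j <;> fin_cases r <;> fin_cases s <;>
    simp [sixVertex, Matrix.mul_apply, Fintype.sum_prod_type, hu] <;>
    first | linear_combination hv | ring

/-- The only nonzero entry in the first row and in the first column of R is a, so the corner of the
exchange relation involves only the two upper left entries. -/
lemma Exchange.zero_zero_commute {a b b' c u : K} (hu : a * u = 1)
    {A B : Matrix (Fin 2) (Fin 2) W} (h : Exchange (sixVertex a b b' c) A B) :
    Commute (A 0 0) (B 0 0) := by
  have h1 := congrFun (congrFun h (0, 0)) (0, 0)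
  simp only [sixVertex, kron, kronOp, Matrix.mul_apply, Fintype.sum_prod_type,
    Fin.sum_univ_two] at h1
  simp [← Algebra.commutes] at h1
  have h2 := congrArg (fun w => algebraMap K W u * w) h1
  rw [Commute, SemiconjBy]
  simpa [← mul_assoc, ← map_mul, mul_comm u a, hu] using h2

/-- The exchange relation of the Lax matrices with a rational `R`-matrix. -/
lemma exchange_rational {P B C : W} {d h l m : K} (hB : P * B - B * P = h • B)
    (hC : P * C - C * P = -(h • C)) (hBC : B * C - C * B = -((h * d) • 1)) :
    Exchange (sixVertex (l - m + h) (l - m) (l - m) h)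
      !![-(l • 1) + P, B; C, d • 1] !![-(m • 1) + P, B; C, d • 1] := by
  have e1 : P * B = B * P + h • B := by rw [← hB]; abel
  have e2 : P * C = C * P - h • C := by rw [sub_eq_add_neg, ← hC]; abel
  have e3 : B * C = C * B - (h * d) • 1 := by rw [sub_eq_add_neg, ← hBC]; abel
  ext ⟨i, j⟩ ⟨r, s⟩
  fin_cases i <;> fin_cases j <;> fin_cases r <;> fin_cases s <;>
    simp [sixVertex, kron, kronOp, Matrix.mul_apply, Fintype.sum_prod_type,
      Algebra.algebraMap_eq_smul_one,
      mul_add, add_mul, e1, e2, e3] <;> module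

/-- The exchange relation of the Lax matrices with a trigonometric `R`-matrix. -/
lemma exchange_trigonometric {k B C : W} {d t x l m : K} (hB : k * B = t • (B * k))
    (hC : t • (k * C) = C * k) (hBC : B * C = x • k + d • 1)
    (hCB : C * B = (t * x) • k + d • 1) :
    Exchange (sixVertex (l ^ 2 - t * m ^ 2) (t * (l ^ 2 - m ^ 2)) (l ^ 2 - m ^ 2)
        (l * m * (1 - t)))
      !![1 - l ^ 2 • k, l • B; l • C, (l ^ 2 * d) • 1]
      !![1 - m ^ 2 • k, m • B; m • C, (m ^ 2 * d) • 1] := by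
  ext ⟨i, j⟩ ⟨r, s⟩
  fin_cases i <;> fin_cases j <;> fin_cases r <;> fin_cases s <;>
    simp [sixVertex, kron, kronOp, Matrix.mul_apply, Fintype.sum_prod_type,
      Algebra.algebraMap_eq_smul_one,
      hB, ← hC, hBC, hCB, mul_sub, sub_mul] <;> module

/-- The exchange relation from the relations between `p` and `e^{±q}`. -/
lemma exchange_rational_of_weyl {P E F M N : W} {a b c η l m : K} (e1 : P * E = M - η • E)
    (e2 : E * P = M + η • E) (f1 : P * F = N + η • F) (f2 : F * P = N - η • F) (ef : E * F = 1)
    (fe : F * E = 1) :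
    Exchange (sixVertex (l - m + 2 * η) (l - m) (l - m) (2 * η))
      !![-(l • 1) + P, a • F; b • E + c • M, (a * c) • 1]
      !![-(m • 1) + P, a • F; b • E + c • M, (a * c) • 1] := by
  -- M stands for the Weyl quantization of p e^q. Eliminating it leaves an ordered expression in P
  -- and E.
  have hM : M = P * E + η • E := by rw [e1]; abel
  have hEP : E * P = P * E + (2 * η) • E := by rw [e2, e1]; module
  have hPF : P * F = F * P + (2 * η) • F := by rw [f1, f2]; module
  rw [hM]
  refine exchange_rational ?_ ?_ ?_
  · rw [mul_smul_comm, smul_mul_assoc, hPF]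
    module
  · simp only [mul_add, add_mul, mul_smul_comm, smul_mul_assoc, mul_assoc, hEP]
    module
  · have h3 : F * (P * E) = P - (2 * η) • 1 := by
      rw [← mul_assoc, show F * P = P * F - (2 * η) • F by rw [hPF]; abel, sub_mul, mul_assoc,
        fe, smul_mul_assoc, fe, mul_one]
    simp only [mul_add, add_mul, mul_smul_comm, smul_mul_assoc, mul_assoc, ef, fe, h3]
    simp only [mul_one]
    module

/-- The exchange relation from the relations between `e^{εp}` and `e^{±q}`. -/
lemma exchange_trigonometric_of_weyl {k E F G N : W} {s s' α β γ l m : K} (hs : s * s' = 1)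
    (e1 : E * k = s • N) (e2 : k * E = s' • N) (f1 : F * k = s' • G) (f2 : k * F = s • G)
    (ef : E * F = 1) (fe : F * E = 1) :
    Exchange (sixVertex (l ^ 2 - s * s * m ^ 2) (s * s * (l ^ 2 - m ^ 2)) (l ^ 2 - m ^ 2)
        (l * m * (1 - s * s)))
      !![1 - l ^ 2 • k, l • -(α • G + β • F); l • γ • E, (l ^ 2 * -(β * γ)) • 1]
      !![1 - m ^ 2 • k, m • -(α • G + β • F); m • γ • E, (m ^ 2 * -(β * γ)) • 1] := by
  have hG : G = s' • (k * F) := by rw [f2, smul_smul, mul_comm, hs, one_smul]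
  have hG' : G = s • (F * k) := by rw [f1, smul_smul, hs, one_smul]
  have hkF : k * F = (s * s) • (F * k) := by rw [f2, f1, smul_smul, mul_assoc, hs, mul_one]
  have hkE : (s * s) • (k * E) = E * k := by rw [e2, e1, smul_smul, mul_assoc, hs, mul_one]
  have hkG : k * G = (s * s) • (G * k) := by
    rw [hG']
    simp only [mul_smul_comm, smul_mul_assoc, ← mul_assoc, hkF]
    module
  -- The value of x is read off from BC: since G = s' k F and FE = 1, the product GE equals s' k.
  refine exchange_trigonometric (x := -(α * γ) * s') ?_ ?_ ?_ ?_
  · simp only [mul_neg, neg_mul, mul_add, add_mul, mul_smul_comm, smul_mul_assoc, hkF, hkG]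
    module
  · rw [mul_smul_comm, smul_mul_assoc, ← hkE]
    module
  · have h1 : G * E = s' • k := by rw [hG, smul_mul_assoc, mul_assoc, fe, mul_one]
    simp only [neg_mul, add_mul, mul_smul_comm, smul_mul_assoc, h1, fe]
    module
  · have h1 : E * G = s • k := by rw [hG', mul_smul_comm, ← mul_assoc, ef, one_mul]
    have h2 : s * s * (-(α * γ) * s') = -(α * γ) * s := by
      linear_combination (-α * γ * s) * hs
    rw [h2]
    simp only [mul_neg, mul_add, mul_smul_comm, smul_mul_assoc, h1, ef]
    module

end Exchange

/-! ### Two families that contain all Lax matrices -/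

open LaurentPolynomial in
/-- The Lax matrices with a rational `R`-matrix. -/
def todaLax (a b c : ℂ) : Matrix (Fin 2) (Fin 2) (Obs 1)[T;T⁻¹] :=
  !![-T 1 + C mom, C (a • expQ (-1));
    C (b • expQ 1 + c • (mom * expQ 1)), C (algebraMap ℂ (Obs 1) (a * c))]

open LaurentPolynomial in
/-- The Lax matrices with a trigonometric `R`-matrix. -/
def relLax (ε α β γ : ℂ) : Matrix (Fin 2) (Fin 2) (Obs 1)[T;T⁻¹] :=
  !![T (-1) - T 1 * C (expP ε), -C (α • (expP ε * expQ (-1)) + β • expQ (-1));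
    C (γ • expQ 1), -(T 1 * C (algebraMap ℂ (Obs 1) (β * γ)))]

/-- This reduces seven computations to two. In the second family, nondegeneracy of the Lax matrix is
what guarantees ε ≠ 0. -/
lemma Lax.mat_eq (U : Lax) : (∃ a b c, U.mat = todaLax a b c) ∨
    ∃ ε α β γ, (U.Nondegenerate → ε ≠ 0) ∧ U.mat = relLax ε α β γ := by
  have hC : ∀ (z : ℂ) (f : Obs 1), LaurentPolynomial.C (z • f) =
      LaurentPolynomial.C (algebraMap ℂ (Obs 1) z) * LaurentPolynomial.C f := by
    intro z f
    rw [← map_mul, Algebra.smul_def]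
  cases U with
  | toda =>
    refine Or.inl ⟨-1, 1, 0, ?_⟩
    simp [Lax.mat, todaLax]
  | toda' σ τ =>
    refine Or.inl ⟨((σ : ℤ) : ℂ), 0, ((τ : ℤ) : ℂ), ?_⟩
    simp [Lax.mat, todaLax, hC, cst]
  | relToda =>
    refine Or.inr ⟨1, 0, 1, 1, fun _ => one_ne_zero, ?_⟩
    simp [Lax.mat, relLax]
  | relToda' g =>
    refine Or.inr ⟨1, g ^ 2, 0, 1, fun _ => one_ne_zero, ?_⟩
    simp [Lax.mat, relLax, hC, cst]
    ring
  | relToda'' g δ =>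
    refine Or.inr ⟨1, g ^ 2, δ * g ^ 2, 1, fun _ => one_ne_zero, ?_⟩
    simp [Lax.mat, relLax, hC, cst]
    ring
  | discToda ε =>
    refine Or.inr ⟨ε, 0, ε, ε, id, ?_⟩
    simp [Lax.mat, relLax, hC, cst]
    ring
  | discToda' ε =>
    refine Or.inr ⟨ε, 1, -1, ε, id, ?_⟩
    simp [Lax.mat, relLax, hC, cst, ← sub_eq_add_neg]
    ring

/-! ### Evaluation of the spectral parameter -/

/-- Evaluation of the spectral parameter at a nonzero complex number. -/
def evalLam {n : ℕ} (z : ℂˣ) : (Obs n)[T;T⁻¹] →+* Obs n :=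
  LaurentPolynomial.eval₂ (RingHom.id _) (Units.map (algebraMap ℂ (Obs n)).toMonoidHom z)

lemma evalLam_C {n : ℕ} (z : ℂˣ) (f : Obs n) : evalLam z (LaurentPolynomial.C f) = f := by
  simp [evalLam]

lemma evalLam_T {n : ℕ} (z : ℂˣ) (k : ℤ) :
    evalLam z (LaurentPolynomial.T k : (Obs n)[T;T⁻¹]) =
      algebraMap ℂ (Obs n) ((z ^ k : ℂˣ) : ℂ) := by
  rw [evalLam, LaurentPolynomial.eval₂_T, ← map_zpow]
  rfl

lemma evalLam_mapRingHom_pull {n : ℕ} (k : Fin n) (z : ℂˣ) (P : (Obs 1)[T;T⁻¹]) :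
    evalLam z (AddMonoidAlgebra.mapRingHom ℤ (pull k) P) = pull k (evalLam z P) := by
  induction P using LaurentPolynomial.induction_on' with
  | add p q hp hq => simp only [map_add, hp, hq]
  | C_mul_T m f =>
    have h1 : AddMonoidAlgebra.mapRingHom ℤ (pull k)
        (LaurentPolynomial.C f * LaurentPolynomial.T m) =
        LaurentPolynomial.C (pull k f) * LaurentPolynomial.T m := by
      rw [← LaurentPolynomial.single_eq_C_mul_T, ← LaurentPolynomial.single_eq_C_mul_T]
      exact AddMonoidAlgebra.map_single ..
    rw [h1, map_mul, map_mul, evalLam_C, evalLam_C, evalLam_T, evalLam_T, map_mul,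
      pull_algebraMap]

lemma quant_algebraMap {n : ℕ} (z : ℂ) :
    quant n (algebraMap ℂ (Obs n) z) = (PowerSeries.C z : PowerSeries ℂ) • 1 := by
  rw [Algebra.algebraMap_eq_smul_one, quant_smul, quant_one]

/-- The quantization of the Lax matrix of a single site. -/
def quantMat {n : ℕ} (z : ℂˣ) (M : Matrix (Fin 2) (Fin 2) (Obs n)[T;T⁻¹]) :
    Matrix (Fin 2) (Fin 2) (WeylAlgebra n) := (M.map (evalLam z)).map (quant n)

lemma quantMat_todaLax (a b c : ℂ) (z : ℂˣ) : quantMat z (todaLax a b c) =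
    !![-((PowerSeries.C (z : ℂ) : PowerSeries ℂ) • 1) + quant 1 mom,
        (PowerSeries.C a : PowerSeries ℂ) • quant 1 (expQ (-1));
      (PowerSeries.C b : PowerSeries ℂ) • quant 1 (expQ 1) +
        (PowerSeries.C c : PowerSeries ℂ) • quant 1 (mom * expQ 1),
      (PowerSeries.C (a * c) : PowerSeries ℂ) • 1] := by
  ext i j
  fin_cases i <;> fin_cases j
  · simp [quantMat, todaLax, evalLam_C, evalLam_T, quant_algebraMap]
  · simp only [quantMat, todaLax, Matrix.map_apply]
    simp [evalLam_C, quant_smul]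
  · simp only [quantMat, todaLax, Matrix.map_apply]
    simp [evalLam_C, quant_smul]
  · simp only [quantMat, todaLax, Matrix.map_apply]
    simp [evalLam_C, quant_algebraMap, -map_mul]

/-- Taking out 1/z leaves a matrix polynomial in z, as in the trigonometric exchange relation; a
scalar factor does not affect that relation. -/
lemma quantMat_relLax (ε α β γ : ℂ) (z : ℂˣ) : quantMat z (relLax ε α β γ) =
    (PowerSeries.C ((z⁻¹ : ℂˣ) : ℂ) : PowerSeries ℂ) •
    !![1 - (PowerSeries.C (z : ℂ) : PowerSeries ℂ) ^ 2 • quant 1 (expP ε),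
        (PowerSeries.C (z : ℂ) : PowerSeries ℂ) •
          -((PowerSeries.C α : PowerSeries ℂ) • quant 1 (expP ε * expQ (-1)) +
          (PowerSeries.C β : PowerSeries ℂ) • quant 1 (expQ (-1)));
      (PowerSeries.C (z : ℂ) : PowerSeries ℂ) • (PowerSeries.C γ : PowerSeries ℂ) •
        quant 1 (expQ 1),
      ((PowerSeries.C (z : ℂ) : PowerSeries ℂ) ^ 2 *
        (-PowerSeries.C (β * γ) : PowerSeries ℂ)) • 1] := by
  have hz : (PowerSeries.C ((z⁻¹ : ℂˣ) : ℂ) : PowerSeries ℂ) * PowerSeries.C (z : ℂ) = 1 := by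
    rw [← map_mul, Units.inv_mul, map_one]
  have hz' : (PowerSeries.C (z : ℂ)⁻¹ : PowerSeries ℂ) * PowerSeries.C (z : ℂ) = 1 := by
    rw [← map_mul, inv_mul_cancel₀ z.ne_zero, map_one]
  ext i j
  fin_cases i <;> fin_cases j
  · simp only [quantMat, relLax, Matrix.map_apply, Matrix.smul_apply]
    simp only [Matrix.of_apply, Matrix.cons_val', Matrix.cons_val_zero, Fin.zero_eta, map_sub,
      map_mul, evalLam_C, evalLam_T, ← Algebra.smul_def, quant_smul, quant_algebraMap, zpow_one,
      zpow_neg, smul_sub, smul_smul, pow_two]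
    rw [← mul_assoc, hz, one_mul]
  · simp only [quantMat, relLax, Matrix.map_apply, Matrix.smul_apply]
    simp [evalLam_C, quant_smul, smul_smul, ← mul_assoc, hz', add_comm]
  · simp only [quantMat, relLax, Matrix.map_apply, Matrix.smul_apply]
    simp [evalLam_C, quant_smul, smul_smul, ← mul_assoc, hz']
  · simp only [quantMat, relLax, Matrix.map_apply, Matrix.smul_apply]
    have h1 : evalLam z (LaurentPolynomial.T 1 * LaurentPolynomial.C
        (algebraMap ℂ (Obs 1) (β * γ))) = algebraMap ℂ (Obs 1) (z * (β * γ)) := by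
      rw [map_mul, evalLam_T, evalLam_C, ← map_mul, zpow_one]
    simp only [Matrix.of_apply, Matrix.cons_val', Matrix.cons_val_one, Fin.mk_one, map_neg,
      Matrix.cons_val_fin_one, h1, quant_algebraMap, smul_smul, pow_two]
    rw [← mul_assoc (PowerSeries.C _), ← mul_assoc (PowerSeries.C _), hz, one_mul, map_mul,
      mul_neg, neg_smul]

/-! ### The exchange relation of a single site -/

lemma exchange_todaLax (a b c : ℂ) (z w : ℂˣ) :
    Exchange (sixVertex (PowerSeries.C (z : ℂ) - PowerSeries.C (w : ℂ) + ihbar)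
      (PowerSeries.C (z : ℂ) - PowerSeries.C (w : ℂ))
      (PowerSeries.C (z : ℂ) - PowerSeries.C (w : ℂ)) ihbar)
      (quantMat z (todaLax a b c)) (quantMat w (todaLax a b c)) := by
  rw [quantMat_todaLax, quantMat_todaLax]
  set η : PowerSeries ℂ := PowerSeries.C (1 / 2) * ihbar with hη
  -- Here η = iħ/2 is the correction between the star product of p with e^q and its Weyl symbol; the
  -- R-matrix contains the full commutator 2η.
  have h2 : ihbar = 2 * η := by
    rw [hη, ← mul_assoc, ← map_ofNat (PowerSeries.C : ℂ →+* PowerSeries ℂ) 2, ← map_mul]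
    norm_num
  have hη' : (PowerSeries.C (-1 / 2 : ℂ) * ihbar : PowerSeries ℂ) = -η := by
    rw [hη, neg_div, map_neg, neg_mul]
  have f1 := quant_mom_mul_expQ (-1)
  have f2 := quant_expQ_mul_mom (-1)
  have fe := quant_expQ_mul_expQ_neg (-1)
  rw [neg_neg] at fe
  rw [hη', neg_smul, sub_neg_eq_add] at f1
  rw [hη', neg_smul, ← sub_eq_add_neg] at f2
  rw [h2, map_mul (PowerSeries.C : ℂ →+* PowerSeries ℂ)]
  exact exchange_rational_of_weyl (quant_mom_mul_expQ 1) (quant_expQ_mul_mom 1) f1 f2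
    (quant_expQ_mul_expQ_neg 1) fe

lemma exchange_relLax (ε α β γ : ℂ) (z w : ℂˣ) :
    Exchange (sixVertex
      (PowerSeries.C (z : ℂ) ^ 2 - hexp (ε + ε) * PowerSeries.C (w : ℂ) ^ 2)
      (hexp (ε + ε) * (PowerSeries.C (z : ℂ) ^ 2 - PowerSeries.C (w : ℂ) ^ 2))
      (PowerSeries.C (z : ℂ) ^ 2 - PowerSeries.C (w : ℂ) ^ 2)
      (PowerSeries.C (z : ℂ) * PowerSeries.C (w : ℂ) * (1 - hexp (ε + ε))))
      (quantMat z (relLax ε α β γ)) (quantMat w (relLax ε α β γ)) := by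
  rw [quantMat_relLax, quantMat_relLax]
  refine Exchange.smul ?_ _ _
  have fe := quant_expQ_mul_expQ_neg (-1)
  have e1 := quant_expQ_mul_expP 1 ε
  have e2 := quant_expP_mul_expQ 1 ε
  have f1 := quant_expQ_mul_expP (-1) ε
  have f2 := quant_expP_mul_expQ (-1) ε
  simp only [one_mul, neg_mul, neg_neg] at e1 e2 f1 f2 fe
  have hs : hexp ε * hexp (-ε) = 1 := by rw [← hexp_add, add_neg_cancel, hexp_zero]
  rw [hexp_add, map_mul (PowerSeries.C : ℂ →+* PowerSeries ℂ)]
  exact exchange_trigonometric_of_weyl hs e1 e2 f1 f2 (quant_expQ_mul_expQ_neg 1) fe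

lemma exists_mul_eq_one_of_constantCoeff {a : PowerSeries ℂ}
    (h : PowerSeries.constantCoeff a ≠ 0) : ∃ u, a * u = 1 :=
  (PowerSeries.isUnit_iff_constantCoeff.mpr (isUnit_iff_ne_zero.mpr h)).exists_right_inv

/-- A power series is invertible if its constant term is nonzero. At ħ = 0 the two quantities are z
- w and its square, or z² - w² and its square. -/
lemma Lax.exists_exchange (U : Lax) {z w : ℂˣ} (hzw : (z : ℂ) ^ 2 ≠ (w : ℂ) ^ 2) :
    ∃ a b b' c u v : PowerSeries ℂ, a * u = 1 ∧ (b * b' - c * c) * v = 1 ∧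
      Exchange (sixVertex a b b' c) (quantMat z U.mat) (quantMat w U.mat) := by
  have h1 : (z : ℂ) - w ≠ 0 := fun h => hzw (by rw [sub_eq_zero.mp h])
  have h2 : (z : ℂ) ^ 2 - (w : ℂ) ^ 2 ≠ 0 := sub_ne_zero.mpr hzw
  rcases U.mat_eq with ⟨a, b, c, hU⟩ | ⟨ε, α, β, γ, -, hU⟩
  · have hE := exchange_todaLax a b c z w
    rw [← hU] at hE
    obtain ⟨u, hu⟩ := exists_mul_eq_one_of_constantCoeff
      (a := PowerSeries.C (z : ℂ) - PowerSeries.C (w : ℂ) + ihbar) (by simpa [ihbar] using h1)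
    obtain ⟨v, hv⟩ := exists_mul_eq_one_of_constantCoeff
      (a := (PowerSeries.C (z : ℂ) - PowerSeries.C (w : ℂ)) *
        (PowerSeries.C (z : ℂ) - PowerSeries.C (w : ℂ)) - ihbar * ihbar)
      (by simpa [ihbar] using h1)
    exact ⟨_, _, _, _, u, v, hu, hv, hE⟩
  · have hE := exchange_relLax ε α β γ z w
    rw [← hU] at hE
    obtain ⟨u, hu⟩ := exists_mul_eq_one_of_constantCoeff
      (a := PowerSeries.C (z : ℂ) ^ 2 - hexp (ε + ε) * PowerSeries.C (w : ℂ) ^ 2)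
      (by simpa [constantCoeff_hexp] using h2)
    obtain ⟨v, hv⟩ := exists_mul_eq_one_of_constantCoeff
      (a := (hexp (ε + ε) * (PowerSeries.C (z : ℂ) ^ 2 - PowerSeries.C (w : ℂ) ^ 2)) *
        (PowerSeries.C (z : ℂ) ^ 2 - PowerSeries.C (w : ℂ) ^ 2) -
        (PowerSeries.C (z : ℂ) * PowerSeries.C (w : ℂ) * (1 - hexp (ε + ε))) *
        (PowerSeries.C (z : ℂ) * PowerSeries.C (w : ℂ) * (1 - hexp (ε + ε))))
      (by simpa [constantCoeff_hexp] using h2)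
    exact ⟨_, _, _, _, u, v, hu, hv, hE⟩

/-! ### The exchange relation of the monodromy matrix -/

/-- The observables that depend only on the coordinates of the sites in `l`. -/
def supported {n : ℕ} (l : List (Fin n)) : Subring (Obs n) where
  carrier := {f | ∀ j, j ∉ l → dq j f = 0 ∧ dp j f = 0}
  mul_mem' {f g} hf hg j hj := by
    obtain ⟨h1, h2⟩ := hf j hj
    obtain ⟨h3, h4⟩ := hg j hj
    simp only [dq, dp] at *
    simp [pd_mul, h1, h2, h3, h4]
  one_mem' j _ := ⟨pd_one _, pd_one _⟩
  add_mem' {f g} hf hg j hj := by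
    obtain ⟨h1, h2⟩ := hf j hj
    obtain ⟨h3, h4⟩ := hg j hj
    simp [h1, h2, h3, h4]
  zero_mem' j _ := ⟨map_zero _, map_zero _⟩
  neg_mem' {f} hf j hj := by
    obtain ⟨h1, h2⟩ := hf j hj
    simp [h1, h2]

lemma supported_mono {n : ℕ} {l l' : List (Fin n)} (h : l ⊆ l') : supported l ≤ supported l' :=
  fun _ hf j hj => hf j fun hl => hj (h hl)

lemma pull_mem_supported {n : ℕ} {l : List (Fin n)} {k : Fin n} (hk : k ∈ l) (f : Obs 1) :
    pull k f ∈ supported l := fun j hj => by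
  have : j ≠ k := by rintro rfl; exact hj hk
  exact ⟨dq_pull_of_ne this f, dp_pull_of_ne this f⟩

/-- In each summand one factor is differentiated in a coordinate on which it does not depend. -/
lemma poissonTensor_pull_supported {n : ℕ} {l : List (Fin n)} {k : Fin n} (hk : k ∉ l) (f : Obs 1)
    {g : Obs n} (hg : g ∈ supported l) :
    poissonTensor n (pull k f ⊗ₜ g) = 0 ∧ poissonTensor n (g ⊗ₜ pull k f) = 0 := by
  obtain ⟨h1, h2⟩ := hg k hk
  rw [poissonTensor_tmul, poissonTensor_tmul]
  constructor <;>
  · refine Finset.sum_eq_zero fun j _ => ?_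
    by_cases hj : j = k
    · subst hj
      simp [h1, h2]
    · simp [dq_pull_of_ne hj, dp_pull_of_ne hj]

lemma quant_pull_mul {n : ℕ} {l : List (Fin n)} {k : Fin n} (hk : k ∉ l) (f : Obs 1)
    {g : Obs n} (hg : g ∈ supported l) :
    quant n (pull k f) * quant n g = quant n (pull k f * g) :=
  quant_mul_of_poissonTensor_eq_zero (poissonTensor_pull_supported hk f hg).1

lemma commute_quant_pull {n : ℕ} {l : List (Fin n)} {k : Fin n} (hk : k ∉ l) (f : Obs 1)
    {g : Obs n} (hg : g ∈ supported l) : Commute (quant n (pull k f)) (quant n g) := by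
  rw [Commute, SemiconjBy, quant_pull_mul hk f hg, mul_comm,
    quant_mul_of_poissonTensor_eq_zero (poissonTensor_pull_supported hk f hg).2]

lemma Lax.site_evalLam (U : Lax) {n : ℕ} (k : Fin n) (z : ℂˣ) (i j : Fin 2) :
    evalLam z (U.site k i j) = pull k (evalLam z (U.mat i j)) :=
  evalLam_mapRingHom_pull k z _

lemma evalLam_mul_apply {n : ℕ} (z : ℂˣ) (A B : Matrix (Fin 2) (Fin 2) (Obs n)[T;T⁻¹])
    (i j : Fin 2) : evalLam z ((A * B) i j) = ∑ a, evalLam z (A i a) * evalLam z (B a j) := by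
  simp [Matrix.mul_apply]

lemma Lax.evalLam_prod_mem (U : Lax) {n : ℕ} (z : ℂˣ) (l : List (Fin n)) (i j : Fin 2) :
    evalLam z ((l.map U.site).prod i j) ∈ supported l := by
  induction l generalizing i j with
  | nil =>
    rw [List.map_nil, List.prod_nil, Matrix.one_apply]
    split_ifs
    · rw [map_one]; exact one_mem _
    · rw [map_zero]; exact zero_mem _
  | cons k l ih =>
    rw [List.map_cons, List.prod_cons, evalLam_mul_apply]
    refine Subring.sum_mem _ fun a _ => Subring.mul_mem _ ?_ ?_
    · rw [U.site_evalLam]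
      exact pull_mem_supported List.mem_cons_self _
    · exact supported_mono (List.subset_cons_self k l) (ih a j)

/-- The new site does not occur in the rest of the list, so pointwise and star products of entries
agree. Hence quantizing the classical monodromy matrix gives the product of the quantized Lax
matrices. -/
lemma Lax.quantMat_cons (U : Lax) {n : ℕ} (z : ℂˣ) {k : Fin n} {l : List (Fin n)} (hk : k ∉ l) :
    quantMat z (((k :: l).map U.site).prod) =
      quantMat z (U.site k) * quantMat z ((l.map U.site).prod) := by
  ext i j
  rw [List.map_cons, List.prod_cons]
  simp only [quantMat, Matrix.map_apply, evalLam_mul_apply]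
  rw [Matrix.mul_apply, map_sum]
  refine Finset.sum_congr rfl fun a _ => ?_
  simp only [Matrix.map_apply, U.site_evalLam]
  rw [quant_pull_mul hk _ (U.evalLam_prod_mem z l a j)]

lemma Lax.quantMat_site (U : Lax) {n : ℕ} (z : ℂˣ) (k : Fin n) :
    quantMat z (U.site k) = (quantMat z U.mat).map (pullHom k) := by
  ext i j
  simp only [quantMat, Matrix.map_apply, U.site_evalLam, pullHom_quant]

/-- Induction over the sites: each one satisfies the relation of a single site through the embedding
of its Weyl algebra, and commutes with the sites after it because the list has no repetitions. -/
lemma Lax.exchange_prod (U : Lax) {n : ℕ} {z w : ℂˣ}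
    {R : Matrix (Fin 2 × Fin 2) (Fin 2 × Fin 2) (PowerSeries ℂ)}
    (hR : Exchange R (quantMat z U.mat) (quantMat w U.mat)) {l : List (Fin n)} (hl : l.Nodup) :
    Exchange R (quantMat z ((l.map U.site).prod)) (quantMat w ((l.map U.site).prod)) := by
  induction l with
  | nil =>
    have h : ∀ z : ℂˣ, quantMat z (1 : Matrix (Fin 2) (Fin 2) (Obs n)[T;T⁻¹]) = 1 := by
      intro z
      rw [quantMat, Matrix.map_one _ (map_zero _) (map_one _),
        Matrix.map_one _ (map_zero _) quant_one]
    rw [List.map_nil, List.prod_nil, h, h]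
    exact Exchange.one R
  | cons k l ih =>
    obtain ⟨hk, hl⟩ := List.nodup_cons.mp hl
    rw [U.quantMat_cons z hk, U.quantMat_cons w hk]
    have hc : ∀ (z w : ℂˣ) (i j r s : Fin 2), Commute (quantMat z (U.site k) i j)
        (quantMat w ((l.map U.site).prod) r s) := by
      intro z w i j r s
      simp only [quantMat, Matrix.map_apply, U.site_evalLam]
      exact commute_quant_pull hk _ (U.evalLam_prod_mem w l r s)
    refine Exchange.mul ?_ (ih hl) (hc w z) (hc z w)
    rw [U.quantMat_site, U.quantMat_site]
    exact hR.map (pullHom k)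

lemma Lax.prod_eq (U : Lax) (n : ℕ) :
    U.prod n = (((List.finRange n).reverse).map U.site).prod := by
  rw [Lax.prod, List.map_reverse, List.ofFn_eq_map]

lemma Lax.commute_evalLam (U : Lax) (n : ℕ) {P : (Obs n)[T;T⁻¹]}
    (hP : P = chi U n ∨ P = chiTilde U n) {z w : ℂˣ} (hzw : (z : ℂ) ^ 2 ≠ (w : ℂ) ^ 2) :
    Commute (quant n (evalLam z P)) (quant n (evalLam w P)) := by
  obtain ⟨a, b, b', c, u, v, hu, hv, hE⟩ := U.exists_exchange hzw
  have h := U.exchange_prod (n := n) hE (List.nodup_reverse.mpr (List.nodup_finRange n))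
  rw [← U.prod_eq] at h
  rcases hP with rfl | rfl
  · have htr : ∀ z, quant n (evalLam z (chi U n)) = (quantMat z (U.prod n)).trace := by
      intro z
      simp [chi, Matrix.trace, quantMat]
    rw [htr, htr]
    exact h.trace_commute (sixVertex_mul_inverse hu hv)
  · have h00 : chiTilde U n = U.prod n 0 0 := by
      simp [chiTilde, Matrix.trace, Matrix.mul_apply, Matrix.single]
    rw [h00]
    exact h.zero_zero_commute hu

/-! ### The coefficients commute -/

lemma eq_zero_of_eval_laurent {f : ℂ[T;T⁻¹]} {S : Set ℂˣ} (hS : S.Infinite)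
    (h : ∀ z ∈ S, LaurentPolynomial.eval₂ (RingHom.id ℂ) z f = 0) : f = 0 := by
  obtain ⟨N, q, hq⟩ := f.exists_T_pow
  have hq0 : q = 0 := by
    refine Polynomial.eq_zero_of_infinite_isRoot q
      ((hS.image Units.val_injective.injOn).mono ?_)
    rintro _ ⟨z, hz, rfl⟩
    have := congrArg (LaurentPolynomial.eval₂ (RingHom.id ℂ) z) hq
    rw [LaurentPolynomial.eval₂_toLaurent, map_mul, h z hz, zero_mul] at this
    simpa [Polynomial.eval₂_id] using this
  rw [hq0, map_zero] at hq
  have h2 := congrArg (· * LaurentPolynomial.T (-(N : ℤ))) hq.symm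
  simpa [LaurentPolynomial.mul_T_assoc] using h2

/-- Applying the functional to each coefficient gives a complex Laurent polynomial with infinitely
many zeros. -/
lemma coeff_eq_zero_of_evalLam {n : ℕ} (φ : Obs n →ₗ[ℂ] ℂ) {P : (Obs n)[T;T⁻¹]} {S : Set ℂˣ}
    (hS : S.Infinite) (h : ∀ z ∈ S, φ (evalLam z P) = 0) (k : ℤ) : φ (P.coeff k) = 0 := by
  let ψ : (Obs n)[T;T⁻¹] →+ ℂ[T;T⁻¹] :=
    { toFun := fun P => AddMonoidAlgebra.ofCoeff (P.coeff.mapRange φ (map_zero φ))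
      map_zero' := by ext; simp
      map_add' := fun P Q => by ext; simp }
  have hψ : ∀ P k, (ψ P).coeff k = φ (P.coeff k) := fun P k => rfl
  have he : ∀ (z : ℂˣ) (P : (Obs n)[T;T⁻¹]),
      LaurentPolynomial.eval₂ (RingHom.id ℂ) z (ψ P) = φ (evalLam z P) := by
    intro z P
    induction P using LaurentPolynomial.induction_on' with
    | add p q hp hq => simp only [map_add, hp, hq]
    | C_mul_T m f =>
      have h1 : ψ (LaurentPolynomial.C f * LaurentPolynomial.T m) =
          LaurentPolynomial.C (φ f) * LaurentPolynomial.T m := by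
        ext k
        rw [hψ, ← LaurentPolynomial.single_eq_C_mul_T, ← LaurentPolynomial.single_eq_C_mul_T]
        simp only [AddMonoidAlgebra.coeff_single, Finsupp.single_apply]
        split_ifs <;> simp
      rw [h1, LaurentPolynomial.eval₂_C_mul_T, map_mul, evalLam_C, evalLam_T, mul_comm f,
        ← Algebra.smul_def, map_smul, smul_eq_mul, mul_comm]
      rfl
  rw [← hψ, eq_zero_of_eval_laurent hS (f := ψ P) fun z hz => by rw [he, h z hz]]
  rfl

lemma infinite_sq_ne (w : ℂˣ) : {z : ℂˣ | (z : ℂ) ^ 2 ≠ (w : ℂ) ^ 2}.Infinite := by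
  have : Infinite ℂˣ := by
    refine Infinite.of_injective (fun m : ℕ => Units.mk0 ((m : ℂ) + 1)
      (by exact_mod_cast m.succ_ne_zero)) ?_
    intro a b hab
    simpa using congrArg Units.val hab
  refine Set.Finite.infinite_compl (s := {z : ℂˣ | (z : ℂ) ^ 2 = (w : ℂ) ^ 2}) ?_
  refine (Set.toFinite {w, -w}).subset fun z hz => ?_
  rcases sq_eq_sq_iff_eq_or_eq_neg.mp hz with h | h
  · exact Or.inl (Units.ext h)
  · exact Or.inr (Units.ext h)

/-- The evaluation of an observable at a point of phase space. -/
def evalAt {n : ℕ} (x : Phase n) : Obs n →+* ℂ where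
  toFun f := f.1 x
  map_one' := rfl
  map_mul' _ _ := rfl
  map_zero' := rfl
  map_add' _ _ := rfl

lemma Lax.commute_coeff (U : Lax) (n : ℕ) {P : (Obs n)[T;T⁻¹]}
    (hP : P = chi U n ∨ P = chiTilde U n) (k l : ℤ) :
    Commute (quant n (P.coeff k)) (quant n (P.coeff l)) := by
  -- Commutation is tested order by order in ħ and point by point, that is, by complex linear
  -- functionals of each argument.
  have hiff : ∀ f g : Obs n, Commute (quant n f) (quant n g) ↔
      ∀ (m : ℕ) (x : Phase n), evalAt x (weyl n m f g - weyl n m g f) = 0 := by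
    intro f g
    constructor
    · intro h m x
      rw [← coeff_quant_mul_quant, ← coeff_quant_mul_quant, h.eq, sub_self, map_zero]
    · intro h
      refine WeylAlgebra.ext fun m => ?_
      rw [coeff_quant_mul_quant, coeff_quant_mul_quant]
      exact Obs.ext fun x => sub_eq_zero.mp (h m x)
  let ev : Phase n → Obs n →ₗ[ℂ] ℂ := fun x =>
    { toFun := evalAt x, map_add' := map_add _, map_smul' := fun _ _ => rfl }
  let φ : ℕ → Phase n → Obs n → Obs n →ₗ[ℂ] ℂ := fun m x g =>
    ev x ∘ₗ ((weyl n m).flip g - weyl n m g)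
  have key : ∀ g : Obs n, ∀ S : Set ℂˣ, S.Infinite →
      (∀ z ∈ S, Commute (quant n (evalLam z P)) (quant n g)) →
      ∀ k, Commute (quant n (P.coeff k)) (quant n g) := by
    intro g S hS h k
    rw [hiff]
    intro m x
    exact coeff_eq_zero_of_evalLam (φ m x g) hS (fun z hz => (hiff _ _).mp (h z hz) m x) k
  have h1 : ∀ (w : ℂˣ) (k : ℤ), Commute (quant n (P.coeff k)) (quant n (evalLam w P)) :=
    fun w => key _ _ (infinite_sq_ne w) fun z hz => U.commute_evalLam n hP hz
  -- With one coefficient already separated from its parameter, the other parameter is unrestricted;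
  -- any infinite set of values serves here.
  exact (key (P.coeff k) _ (infinite_sq_ne 1) (fun z _ => (h1 z k).symm) l).symm

lemma spectralStar_atLam_atMu {n : ℕ} (P : (Obs n)[T;T⁻¹]) :
    spectralStar (atLam P) (atMu P) = P.coeff.sum fun k f => P.coeff.sum fun l g =>
      AddMonoidAlgebra.single (k, l) (starMul (weyl n) (cl f) (cl g)) := by
  have hl : ∀ F : QObs n, starMul (weyl n) F 0 = 0 := starMul_zero
  have hz : ∀ F : QObs n, starMul (weyl n) 0 F = 0 := zero_starMul
  simp only [spectralStar, atLam, atMu, AddMonoidAlgebra.coeff_finsuppSum,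
    AddMonoidAlgebra.coeff_single]
  rw [Finsupp.sum_sum_index (by simp [hz])
    (by intros; simp [add_starMul, Finsupp.sum_add])]
  refine Finsupp.sum_congr fun k _ => ?_
  rw [Finsupp.sum_single_index (by simp [hz]), Finsupp.sum_sum_index (by simp [hl])
    (by intros; simp [starMul_add])]
  refine Finsupp.sum_congr fun l _ => ?_
  rw [Finsupp.sum_single_index (by simp [hl])]
  simp

lemma spectralStar_atMu_atLam {n : ℕ} (P : (Obs n)[T;T⁻¹]) :
    spectralStar (atMu P) (atLam P) = P.coeff.sum fun l g => P.coeff.sum fun k f =>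
      AddMonoidAlgebra.single (k, l) (starMul (weyl n) (cl g) (cl f)) := by
  have hl : ∀ F : QObs n, starMul (weyl n) F 0 = 0 := starMul_zero
  have hz : ∀ F : QObs n, starMul (weyl n) 0 F = 0 := zero_starMul
  simp only [spectralStar, atLam, atMu, AddMonoidAlgebra.coeff_finsuppSum,
    AddMonoidAlgebra.coeff_single]
  rw [Finsupp.sum_sum_index (by simp [hz])
    (by intros; simp [add_starMul, Finsupp.sum_add])]
  refine Finsupp.sum_congr fun k _ => ?_
  rw [Finsupp.sum_single_index (by simp [hz]), Finsupp.sum_sum_index (by simp [hl])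
    (by intros; simp [starMul_add])]
  refine Finsupp.sum_congr fun l _ => ?_
  rw [Finsupp.sum_single_index (by simp [hl])]
  simp

lemma Lax.spectralStar_comm (U : Lax) (n : ℕ) {P : (Obs n)[T;T⁻¹]}
    (hP : P = chi U n ∨ P = chiTilde U n) :
    spectralStar (atLam P) (atMu P) = spectralStar (atMu P) (atLam P) := by
  rw [spectralStar_atLam_atMu, spectralStar_atMu_atLam, Finsupp.sum_comm]
  refine Finsupp.sum_congr fun l _ => Finsupp.sum_congr fun k _ => ?_
  rw [← quant_mul_quant, ← quant_mul_quant, (U.commute_coeff n hP k l).eq]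

/-! ### Functional independence of multi-affine functions -/

/-- The weights n - i are positive and strictly decreasing. Indices up to j weigh at least n - j and
the others at most n - j - 1, so replacing or dropping elements of the initial segment loses weight.
-/
lemma sum_weight_lt {n : ℕ} {j : Fin n} {S : Finset (Fin n)} (hS : S.card ≤ (j : ℕ) + 1)
    (hne : S ≠ Finset.Iic j) :
    ∑ i ∈ S, (n - (i : ℕ)) < ∑ i ∈ Finset.Iic j, (n - (i : ℕ)) := by
  classical
  set I := Finset.Iic j
  have hI : I.card = (j : ℕ) + 1 := Fin.card_Iic j
  have hcard : (S \ I).card ≤ (I \ S).card := by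
    have h1 := Finset.card_sdiff_add_card_inter S I
    have h2 := Finset.card_sdiff_add_card_inter I S
    rw [Finset.inter_comm] at h2
    omega
  have hpos : 0 < (I \ S).card := by
    rw [Finset.card_pos, Finset.sdiff_nonempty]
    exact fun h => hne (Finset.eq_of_subset_of_card_le h (by omega)).symm
  have h1 : ∑ i ∈ S \ I, (n - (i : ℕ)) ≤ (S \ I).card * (n - (j : ℕ) - 1) := by
    refine (Finset.sum_le_card_nsmul _ _ (n - (j : ℕ) - 1) fun i hi => ?_).trans_eq (by simp)
    have : ¬ i ≤ j := by simpa [I] using (Finset.mem_sdiff.mp hi).2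
    have : (j : ℕ) < i := by simpa using this
    omega
  have h2 : (I \ S).card * (n - (j : ℕ)) ≤ ∑ i ∈ I \ S, (n - (i : ℕ)) := by
    refine (by simp : (I \ S).card * (n - (j : ℕ)) = (I \ S).card • (n - (j : ℕ))).trans_le
      (Finset.card_nsmul_le_sum _ _ (n - (j : ℕ)) fun i hi => ?_)
    have : i ≤ j := by simpa [I] using (Finset.mem_sdiff.mp hi).1
    have : (i : ℕ) ≤ j := this
    omega
  have h3 : (S \ I).card * (n - (j : ℕ) - 1) < (I \ S).card * (n - (j : ℕ)) := by
    have hj := j.2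
    calc (S \ I).card * (n - (j : ℕ) - 1) ≤ (I \ S).card * (n - (j : ℕ) - 1) :=
          Nat.mul_le_mul_right _ hcard
      _ < (I \ S).card * (n - (j : ℕ)) := Nat.mul_lt_mul_of_pos_left (by omega) hpos
  have h4 := Finset.sum_inter_add_sum_sdiff S I fun i => n - (i : ℕ)
  have h5 := Finset.sum_inter_add_sum_sdiff I S fun i => n - (i : ℕ)
  rw [Finset.inter_comm] at h5
  omega

/-- The polynomials `x_k ∂f_j/∂x_k` for the multi-affine functions `f_j = ∑_S c_{j,S} x_S`. -/
def eulerMatrix {n : ℕ} (c : Fin n → Finset (Fin n) → ℂ) :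
    Matrix (Fin n) (Fin n) (MvPolynomial (Fin n) ℂ) :=
  Matrix.of fun j k => ∑ S : Finset (Fin n), if k ∈ S then
    MvPolynomial.C (c j S) * ∏ i ∈ S, MvPolynomial.X i else 0

lemma eval_eulerMatrix {n : ℕ} (c : Fin n → Finset (Fin n) → ℂ) (x : Fin n → ℂ) (j k : Fin n) :
    MvPolynomial.eval x (eulerMatrix c j k) =
      ∑ S : Finset (Fin n), if k ∈ S then c j S * ∏ i ∈ S, x i else 0 := by
  simp only [eulerMatrix, Matrix.of_apply, map_sum]
  refine Finset.sum_congr rfl fun S _ => ?_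
  split_ifs <;> simp

/-- Under x_i = t^(n-i) the monomial of the initial segment dominates its row as t → ∞. After each
row is divided by it, the matrix tends to a lower triangular one with nonzero diagonal; a vanishing
determinant would survive in the limit. -/
lemma det_eulerMatrix_ne_zero {n : ℕ} (c : Fin n → Finset (Fin n) → ℂ)
    (hc : ∀ (j : Fin n) S, (j : ℕ) + 1 < S.card → c j S = 0) (h : ∀ j, c j (Finset.Iic j) ≠ 0) :
    (eulerMatrix c).det ≠ 0 := by
  classical
  intro h0
  -- The exponent of t in the leading monomial of row j.
  let W : Fin n → ℕ := fun j => ∑ i ∈ Finset.Iic j, (n - (i : ℕ))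
  let L : Matrix (Fin n) (Fin n) ℂ :=
    Matrix.of fun j k => if k ≤ j then c j (Finset.Iic j) else 0
  let A : ℝ → Matrix (Fin n) (Fin n) ℂ := fun t =>
    (eulerMatrix c).map (MvPolynomial.eval fun i : Fin n => ((t ^ (n - (i : ℕ)) : ℝ) : ℂ))
  let B : ℝ → Matrix (Fin n) (Fin n) ℂ := fun t =>
    Matrix.of fun j k => (((t ^ W j)⁻¹ : ℝ) : ℂ) * A t j k
  have hB0 : ∀ t, (B t).det = 0 := by
    intro t
    have hA : (A t).det = 0 := by
      have := congrArg (MvPolynomial.eval fun i : Fin n => ((t ^ (n - (i : ℕ)) : ℝ) : ℂ)) h0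
      rwa [RingHom.map_det, map_zero] at this
    rw [Matrix.det_mul_column, hA, mul_zero]
  have hL : L.det = ∏ j, c j (Finset.Iic j) := by
    rw [Matrix.det_of_isLowerTriangular L]
    · simp [L]
    · intro i j hij
      have : ¬ j ≤ i := not_le.mpr hij
      simp [L, this]
  have hlim : Filter.Tendsto B Filter.atTop (nhds L) := by
    refine tendsto_pi_nhds.mpr fun j => tendsto_pi_nhds.mpr fun k => ?_
    have hterm : ∀ S : Finset (Fin n), Filter.Tendsto (fun t : ℝ => if k ∈ S then
        c j S * ((t ^ (∑ i ∈ S, (n - (i : ℕ))) / t ^ W j : ℝ) : ℂ) else 0) Filter.atTop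
        (nhds (if S = Finset.Iic j then (if k ∈ S then c j S else 0) else 0)) := by
      intro S
      by_cases hkS : k ∈ S
      · simp only [hkS, if_true]
        split_ifs with hS
        · have he : (fun _ : ℝ => c j S) =ᶠ[Filter.atTop] fun t : ℝ =>
              c j S * ((t ^ (∑ i ∈ S, (n - (i : ℕ))) / t ^ W j : ℝ) : ℂ) := by
            filter_upwards [Filter.eventually_gt_atTop 0] with t ht
            rw [hS, div_self (pow_ne_zero _ ht.ne')]
            simp
          exact tendsto_const_nhds.congr' he
        · by_cases hcard : (j : ℕ) + 1 < S.card
          · simp [hc j S hcard]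
          · have h1 : Filter.Tendsto
                (fun t : ℝ => t ^ (∑ i ∈ S, (n - (i : ℕ))) / t ^ W j) Filter.atTop (nhds 0) :=
              tendsto_pow_div_pow_atTop_zero (sum_weight_lt (not_lt.mp hcard) hS)
            have h2 := (Complex.continuous_ofReal.tendsto 0).comp h1
            have h3 := h2.const_mul (c j S)
            simpa using h3
      · simp [hkS]
    have hsum := tendsto_finsetSum Finset.univ fun S _ => hterm S
    rw [Finset.sum_ite_eq' Finset.univ (Finset.Iic j)] at hsum
    simp only [Finset.mem_univ, if_true, Finset.mem_Iic] at hsum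
    refine hsum.congr fun t => ?_
    simp only [B, A, Matrix.of_apply, Matrix.map_apply, eval_eulerMatrix, Finset.mul_sum]
    refine Finset.sum_congr rfl fun S _ => ?_
    split_ifs
    · rw [← Complex.ofReal_prod, Finset.prod_pow_eq_pow_sum, div_eq_mul_inv]
      push_cast
      ring
    · simp
  have hdet : Filter.Tendsto (fun t => (B t).det) Filter.atTop (nhds L.det) :=
    ((continuous_id.matrix_det).tendsto L).comp hlim
  simp only [hB0] at hdet
  have := tendsto_nhds_unique hdet tendsto_const_nhds
  rw [hL, Finset.prod_eq_zero_iff] at this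
  obtain ⟨j, -, hj⟩ := this
  exact h j hj

lemma fderiv_multiaffine {n : ℕ} {φ φ' : ℝ → ℂ} (hφ : ∀ t, HasDerivAt φ (φ' t) t) (f : Obs n)
    (c : Finset (Fin n) → ℂ) (q : Fin n → ℝ)
    (hf : ∀ p, f.1 (q, p) = ∑ S : Finset (Fin n), c S * ∏ i ∈ S, φ (p i)) (p : Fin n → ℝ)
    (k : Fin n) : fderiv ℝ f.1 (q, p) (0, Pi.single k 1) =
      ∑ S : Finset (Fin n), if k ∈ S then c S * (φ' (p k) * ∏ i ∈ S.erase k, φ (p i)) else 0 := by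
  have hline : HasDerivAt (fun t : ℝ => ((q, p) : Phase n) + t • ((0, Pi.single k 1) : Phase n))
      (0, Pi.single k 1) 0 := by
    simpa using ((hasDerivAt_id (0 : ℝ)).smul_const ((0, Pi.single k 1) : Phase n)).const_add
      ((q, p) : Phase n)
  have h1 : HasDerivAt (fun t : ℝ => f.1 (((q, p) : Phase n) + t • ((0, Pi.single k 1) : Phase n)))
      (fderiv ℝ f.1 (q, p) (0, Pi.single k 1)) 0 := by
    have h := (f.differentiable (((q, p) : Phase n) +
      (0 : ℝ) • ((0, Pi.single k 1) : Phase n))).hasFDerivAt.comp_hasDerivAt 0 hline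
    rw [zero_smul, add_zero] at h
    exact h
  refine h1.unique ?_
  have h2 : (fun t : ℝ => f.1 (((q, p) : Phase n) + t • ((0, Pi.single k 1) : Phase n))) =
      fun t => ∑ S : Finset (Fin n), c S *
        ∏ i ∈ S, φ ((p + t • (Pi.single k 1 : Fin n → ℝ)) i) := by
    funext t
    rw [← hf]
    simp
  rw [h2]
  refine HasDerivAt.fun_sum fun S _ => ?_
  have hne : ∀ i, i ≠ k → ∀ t : ℝ, (p + t • (Pi.single k 1 : Fin n → ℝ)) i = p i := by
    intro i hi t
    simp [hi]
  split_ifs with hk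
  · refine HasDerivAt.const_mul _ ?_
    have h3 : (fun t : ℝ => ∏ i ∈ S, φ ((p + t • (Pi.single k 1 : Fin n → ℝ)) i)) =
        fun t => φ (p k + t) * ∏ i ∈ S.erase k, φ (p i) := by
      funext t
      rw [← Finset.mul_prod_erase S _ hk]
      congr 1
      · simp
      · exact Finset.prod_congr rfl fun i hi => by rw [hne i (Finset.ne_of_mem_erase hi)]
    rw [h3]
    refine HasDerivAt.mul_const ?_ _
    have h4 : HasDerivAt φ (φ' (p k)) (p k + 0) := by simpa using hφ (p k)
    exact h4.comp_const_add (p k) 0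
  · have h3 : (fun t : ℝ => c S * ∏ i ∈ S, φ ((p + t • (Pi.single k 1 : Fin n → ℝ)) i)) =
        fun _ => c S * ∏ i ∈ S, φ (p i) := by
      funext t
      congr 1
      exact Finset.prod_congr rfl fun i hi => by rw [hne i (by rintro rfl; exact hk hi)]
    rw [h3]
    exact hasDerivAt_const _ _

/-- A connected set with two points is infinite, and an image with only one point would force the
derivative to vanish at the centre. -/
lemma infinite_image_ball {φ φ' : ℝ → ℂ} (hφ : ∀ t, HasDerivAt φ (φ' t) t) (hφ' : ∀ t, φ' t ≠ 0)
    (a : ℝ) {r : ℝ} (hr : 0 < r) : (φ '' Metric.ball a r).Infinite := by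
  have hcont : Continuous φ := continuous_iff_continuousAt.mpr fun t => (hφ t).continuousAt
  refine IsPreconnected.infinite_of_nontrivial
    (((convex_ball a r).isPreconnected).image φ hcont.continuousOn) ?_
  by_contra hs
  rw [Set.not_nontrivial_iff] at hs
  have hev : φ =ᶠ[nhds a] fun _ => φ a := by
    filter_upwards [Metric.ball_mem_nhds a hr] with t ht
    exact hs ⟨t, ht, rfl⟩ ⟨a, Metric.mem_ball_self hr, rfl⟩
  exact hφ' a ((hφ a).unique ((hasDerivAt_const a (φ a)).congr_of_eventuallyEq hev))

/-- Functions that are multi-affine in `φ(p_1), …, φ(p_n)`, the `j`-th one of degree at most `j`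
and with leading monomial `φ(p_1) ⋯ φ(p_j)`, are functionally independent. -/
lemma functionallyIndependent_of_multiaffine {n : ℕ} {φ φ' θ : ℝ → ℂ}
    (hφ : ∀ t, HasDerivAt φ (φ' t) t) (hφ' : ∀ t, φ' t ≠ 0) (hθ : ∀ t, θ t * φ' t = φ t)
    (f : Fin n → Obs n) (c : (Fin n → ℝ) → Fin n → Finset (Fin n) → ℂ)
    (hf : ∀ j q p, (f j).1 (q, p) = ∑ S : Finset (Fin n), c q j S * ∏ i ∈ S, φ (p i))
    (hc : ∀ q (j : Fin n) S, (j : ℕ) + 1 < S.card → c q j S = 0)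
    (hd : Dense {q | ∀ j, c q j (Finset.Iic j) ≠ 0}) : FunctionallyIndependent f := by
  rw [FunctionallyIndependent, dense_iff_inter_open]
  rintro U hU ⟨⟨q₀, p₀⟩, h0⟩
  obtain ⟨V, W, hV, hW, hqV, hpW, hVW⟩ := isOpen_prod_iff.mp hU q₀ p₀ h0
  obtain ⟨r, hr, hball⟩ := Metric.isOpen_iff.mp hW p₀ hpW
  obtain ⟨q, hq, hgood⟩ := (dense_iff_inter_open.mp hd) V hV ⟨q₀, hqV⟩
  have hdet := det_eulerMatrix_ne_zero (c q) (hc q) hgood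
  -- A nonzero polynomial cannot vanish on a product of infinite sets. Thus the coordinates φ(p_i)
  -- can be chosen with p as close to the given point as needed.
  have hex : ∃ x ∈ Set.pi Set.univ fun i => φ '' Metric.ball (p₀ i) r,
      MvPolynomial.eval x (eulerMatrix (c q)).det ≠ 0 := by
    by_contra! hcon
    refine hdet (MvPolynomial.funext_set (fun i => φ '' Metric.ball (p₀ i) r)
      (fun i => infinite_image_ball hφ hφ' _ hr) fun x hx => ?_)
    rw [hcon x hx, map_zero]
  obtain ⟨x, hx, hxdet⟩ := hex
  choose p hp hpx using fun i => hx i trivial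
  have hpW : p ∈ W := hball (by
    rw [ball_pi _ hr]
    exact fun i _ => hp i)
  refine ⟨(q, p), hVW ⟨hq, hpW⟩, ?_⟩
  rw [Set.mem_ofPred_eq, Fintype.linearIndependent_iff]
  intro a ha
  refine congrFun (?_ : a = 0)
  rw [RingHom.map_det] at hxdet
  refine Matrix.eq_zero_of_vecMul_eq_zero hxdet (funext fun k => ?_)
  -- Multiplying ∂/∂p_k by θ = φ/φ' turns it into the Euler operator x_k ∂/∂x_k in x_k = φ(p_k),
  -- whose values are the entries of the Euler matrix.
  have hk := congrArg (fun L : Phase n →L[ℝ] ℂ => θ (p k) * L (0, Pi.single k 1)) ha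
  simp only [sum_apply, smul_apply, zero_apply, mul_zero, Finset.mul_sum, smul_eq_mul] at hk
  rw [Matrix.vecMul, dotProduct, Pi.zero_apply, ← hk]
  refine Finset.sum_congr rfl fun j _ => ?_
  rw [fderiv_multiaffine hφ (f j) (c q j) q (hf j q) p k, RingHom.mapMatrix_apply,
    Matrix.map_apply, eval_eulerMatrix, mul_left_comm]
  congr 1
  rw [Finset.mul_sum]
  refine Finset.sum_congr rfl fun S _ => ?_
  split_ifs with hS
  · rw [← Finset.mul_prod_erase S _ hS, ← hpx k, ← hθ (p k)]
    simp only [← hpx]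
    ring
  · simp

/-! ### The monodromy matrix at a point of phase space -/

/-- The combination `tr(diag(1, δ) A)`. -/
def weightedTrace {R : Type*} [CommRing R] (δ : ℕ) (A : Matrix (Fin 2) (Fin 2) R) : R :=
  A 0 0 + δ * A 1 1

lemma weightedTrace_map {R S : Type*} [CommRing R] [CommRing S] (δ : ℕ) (f : R →+* S)
    (A : Matrix (Fin 2) (Fin 2) R) : weightedTrace δ (A.map f) = f (weightedTrace δ A) := by
  simp [weightedTrace]

lemma weightedTrace_smul {R : Type*} [CommRing R] (δ : ℕ) (a : R)
    (A : Matrix (Fin 2) (Fin 2) R) : weightedTrace δ (a • A) = a * weightedTrace δ A := by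
  simp only [weightedTrace, Matrix.smul_apply, smul_eq_mul]
  ring

lemma weightedTrace_sum {R ι : Type*} [CommRing R] (δ : ℕ) (s : Finset ι)
    (A : ι → Matrix (Fin 2) (Fin 2) R) :
    weightedTrace δ (∑ i ∈ s, A i) = ∑ i ∈ s, weightedTrace δ (A i) := by
  simp [weightedTrace, Matrix.sum_apply, Finset.mul_sum, Finset.sum_add_distrib]

lemma chi_eq_weightedTrace (U : Lax) (n : ℕ) : chi U n = weightedTrace 1 (U.prod n) := by
  simp [chi, weightedTrace, Matrix.trace]

lemma chiTilde_eq_weightedTrace (U : Lax) (n : ℕ) :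
    chiTilde U n = weightedTrace 0 (U.prod n) := by
  simp [chiTilde, weightedTrace, Matrix.trace, Matrix.mul_apply, Matrix.single]

/-- Evaluation of the coefficients of a Laurent polynomial at a point of phase space. -/
def evalCoeffs {n : ℕ} (x : Phase n) : (Obs n)[T;T⁻¹] →+* ℂ[T;T⁻¹] :=
  AddMonoidAlgebra.mapRingHom ℤ (evalAt x)

lemma coeff_evalCoeffs {n : ℕ} (x : Phase n) (P : (Obs n)[T;T⁻¹]) (k : ℤ) :
    (evalCoeffs x P).coeff k = evalAt x (P.coeff k) :=
  AddMonoidAlgebra.coeff_mapRingHom ..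

lemma evalCoeffs_C {n : ℕ} (x : Phase n) (f : Obs n) :
    evalCoeffs x (LaurentPolynomial.C f) = LaurentPolynomial.C (evalAt x f) :=
  AddMonoidAlgebra.map_single ..

lemma evalCoeffs_T {n : ℕ} (x : Phase n) (k : ℤ) :
    evalCoeffs x (LaurentPolynomial.T k) = LaurentPolynomial.T k := by
  exact (AddMonoidAlgebra.map_single ..).trans
    (congrArg (AddMonoidAlgebra.single k) (map_one (evalAt x)))

/-- The point of the phase space of the `k`-th site. -/
def sitePoint {n : ℕ} (x : Phase n) (k : Fin n) : Phase 1 := (fun _ => x.1 k, fun _ => x.2 k)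

lemma Lax.site_evalCoeffs (U : Lax) {n : ℕ} (x : Phase n) (k : Fin n) :
    (U.site k).map (evalCoeffs x) = U.mat.map (evalCoeffs (sitePoint x k)) := by
  ext i j m
  simp only [Lax.site, Matrix.map_apply, coeff_evalCoeffs, AddMonoidAlgebra.coeff_mapRingHom]
  rfl

lemma Lax.prod_evalCoeffs (U : Lax) (n : ℕ) (x : Phase n) :
    (U.prod n).map (evalCoeffs x) =
      ((List.finRange n).reverse.map fun k => U.mat.map (evalCoeffs (sitePoint x k))).prod := by
  rw [Lax.prod_eq]
  have h := map_list_prod (evalCoeffs x).mapMatrix ((List.finRange n).reverse.map U.site)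
  rw [RingHom.mapMatrix_apply, List.map_map] at h
  rw [h]
  congr 1
  refine List.map_congr_left fun k _ => ?_
  rw [Function.comp_apply, RingHom.mapMatrix_apply, U.site_evalCoeffs]

/-! ### Substitution of a power of the spectral parameter -/

/-- The substitution `z ↦ λ^d`. -/
def substT (d : ℤ) : Polynomial ℂ →+* ℂ[T;T⁻¹] :=
  Polynomial.eval₂RingHom LaurentPolynomial.C (LaurentPolynomial.T d)

lemma substT_C (d : ℤ) (a : ℂ) : substT d (Polynomial.C a) = LaurentPolynomial.C a := by
  simp [substT]

lemma substT_X (d : ℤ) : substT d Polynomial.X = LaurentPolynomial.T d := by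
  simp [substT]

lemma T_mul_substT_monomial (s d : ℤ) (m : ℕ) (a : ℂ) :
    LaurentPolynomial.T s * substT d (Polynomial.monomial m a) =
      AddMonoidAlgebra.single (s + d * m) a := by
  rw [← Polynomial.C_mul_X_pow_eq_monomial, map_mul, map_pow, substT_C, substT_X,
    LaurentPolynomial.T_pow, mul_left_comm, ← LaurentPolynomial.T_add,
    LaurentPolynomial.single_eq_C_mul_T, mul_comm (m : ℤ)]

lemma coeff_T_mul_substT {d : ℤ} (hd : d ≠ 0) (s : ℤ) (Q : Polynomial ℂ) (j : ℕ) :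
    (LaurentPolynomial.T s * substT d Q).coeff (s + d * j) = Q.coeff j := by
  induction Q using Polynomial.induction_on' with
  | add p q hp hq =>
    rw [map_add (substT d), mul_add, AddMonoidAlgebra.coeff_add, Finsupp.add_apply, hp, hq,
      Polynomial.coeff_add]
  | monomial m a =>
    rw [T_mul_substT_monomial, Polynomial.coeff_monomial, AddMonoidAlgebra.coeff_single,
      Finsupp.single_apply]
    simp [hd]

lemma coeff_T_mul_substT_of_ne {d : ℤ} (s : ℤ) (Q : Polynomial ℂ) {k : ℤ}
    (hk : ∀ j : ℕ, k ≠ s + d * j) : (LaurentPolynomial.T s * substT d Q).coeff k = 0 := by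
  induction Q using Polynomial.induction_on' with
  | add p q hp hq =>
    rw [map_add, mul_add, AddMonoidAlgebra.coeff_add, Finsupp.add_apply, hp, hq, add_zero]
  | monomial m a =>
    rw [T_mul_substT_monomial, AddMonoidAlgebra.coeff_single, Finsupp.single_apply]
    simp [(hk m).symm]

/-- The diagonal gauge transformation `diag(1, λ^g)`. -/
def gauge (g : ℤ) : Matrix (Fin 2) (Fin 2) ℂ[T;T⁻¹] := !![1, 0; 0, LaurentPolynomial.T g]

/-- The gauge is the same at every site, so the intermediate factors cancel. Writing the conjugation
as an intertwining relation avoids inverses. -/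
lemma gauge_mul_prod {ι : Type*} {g r d : ℤ} {L : ι → Matrix (Fin 2) (Fin 2) ℂ[T;T⁻¹]}
    {M : ι → Matrix (Fin 2) (Fin 2) (Polynomial ℂ)}
    (h : ∀ k, gauge g * L k =
      ((LaurentPolynomial.T r : ℂ[T;T⁻¹]) • (M k).map (substT d)) * gauge g) (l : List ι) :
    gauge g * (l.map L).prod = ((LaurentPolynomial.T (r * l.length) : ℂ[T;T⁻¹]) •
      ((l.map M).prod).map (substT d)) * gauge g := by
  induction l with
  | nil => simp
  | cons k l ih =>
    rw [List.map_cons, List.prod_cons, List.map_cons, List.prod_cons, ← mul_assoc, h, mul_assoc,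
      ih, Matrix.map_mul, ← mul_assoc, List.length_cons, Matrix.smul_mul, Matrix.mul_smul,
      smul_smul, ← LaurentPolynomial.T_add]
    congr 3
    push_cast
    ring

/-- Conjugation by a diagonal matrix leaves the diagonal entries unchanged, and both traces see
nothing else. -/
lemma weightedTrace_of_gauge {g s d : ℤ} {L : Matrix (Fin 2) (Fin 2) ℂ[T;T⁻¹]}
    {M : Matrix (Fin 2) (Fin 2) (Polynomial ℂ)} (h : gauge g * L =
      ((LaurentPolynomial.T s : ℂ[T;T⁻¹]) • M.map (substT d)) * gauge g) (δ : ℕ) :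
    weightedTrace δ L = LaurentPolynomial.T s * substT d (weightedTrace δ M) := by
  have h0 := congrFun (congrFun h 0) 0
  have h1 := congrFun (congrFun h 1) 1
  simp [gauge, Matrix.mul_apply] at h0 h1
  have h2 : L 1 1 = LaurentPolynomial.T s * substT d (M 1 1) := by
    refine (LaurentPolynomial.isUnit_T (R := ℂ) g).mul_right_cancel ?_
    refine h1.trans ?_
    rw [LaurentPolynomial.T_add]
    ring
  have h0' : L 0 0 = LaurentPolynomial.T s * substT d (M 0 0) := h0.trans (mul_comm _ _)
  rw [weightedTrace, weightedTrace, h0', h2, map_add, map_mul, map_natCast]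
  ring

/-! ### Expansion of products of matrix pencils -/

lemma prod_pencil_eq_sum {ι R A : Type*} [DecidableEq ι] [CommRing R] [Ring A] [Algebra R A]
    (s : ι → R) (Y X : ι → A) {l : List ι} (hl : l.Nodup) :
    (l.map fun k => Y k + s k • X k).prod = ∑ S ∈ l.toFinset.powerset,
      (∏ k ∈ S, s k) • (l.map fun k => if k ∈ S then X k else Y k).prod := by
  induction l with
  | nil => simp
  | cons k l ih =>
    obtain ⟨hk, hl⟩ := List.nodup_cons.mp hl
    have hk' : k ∉ l.toFinset := by simpa using hk
    rw [List.map_cons, List.prod_cons, ih hl, List.toFinset_cons,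
      Finset.sum_powerset_insert hk', add_mul, Finset.mul_sum, Finset.mul_sum]
    congr 1
    · refine Finset.sum_congr rfl fun S hS => ?_
      have hkS : k ∉ S := fun h => hk' (Finset.mem_powerset.mp hS h)
      rw [List.map_cons, List.prod_cons, if_neg hkS, mul_smul_comm]
    · refine Finset.sum_congr rfl fun S hS => ?_
      have hkS : k ∉ S := fun h => hk' (Finset.mem_powerset.mp hS h)
      have hmap : (l.map fun i => if i ∈ insert k S then X i else Y i) =
          l.map fun i => if i ∈ S then X i else Y i := by
        refine List.map_congr_left fun i hi => ?_
        have : i ≠ k := by rintro rfl; exact hk hi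
        simp [this]
      rw [List.map_cons, List.prod_cons, if_pos (Finset.mem_insert_self k S), hmap,
        Finset.prod_insert hkS, mul_smul_comm, smul_mul_assoc, smul_smul, mul_comm]

lemma natDegree_prod_le {ι : Type*} {M : ι → Matrix (Fin 2) (Fin 2) (Polynomial ℂ)}
    (h : ∀ k i j, (M k i j).natDegree ≤ 1) (l : List ι) (i j : Fin 2) :
    ((l.map M).prod i j).natDegree ≤ l.length := by
  induction l generalizing i j with
  | nil =>
    rw [List.map_nil, List.prod_nil, Matrix.one_apply]
    split_ifs <;> simp
  | cons k l ih =>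
    rw [List.map_cons, List.prod_cons, Matrix.mul_apply, List.length_cons, add_comm]
    refine Polynomial.natDegree_sum_le_of_forall_le _ _ fun a _ => ?_
    exact Polynomial.natDegree_mul_le_of_le (h k i a) (ih a j)

lemma natDegree_weightedTrace_le {δ m : ℕ} {A : Matrix (Fin 2) (Fin 2) (Polynomial ℂ)}
    (h : ∀ i j, (A i j).natDegree ≤ m) : (weightedTrace δ A).natDegree ≤ m := by
  refine Polynomial.natDegree_add_le_of_degree_le (h 0 0) ?_
  refine (Polynomial.natDegree_mul_le_of_le (m := 0) (by simp) (h 1 1)).trans_eq (zero_add m)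

lemma prod_lower_triangular {ι : Type*} {w : ι → ℂ}
    {N : ι → Matrix (Fin 2) (Fin 2) ℂ} {l : List ι}
    (h : ∀ k ∈ l, N k 0 0 = w k ∧ N k 0 1 = 0 ∧ N k 1 1 = 0) (hl : l ≠ []) :
    (l.map N).prod 0 0 = (l.map w).prod ∧ (l.map N).prod 0 1 = 0 ∧ (l.map N).prod 1 1 = 0 := by
  induction l with
  | nil => exact absurd rfl hl
  | cons k l ih =>
    obtain ⟨h0, h1, h2⟩ := h k List.mem_cons_self
    by_cases hl' : l = []
    · subst hl'
      simp [h0, h1, h2]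
    · obtain ⟨i0, i1, i2⟩ := ih (fun i hi => h i (List.mem_cons_of_mem k hi)) hl'
      simp [List.prod_cons, Matrix.mul_apply, h0, h1, h2, i0, i1, i2]

/-- A Lax matrix, up to a gauge transformation and a power of `λ`, as a pencil of matrices that is
polynomial in `z = λ^d` and affine in `z φ(p)`. -/
structure Pencil (mat : Matrix (Fin 2) (Fin 2) (Obs 1)[T;T⁻¹]) where
  /-- The overall power of `λ`. -/
  r : ℤ
  /-- The exponent of the substitution `z = λ^d`. -/
  d : ℤ
  /-- The exponent of the gauge transformation. -/
  g : ℤ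
  d_ne_zero : d ≠ 0
  /-- The function of the momentum. -/
  φ : ℝ → ℂ
  /-- The derivative of `φ`. -/
  φ' : ℝ → ℂ
  /-- The quotient `φ / φ'`. -/
  θ : ℝ → ℂ
  hasDerivAt : ∀ t, HasDerivAt φ (φ' t) t
  deriv_ne_zero : ∀ t, φ' t ≠ 0
  mul_deriv : ∀ t, θ t * φ' t = φ t
  /-- The part that does not depend on the momentum. -/
  Y : ℝ → Matrix (Fin 2) (Fin 2) (Polynomial ℂ)
  /-- The coefficient of `z φ(p)`. -/
  X : ℝ → Matrix (Fin 2) (Fin 2) (Polynomial ℂ)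
  /-- The upper left entry of `Y` at `z = 0`. -/
  w : ℂ
  gauge_mul : ∀ x : Phase 1, gauge g * mat.map (evalCoeffs x) =
    ((LaurentPolynomial.T r : ℂ[T;T⁻¹]) • ((Y (x.1 0) +
      (Polynomial.X * Polynomial.C (φ (x.2 0))) • X (x.1 0)).map (substT d))) * gauge g
  -- One power of z per site bounds the spectral polynomial by degree n.
  natDegree_le : ∀ q t i j,
    ((Y q + (Polynomial.X * Polynomial.C (φ t)) • X q) i j).natDegree ≤ 1
  -- At z = 0 the pencil reduces to Y. This shape makes the product there lower triangular with
  -- constant diagonal, so the lowest coefficient is no observable of interest.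
  coeff_zero : ∀ q, (Y q 0 0).coeff 0 = w ∧ (Y q 0 1).coeff 0 = 0 ∧ (Y q 1 1).coeff 0 = 0

namespace Pencil

variable {mat : Matrix (Fin 2) (Fin 2) (Obs 1)[T;T⁻¹]} (D : Pencil mat) {U : Lax}
  {n : ℕ} (δ : ℕ)

/-- The spectral polynomial at a point of phase space. -/
def spectral (x : Phase n) : Polynomial ℂ :=
  weightedTrace δ ((List.finRange n).reverse.map fun k => D.Y (x.1 k) +
    (Polynomial.X * Polynomial.C (D.φ (x.2 k))) • D.X (x.1 k)).prod

lemma evalCoeffs_eq (hU : U.mat = mat) (x : Phase n) : evalCoeffs x (weightedTrace δ (U.prod n)) =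
    LaurentPolynomial.T (D.r * n) * substT D.d (D.spectral δ x) := by
  rw [← weightedTrace_map, U.prod_evalCoeffs, hU]
  refine weightedTrace_of_gauge (g := D.g) ?_ δ
  have h := gauge_mul_prod (fun k : Fin n => D.gauge_mul (sitePoint x k))
    (List.finRange n).reverse
  rw [List.length_reverse, List.length_finRange] at h
  exact h

lemma evalAt_coeff (hU : U.mat = mat) (x : Phase n) (j : ℕ) :
    evalAt x ((weightedTrace δ (U.prod n)).coeff (D.r * n + D.d * j)) =
      (D.spectral δ x).coeff j := by
  rw [← coeff_evalCoeffs, D.evalCoeffs_eq δ hU, coeff_T_mul_substT D.d_ne_zero]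

lemma natDegree_spectral_le (x : Phase n) : (D.spectral δ x).natDegree ≤ n := by
  refine natDegree_weightedTrace_le fun i j => ?_
  refine (natDegree_prod_le (fun k i j => D.natDegree_le _ _ i j) _ i j).trans_eq ?_
  simp

lemma coeff_zero_prod {n : ℕ} (δ : ℕ) (A : Fin n → Matrix (Fin 2) (Fin 2) (Polynomial ℂ))
    (l : List (Fin n)) :
    (weightedTrace δ (l.map A).prod).coeff 0 =
      weightedTrace δ (l.map fun k => (A k).map (fun P : Polynomial ℂ => P.coeff 0)).prod := by
  have h := map_list_prod (Polynomial.constantCoeff (R := ℂ)).mapMatrix (l.map A)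
  rw [RingHom.mapMatrix_apply, List.map_map] at h
  rw [← Polynomial.constantCoeff_apply, ← weightedTrace_map, h]
  rfl

lemma coeff_zero_spectral : ∃ c, ∀ x : Phase n, (D.spectral δ x).coeff 0 = c := by
  -- The empty product is the identity, whose lower right entry is not 0; for n = 0, however, the
  -- phase space is a single point.
  by_cases hn : n = 0
  · subst hn
    exact ⟨(D.spectral δ (0, 0)).coeff 0, fun x => by rw [Subsingleton.elim x (0, 0)]⟩
  · refine ⟨((List.finRange n).reverse.map fun _ => D.w).prod, fun x => ?_⟩
    rw [spectral, coeff_zero_prod]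
    have h := prod_lower_triangular (l := (List.finRange n).reverse) (w := fun _ => D.w)
      (N := fun k => (D.Y (x.1 k) + (Polynomial.X * Polynomial.C (D.φ (x.2 k))) •
        D.X (x.1 k)).map (fun P : Polynomial ℂ => P.coeff 0)) (fun k _ => by
          obtain ⟨h0, h1, h2⟩ := D.coeff_zero (x.1 k)
          simp [h0, h1, h2]) (by simpa using hn)
    rw [weightedTrace, h.1, h.2.2]
    simp

/-- The coefficient of the monomial `∏_{i ∈ S} φ(p_i)` in the coefficient of `z^(j+1)`. -/
def monomialCoeff (q : Fin n → ℝ) (j : Fin n) (S : Finset (Fin n)) : ℂ :=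
  if S.card ≤ (j : ℕ) + 1 then
    (weightedTrace δ ((List.finRange n).reverse.map fun k =>
      if k ∈ S then D.X (q k) else D.Y (q k)).prod).coeff ((j : ℕ) + 1 - S.card)
  else 0

/-- Every choice of X brings a factor z φ(p_k), so a set S of such choices contributes only from
z^|S| on. This is the bound on the degree in the φ(p_k). -/
lemma coeff_spectral (q p : Fin n → ℝ) (j : Fin n) :
    (D.spectral δ (q, p)).coeff ((j : ℕ) + 1) =
      ∑ S : Finset (Fin n), D.monomialCoeff δ q j S * ∏ i ∈ S, D.φ (p i) := by
  rw [spectral, prod_pencil_eq_sum (fun k => Polynomial.X * Polynomial.C (D.φ (p k)))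
    (fun k => D.Y (q k)) (fun k => D.X (q k)) (List.nodup_reverse.mpr (List.nodup_finRange n)),
    weightedTrace_sum, Polynomial.finsetSum_coeff]
  have huniv : ((List.finRange n).reverse.toFinset).powerset = Finset.univ := by
    ext S
    simp
  rw [huniv]
  refine Finset.sum_congr rfl fun S _ => ?_
  rw [weightedTrace_smul, Finset.prod_mul_distrib, Finset.prod_const, ← map_prod, mul_assoc,
    Polynomial.coeff_X_pow_mul', monomialCoeff]
  split_ifs
  · rw [Polynomial.coeff_C_mul, mul_comm]
  · simp

/-- The factors X of the initial segment use up all powers of z, so the rest is evaluated at z = 0.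
-/
lemma monomialCoeff_Iic (q : Fin n → ℝ) (j : Fin n) : D.monomialCoeff δ q j (Finset.Iic j) =
    weightedTrace δ ((List.finRange n).reverse.map fun k =>
      (if k ≤ j then D.X (q k) else D.Y (q k)).map (fun P : Polynomial ℂ => P.coeff 0)).prod := by
  rw [monomialCoeff, Fin.card_Iic, if_pos le_rfl, Nat.sub_self, coeff_zero_prod]
  simp

lemma functionallyIndependent (hU : U.mat = mat)
    (hd : Dense {q : Fin n → ℝ | ∀ j, D.monomialCoeff δ q j (Finset.Iic j) ≠ 0}) :
    FunctionallyIndependent fun j : Fin n =>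
      (weightedTrace δ (U.prod n)).coeff (D.r * n + D.d * ((j : ℕ) + 1 : ℕ)) := by
  refine functionallyIndependent_of_multiaffine D.hasDerivAt D.deriv_ne_zero D.mul_deriv _
    (D.monomialCoeff δ) (fun j q p => ?_) (fun q j S hS => ?_) hd
  · rw [← D.coeff_spectral]
    exact D.evalAt_coeff δ hU (q, p) _
  · rw [monomialCoeff, if_neg (not_le.mpr hS)]

/-- A remaining exponent is either not of the form rn + dj, or has j > n, and then the coefficient
vanishes; or it has j = 0, the constant lowest coefficient. -/
lemma exists_coeff_eq (hU : U.mat = mat) (k : ℤ)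
    (hk : ∀ j : Fin n, k ≠ D.r * n + D.d * ((j : ℕ) + 1 : ℕ)) :
    ∃ c : ℂ, (weightedTrace δ (U.prod n)).coeff k = algebraMap ℂ (Obs n) c := by
  by_cases h : ∃ j : ℕ, k = D.r * n + D.d * j
  · obtain ⟨j, rfl⟩ := h
    rcases j with _ | j
    · obtain ⟨c, hc⟩ := D.coeff_zero_spectral (n := n) δ
      exact ⟨c, Obs.ext fun x => (D.evalAt_coeff δ hU x 0).trans (hc x)⟩
    · refine ⟨0, Obs.ext fun x => (D.evalAt_coeff δ hU x (j + 1)).trans ?_⟩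
      have hj : n ≤ j := by
        by_contra hj
        exact hk ⟨j, not_le.mp hj⟩ rfl
      rw [Polynomial.coeff_eq_zero_of_natDegree_lt
        ((D.natDegree_spectral_le δ x).trans_lt (Nat.lt_succ_of_le hj))]
      simp
      rfl
  · push Not at h
    refine ⟨0, Obs.ext fun x => ?_⟩
    have := coeff_T_mul_substT_of_ne (d := D.d) (D.r * n) (D.spectral δ x) h
    rw [← D.evalCoeffs_eq δ hU, coeff_evalCoeffs] at this
    rw [map_zero]
    exact this

end Pencil

/-! ### The two families as pencils -/

lemma evalAt_expQ (x : Phase 1) (a : ℂ) :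
    evalAt x (expQ a) = Complex.exp (a * (x.1 0 : ℂ)) := rfl

lemma evalAt_expP (x : Phase 1) (a : ℂ) :
    evalAt x (expP a) = Complex.exp (a * (x.2 0 : ℂ)) := rfl

lemma evalAt_mom (x : Phase 1) : evalAt x mom = (x.2 0 : ℂ) := rfl

lemma evalAt_smul {n : ℕ} (x : Phase n) (a : ℂ) (f : Obs n) :
    evalAt x (a • f) = a * evalAt x f := rfl

lemma evalAt_algebraMap {n : ℕ} (x : Phase n) (a : ℂ) :
    evalAt x (algebraMap ℂ (Obs n) a) = a := rfl

/-- The pencil of a Lax matrix with a rational `R`-matrix, in `z = 1/λ`. -/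
def todaPencil (a b c : ℂ) : Pencil (todaLax a b c) where
  -- A factor λ is taken out: -λ + p = λ(-1 + zp), and the entries without λ acquire a factor z =
  -- 1/λ.
  r := 1
  d := -1
  g := 0
  d_ne_zero := by norm_num
  φ t := t
  φ' _ := 1
  θ t := t
  hasDerivAt t := Complex.ofRealCLM.hasDerivAt
  deriv_ne_zero _ := one_ne_zero
  mul_deriv _ := mul_one _
  Y q := !![-1, Polynomial.X * Polynomial.C (a * Complex.exp (-q));
    Polynomial.X * Polynomial.C (b * Complex.exp q), Polynomial.X * Polynomial.C (a * c)]
  X q := !![1, 0; Polynomial.C (c * Complex.exp q), 0]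
  w := -1
  gauge_mul x := by
    have hT : (LaurentPolynomial.T 1 : ℂ[T;T⁻¹]) * LaurentPolynomial.T (-1) = 1 := by
      rw [← LaurentPolynomial.T_add]
      simp
    have hT' : ∀ P : ℂ[T;T⁻¹], LaurentPolynomial.T 1 * (LaurentPolynomial.T (-1) * P) = P := by
      intro P
      rw [← mul_assoc, hT, one_mul]
    have hg : gauge 0 = 1 := by
      rw [gauge, LaurentPolynomial.T_zero, Matrix.one_fin_two]
    rw [hg, one_mul, mul_one]
    ext i j : 1
    fin_cases i <;> fin_cases j <;>
      simp [-LaurentPolynomial.T_mul, todaLax, evalCoeffs_C, evalCoeffs_T, evalAt_expQ,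
        evalAt_mom, evalAt_smul, evalAt_algebraMap, substT_C, substT_X, mul_add, hT', mul_assoc]
    · linear_combination -LaurentPolynomial.C (x.2 0 : ℂ) * hT
    · linear_combination -(LaurentPolynomial.C c * (LaurentPolynomial.C (x.2 0 : ℂ) *
        LaurentPolynomial.C (Complex.exp (x.1 0)))) * hT
  natDegree_le q t i j := by
    fin_cases i <;> fin_cases j <;> simp <;> compute_degree!
  coeff_zero q := by simp

/-- The pencil of a Lax matrix with a trigonometric `R`-matrix, in `z = λ²`. -/
def relPencil {ε : ℂ} (hε : ε ≠ 0) (α β γ : ℂ) : Pencil (relLax ε α β γ) where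
  r := -1
  d := 2
  -- The off-diagonal entries have even degree in λ and the diagonal ones odd degree. The gauge
  -- shifts the former by one, so that after removal of 1/λ only powers of λ² remain.
  g := -1
  d_ne_zero := by norm_num
  φ t := Complex.exp (ε * t)
  φ' t := Complex.exp (ε * t) * ε
  θ _ := ε⁻¹
  hasDerivAt t := by
    have h := ((Complex.ofRealCLM.hasDerivAt (x := t)).const_mul ε).cexp
    simpa using h
  deriv_ne_zero _ := mul_ne_zero (Complex.exp_ne_zero _) hε
  mul_deriv _ := by field_simp
  Y q := !![1, -(Polynomial.X * Polynomial.C (β * Complex.exp (-q)));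
    Polynomial.C (γ * Complex.exp q), -(Polynomial.X * Polynomial.C (β * γ))]
  X q := !![-1, -Polynomial.C (α * Complex.exp (-q)); 0, 0]
  w := 1
  gauge_mul x := by
    have h1 : (LaurentPolynomial.T (-1) : ℂ[T;T⁻¹]) * LaurentPolynomial.T 2 =
        LaurentPolynomial.T 1 := by
      rw [← LaurentPolynomial.T_add]
      norm_num
    have h2 : (LaurentPolynomial.T (-1) : ℂ[T;T⁻¹]) * LaurentPolynomial.T 1 = 1 := by
      rw [← LaurentPolynomial.T_add]
      norm_num
    have h3 : (LaurentPolynomial.T (-1) : ℂ[T;T⁻¹]) * LaurentPolynomial.T (-1) *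
        LaurentPolynomial.T 2 = 1 := by rw [mul_assoc, h1, h2]
    ext i j : 1
    fin_cases i <;> fin_cases j <;>
      simp [-LaurentPolynomial.T_mul, gauge, relLax, evalCoeffs_C, evalCoeffs_T, evalAt_expQ,
        evalAt_expP, evalAt_smul, evalAt_algebraMap, substT_C, substT_X, Matrix.mul_apply,
        Fin.sum_univ_two]
    · linear_combination LaurentPolynomial.C (Complex.exp (ε * x.2 0)) * h1
    · linear_combination (LaurentPolynomial.C β * LaurentPolynomial.C (Complex.exp (-x.1 0)) +
        LaurentPolynomial.C (Complex.exp (-x.1 0)) * LaurentPolynomial.C α *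
          LaurentPolynomial.C (Complex.exp (ε * x.2 0))) * h3
    · linear_combination (h2 - h3) * LaurentPolynomial.C β * LaurentPolynomial.C γ
  natDegree_le q t i j := by
    fin_cases i <;> fin_cases j <;> simp <;> compute_degree!
  coeff_zero q := by simp

/-! ### Nonvanishing of the leading coefficients -/

lemma map_finRange_reverse {A : Type*} (n : ℕ) (N : ℕ → A) :
    ((List.finRange n).reverse.map fun k : Fin n => N k) = (List.range n).reverse.map N := by
  rw [← List.map_coe_finRange_eq_range, ← List.map_reverse, List.map_map]
  rfl

lemma prod_range_succ_reverse {A : Type*} [Monoid A] (N : ℕ → A) (m : ℕ) :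
    ((List.range (m + 1)).reverse.map N).prod = N m * ((List.range m).reverse.map N).prod := by
  rw [List.range_succ, List.reverse_concat, List.map_cons, List.prod_cons]


/-- At z = 0 both parts of the pencil are lower triangular with diagonal (±1, 0), so the weighted
trace is a product of signs. -/
lemma todaPencil_monomialCoeff_ne_zero (a b c : ℂ) {n : ℕ} (δ : ℕ) (q : Fin n → ℝ) (j : Fin n) :
    (todaPencil a b c).monomialCoeff δ q j (Finset.Iic j) ≠ 0 := by
  rw [Pencil.monomialCoeff_Iic]
  have h := prod_lower_triangular (l := (List.finRange n).reverse)
    (w := fun k => if k ≤ j then 1 else -1) (N := fun k => (if k ≤ j then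
      (todaPencil a b c).X (q k) else (todaPencil a b c).Y (q k)).map
        (fun P : Polynomial ℂ => P.coeff 0))
    (fun k _ => by split_ifs <;> simp [todaPencil]) (by simpa using j.pos.ne')
  rw [weightedTrace, h.1, h.2.2, mul_zero, add_zero]
  refine List.prod_ne_zero fun h0 => ?_
  obtain ⟨k, -, hk⟩ := List.mem_map.mp h0
  split_ifs at hk <;> norm_num at hk

/-- Here v k stands for e^{-q_k}. A factor with k ≤ j multiplies the upper row by -1, the lower row
being zero. A later factor keeps the upper row and overwrites the lower one by a multiple of it, so
only the first and last sites remain visible. -/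
lemma prod_rel_eq (α γ : ℂ) (v : ℕ → ℂ) (j m : ℕ) :
    ((List.range (m + 1)).reverse.map fun k => if k ≤ j then !![-1, -(α * v k); 0, 0]
      else !![1, 0; γ * (v k)⁻¹, 0]).prod = if m ≤ j then
        (-1 : ℂ) ^ m • !![-1, -(α * v 0); 0, 0]
      else (-1 : ℂ) ^ j • !![-1, -(α * v 0); -(γ * (v m)⁻¹), -(α * γ * v 0 * (v m)⁻¹)] := by
  induction m with
  | zero => simp
  | succ m ih =>
    rw [prod_range_succ_reverse, ih]
    rcases lt_trichotomy m j with h | h | h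
    · rw [if_pos (by omega), if_pos (by omega), if_pos (by omega)]
      ext i k
      fin_cases i <;> fin_cases k <;> simp [pow_succ]
    · subst h
      rw [if_neg (by omega), if_pos le_rfl, if_neg (by omega)]
      ext i k
      fin_cases i <;> fin_cases k <;> simp <;> ring
    · rw [if_neg (by omega), if_neg (by omega), if_neg (by omega)]
      ext i k
      fin_cases i <;> fin_cases k <;> simp <;> ring

lemma relPencil_monomialCoeff {ε : ℂ} (hε : ε ≠ 0) (α β γ : ℂ) {n : ℕ} (δ : ℕ)
    (q : Fin (n + 1) → ℝ) (j : Fin (n + 1)) :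
    (relPencil hε α β γ).monomialCoeff δ q j (Finset.Iic j) = if n ≤ j then (-1) ^ (n + 1)
      else (-1) ^ ((j : ℕ) + 1) *
        (1 + δ * α * γ * Complex.exp ((q (Fin.last n) : ℂ) - q 0)) := by
  rw [Pencil.monomialCoeff_Iic]
  have h := map_finRange_reverse (n + 1) fun k => if k ≤ (j : ℕ)
    then !![-1, -(α * Complex.exp (-(q (Fin.ofNat (n + 1) k))) ); 0, 0]
    else !![1, 0; γ * (Complex.exp (-(q (Fin.ofNat (n + 1) k))))⁻¹, 0]
  have h' := prod_rel_eq α γ (fun k => Complex.exp (-(q (Fin.ofNat (n + 1) k)))) j n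
  rw [← h] at h'
  have hmap : ((List.finRange (n + 1)).reverse.map fun k => (if k ≤ j then
      (relPencil hε α β γ).X (q k) else (relPencil hε α β γ).Y (q k)).map
        (fun P : Polynomial ℂ => P.coeff 0)) =
      (List.finRange (n + 1)).reverse.map fun k : Fin (n + 1) => if (k : ℕ) ≤ (j : ℕ)
    then !![-1, -(α * Complex.exp (-(q (Fin.ofNat (n + 1) k))) ); 0, 0]
    else !![1, 0; γ * (Complex.exp (-(q (Fin.ofNat (n + 1) k))))⁻¹, 0] := by
    refine List.map_congr_left fun k _ => ?_
    have hk : Fin.ofNat (n + 1) k = k := by simp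
    simp only [hk, Fin.le_def]
    split_ifs <;> ext i l <;> fin_cases i <;> fin_cases l <;> simp [relPencil, ← Complex.exp_neg]
  rw [hmap, h']
  split_ifs with hj
  · simp [weightedTrace, pow_succ]
  · simp [weightedTrace, pow_succ, ← Complex.exp_neg, sub_eq_add_neg, Complex.exp_add]
    ring

/-- At a zero, moving q_0 by a small t ≠ 0 changes the exponential term -1 to -e^{-t}. Two sites are
needed for q_0 and the last coordinate to be independent. -/
lemma dense_one_add_exp_ne_zero {n : ℕ} (K : ℂ) :
    Dense {q : Fin (n + 2) → ℝ | 1 + K * Complex.exp ((q (Fin.last (n + 1)) : ℂ) - q 0) ≠ 0} := by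
  intro q
  by_cases hq : 1 + K * Complex.exp ((q (Fin.last (n + 1)) : ℂ) - q 0) = 0
  · have hlim : Filter.Tendsto (fun t : ℝ => Function.update q 0 (q 0 + t)) (nhdsWithin 0 {0}ᶜ)
        (nhds q) := by
      have hc : Continuous fun t : ℝ => Function.update q 0 (q 0 + t) :=
        continuous_const.update 0 (continuous_const.add continuous_id)
      have := hc.tendsto 0
      rw [add_zero, Function.update_eq_self] at this
      exact this.mono_left nhdsWithin_le_nhds
    refine mem_closure_of_tendsto hlim (Filter.eventually_of_mem self_mem_nhdsWithin fun t ht => ?_)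
    have hlast : Fin.last (n + 1) ≠ 0 := Fin.last_pos.ne'
    rw [Set.mem_ofPred_eq, Function.update_self, Function.update_of_ne hlast]
    intro h
    have he : Complex.exp ((q (Fin.last (n + 1)) : ℂ) - ((q 0 + t : ℝ) : ℂ)) =
        Complex.exp ((q (Fin.last (n + 1)) : ℂ) - q 0) * Complex.exp (-(t : ℂ)) := by
      rw [← Complex.exp_add]
      congr 1
      push_cast
      ring
    rw [he, ← mul_assoc, eq_neg_of_add_eq_zero_right hq, neg_one_mul, ← sub_eq_add_neg,
      sub_eq_zero, ← Complex.ofReal_neg, ← Complex.ofReal_exp] at h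
    have := Complex.ofReal_injective (h.symm.trans Complex.ofReal_one.symm)
    rw [Real.exp_eq_one_iff, neg_eq_zero] at this
    exact ht this
  · exact subset_closure hq

lemma dense_relPencil {ε : ℂ} (hε : ε ≠ 0) (α β γ : ℂ) (n δ : ℕ) :
    Dense {q : Fin n → ℝ | ∀ j, (relPencil hε α β γ).monomialCoeff δ q j (Finset.Iic j) ≠ 0} := by
  rcases n with _ | _ | n
  · convert dense_univ using 1
    ext q
    simp
  · convert dense_univ using 1
    ext q
    simp [relPencil_monomialCoeff]
  · refine (dense_one_add_exp_ne_zero (δ * α * γ)).mono fun q hq j => ?_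
    rw [relPencil_monomialCoeff]
    split_ifs
    · simp
    · exact mul_ne_zero (by simp) hq

lemma Lax.exists_pencil (U : Lax) (hU : U.Nondegenerate) : ∃ (mat : _) (D : Pencil mat),
    U.mat = mat ∧ ∀ n δ : ℕ,
      Dense {q : Fin n → ℝ | ∀ j, D.monomialCoeff δ q j (Finset.Iic j) ≠ 0} := by
  rcases U.mat_eq with ⟨a, b, c, h⟩ | ⟨ε, α, β, γ, hε, h⟩
  · refine ⟨_, todaPencil a b c, h, fun n δ => ?_⟩
    convert dense_univ using 1
    exact Set.eq_univ_of_forall fun q j => todaPencil_monomialCoeff_ne_zero a b c δ q j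
  · exact ⟨_, relPencil (hε hU) α β γ, h, dense_relPencil (hε hU) α β γ⟩

/-! ### Quantum integrability -/

/-- At order ħ the contributions of the commutative product cancel, and i times the Poisson bracket
of the classical parts remains. -/
lemma poisson_eq_zero_of_starCommute {n : ℕ} {M : ℕ → Obs n →ₗ[ℂ] Obs n →ₗ[ℂ] Obs n}
    (hM : IsStarProduct M) {F G : QObs n} (h : StarCommute M F G) :
    poisson (PowerSeries.constantCoeff F) (PowerSeries.constantCoeff G) = 0 := by
  have h1 := congrArg (PowerSeries.coeff 1) h
  rw [coeff_starMul, coeff_starMul] at h1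
  simp only [Finset.Nat.antidiagonal_succ, Finset.Nat.antidiagonal_zero, Finset.map_singleton,
    Finset.sum_cons, Finset.sum_singleton] at h1
  simp [hM.classical] at h1
  have h0 : ∑ x ∈ Finset.HasAntidiagonal.antidiagonal 1,
      PowerSeries.coeff x.1 F * PowerSeries.coeff x.2 G =
      ∑ x ∈ Finset.HasAntidiagonal.antidiagonal 1,
        PowerSeries.coeff x.1 G * PowerSeries.coeff x.2 F := by
    rw [← PowerSeries.coeff_mul, ← PowerSeries.coeff_mul, mul_comm]
  have h2 : Complex.I • poisson (PowerSeries.constantCoeff F) (PowerSeries.constantCoeff G) =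
      0 := by
    rw [← hM.commutator]
    linear_combination h1 - h0
  exact (smul_eq_zero_iff_right Complex.I_ne_zero).mp h2

/-- The elements commuting with a given one are closed under sums and star products, and the scalars
are central; this is used in each argument in turn. -/
lemma IsStarPolynomial.commute {n : ℕ} {P : (Obs n)[T;T⁻¹]}
    (hP : ∀ k l, Commute (quant n (P.coeff k)) (quant n (P.coeff l))) {F G : QObs n}
    (hF : IsStarPolynomial P F) (hG : IsStarPolynomial P G) :
    Commute (show WeylAlgebra n from F) (show WeylAlgebra n from G) := by
  have hscalar : ∀ (c : PowerSeries ℂ) (E : WeylAlgebra n), Commute (scalarHom n c) E :=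
    fun c E => Algebra.commutes c E
  induction hF with
  | coeff k =>
    induction hG with
    | coeff l => exact hP k l
    | scalar c => exact (hscalar c _).symm
    | add _ _ h1 h2 => exact h1.add_right h2
    | mul _ _ h1 h2 => exact h1.mul_right h2
  | scalar c => exact hscalar c _
  | add _ _ h1 h2 => exact h1.add_left h2
  | mul _ _ h1 h2 => exact h1.mul_left h2

lemma quantumIntegrableBy_of_isStarPolynomial {n : ℕ} {P : (Obs n)[T;T⁻¹]}
    (hP : ∀ k l, Commute (quant n (P.coeff k)) (quant n (P.coeff l))) {H : QObs n}
    {F : Fin n → QObs n} (hH : IsStarPolynomial P H) (hF : ∀ i, IsStarPolynomial P (F i))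
    (hind : FunctionallyIndependent fun i => PowerSeries.constantCoeff (F i)) :
    QuantumIntegrableBy (weyl n) H F where
  isStarProduct := isStarProduct_weyl n
  classical :=
    { conserved := fun i => poisson_eq_zero_of_starCommute (isStarProduct_weyl n)
        ((hF i).commute hP hH)
      involution := fun i j => poisson_eq_zero_of_starCommute (isStarProduct_weyl n)
        ((hF i).commute hP (hF j))
      independent := hind }
  comm_hamiltonian i := (hF i).commute hP hH
  comm i j := (hF i).commute hP (hF j)

lemma eq_weightedTrace {U : Lax} {n : ℕ} {P : (Obs n)[T;T⁻¹]}
    (hP : P = chi U n ∨ P = chiTilde U n) : ∃ δ : ℕ, P = weightedTrace δ (U.prod n) := by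
  rcases hP with rfl | rfl
  · exact ⟨1, chi_eq_weightedTrace U n⟩
  · exact ⟨0, chiTilde_eq_weightedTrace U n⟩

lemma Lax.exists_functionallyIndependent (U : Lax) (hU : U.Nondegenerate) {n : ℕ}
    {P : (Obs n)[T;T⁻¹]} (hP : P = chi U n ∨ P = chiTilde U n) :
    ∃ e : Fin n → ℤ, Function.Injective e ∧
      (∀ k : ℤ, k ∉ Set.range e → ∃ c : ℂ, P.coeff k = algebraMap ℂ (Obs n) c) ∧
      FunctionallyIndependent fun i => P.coeff (e i) := by
  obtain ⟨δ, rfl⟩ := eq_weightedTrace hP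
  obtain ⟨mat, D, hmat, hd⟩ := U.exists_pencil hU
  refine ⟨fun j => D.r * n + D.d * ((j : ℕ) + 1 : ℕ), fun i j h => ?_, fun k hk => ?_,
    D.functionallyIndependent δ hmat (hd n δ)⟩
  · have := mul_left_cancel₀ D.d_ne_zero (add_left_cancel h)
    exact Fin.ext (Nat.succ_injective (by exact_mod_cast this))
  · exact D.exists_coeff_eq δ hmat k fun j hj => hk ⟨j, hj.symm⟩

lemma Lax.exists_quantumIntegrableBy (U : Lax) (hU : U.Nondegenerate) {n : ℕ}
    {P : (Obs n)[T;T⁻¹]} (hP : P = chi U n ∨ P = chiTilde U n) :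
    ∃ e : Fin n → ℤ, Function.Injective e ∧
      (∀ k : ℤ, k ∉ Set.range e → ∃ c : ℂ, P.coeff k = algebraMap ℂ (Obs n) c) ∧
      ∀ H : QObs n, IsStarPolynomial P H →
        QuantumIntegrableBy (weyl n) H fun i => cl (P.coeff (e i)) := by
  obtain ⟨e, he, hc, hind⟩ := U.exists_functionallyIndependent hU hP
  refine ⟨e, he, hc, fun H hH => quantumIntegrableBy_of_isStarPolynomial
    (U.commute_coeff n hP) hH (fun i => .coeff (e i)) ?_⟩
  simpa [cl] using hind

/-! ### The Toda chains -/

lemma FunctionallyIndependent.comp_equiv {n : ℕ} {f : Fin n → Obs n}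
    (hf : FunctionallyIndependent f) (σ : Equiv.Perm (Fin n)) :
    FunctionallyIndependent fun i => f (σ i) := by
  rw [FunctionallyIndependent] at hf ⊢
  convert hf using 3 with x
  exact linearIndependent_equiv (R := ℂ) σ (f := fun i => fderiv ℝ (f i).1 x)

lemma toda_mat : Lax.toda.mat = todaLax (-1) 1 0 := by simp [Lax.mat, todaLax]

/-- Since z = 1/λ, the coefficient of z^(j+1) belongs to λ^(n-1-j); the reversal of the indices
restores increasing powers of λ. -/
lemma functionallyIndependent_toda (n δ : ℕ) : FunctionallyIndependent fun i : Fin n =>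
    (weightedTrace δ (Lax.toda.prod n)).coeff (i : ℤ) := by
  have h := (todaPencil (-1) 1 0).functionallyIndependent δ (n := n) toda_mat (by
    convert dense_univ using 1
    exact Set.eq_univ_of_forall fun q j => todaPencil_monomialCoeff_ne_zero _ _ _ δ q j)
  convert h.comp_equiv Fin.revPerm using 3 with i
  simp only [todaPencil, Fin.revPerm_apply, Fin.val_rev]
  omega

lemma Obs.ext_evalAt {n : ℕ} {f g : Obs n} (h : ∀ x, evalAt x f = evalAt x g) : f = g := Obs.ext h

/-- The entries of lowest order of the monodromy matrix of the Toda chain. -/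
lemma toda_prod_coeff (v p : ℕ → ℂ) (m : ℕ)
    {A : Matrix (Fin 2) (Fin 2) (Polynomial ℂ)}
    (hA : A = ((List.range (m + 1)).reverse.map fun k => !![-1 + Polynomial.X * Polynomial.C (p k),
      -(Polynomial.X * Polynomial.C (v k)); Polynomial.X * Polynomial.C (v k)⁻¹, 0]).prod) :
    ((A 0 0).coeff 0 = (-1) ^ (m + 1) ∧
      (A 0 0).coeff 1 = (-1) ^ m * ∑ k ∈ Finset.range (m + 1), p k ∧
      (A 0 0).coeff 2 = (-1) ^ (m + 1) * ((1 / 2) * (∑ k ∈ Finset.range (m + 1), p k) ^ 2 -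
        ((1 / 2) * ∑ k ∈ Finset.range (m + 1), p k ^ 2 +
          ∑ k ∈ Finset.range m, v (k + 1) * (v k)⁻¹))) ∧
      ((A 1 0).coeff 0 = 0 ∧ (A 1 0).coeff 1 = (-1) ^ m * (v m)⁻¹) ∧
      ((A 0 1).coeff 0 = 0 ∧ (A 0 1).coeff 1 = (-1) ^ (m + 1) * v 0) ∧
      ((A 1 1).coeff 0 = 0 ∧ (A 1 1).coeff 1 = 0 ∧
        (A 1 1).coeff 2 = if m = 0 then 0 else (-1) ^ m * (v 0 * (v m)⁻¹)) := by
  induction m generalizing A with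
  | zero =>
    subst hA
    simp [Polynomial.coeff_one, Polynomial.coeff_X]
  | succ m ih =>
    obtain ⟨⟨a0, a1, a2⟩, ⟨c0, c1⟩, ⟨b0, b1⟩, d0, d1, d2⟩ := ih rfl
    rw [prod_range_succ_reverse] at hA
    generalize ((List.range (m + 1)).reverse.map fun k =>
      !![-1 + Polynomial.X * Polynomial.C (p k), -(Polynomial.X * Polynomial.C (v k));
        Polynomial.X * Polynomial.C (v k)⁻¹, 0]).prod = B at *
    subst hA
    -- Multiplication by the next Lax matrix shifts degrees in z by at most one, so the low order
    -- coefficients satisfy a closed recursion.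
    have h0 : ∀ (c : ℂ) (Q : Polynomial ℂ), (Polynomial.X * Polynomial.C c * Q).coeff 0 = 0 := by
      intro c Q
      rw [mul_assoc, Polynomial.coeff_X_mul_zero]
    have hs : ∀ (c : ℂ) (Q : Polynomial ℂ) (k : ℕ),
        (Polynomial.X * Polynomial.C c * Q).coeff (k + 1) = c * Q.coeff k := by
      intro c Q k
      rw [mul_assoc, Polynomial.coeff_X_mul, Polynomial.coeff_C_mul]
    have h1 := fun c Q => hs c Q 0
    have h2 := fun c Q => hs c Q 1
    simp only [zero_add, one_add_one_eq_two] at h1 h2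
    simp only [Matrix.mul_apply, Fin.sum_univ_two, Matrix.of_apply, Matrix.cons_val_zero,
      Matrix.cons_val_one, add_mul, neg_mul, one_mul, zero_mul, add_zero, Polynomial.coeff_add,
      Polynomial.coeff_neg, h0, h1, h2, a0, a1, a2, b0, b1, c0, c1, d0,
      Finset.sum_range_succ _ (m + 1), Finset.sum_range_succ _ m]
    refine ⟨⟨by ring, by ring, by ring⟩, ⟨trivial, by ring⟩, ⟨by simp, by ring⟩, trivial,
      by simp, ?_⟩
    rw [if_neg m.succ_ne_zero]
    ring

/-- A function of the momenta alone has vanishing Poisson tensor with itself, so its pointwise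
square is its star square. -/
lemma isStarPolynomial_quadratic {n : ℕ} {P : (Obs n)[T;T⁻¹]} {k l : ℤ} {a c : ℂ} {H : Obs n}
    (hk : ∀ j, dq j (P.coeff k) = 0)
    (hH : H = (1 / 2 : ℂ) • (P.coeff k * P.coeff k) + a • P.coeff l + algebraMap ℂ (Obs n) c) :
    IsStarPolynomial P (cl H) := by
  have hsq : poissonTensor n (P.coeff k ⊗ₜ P.coeff k) = 0 := by
    simp [poissonTensor_tmul, hk]
  have h : ∀ (z : ℂ) (f : Obs n), cl (z • f) =
      starMul (weyl n) (scalar n (PowerSeries.C z)) (cl f) := by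
    intro z f
    refine (quant_smul z f).trans ?_
    exact (smul_eq_scalar_mul _ _).trans (scalar_starMul _ _).symm
  have h' : cl (algebraMap ℂ (Obs n) c) = scalar n (PowerSeries.C c) := by
    simp [scalar, cl]
  have hadd : ∀ f g : Obs n, cl (f + g) = cl f + cl g := (quant n).map_add
  have hm : cl (P.coeff k * P.coeff k) = starMul (weyl n) (cl (P.coeff k)) (cl (P.coeff k)) :=
    (quant_mul_of_poissonTensor_eq_zero hsq).symm
  rw [hH, hadd, hadd, h, h, h', hm]
  exact .add (.add (.mul (.scalar _) (.mul (.coeff k) (.coeff k))) (.mul (.scalar _) (.coeff l)))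
    (.scalar _)

lemma toda_spectral (δ : ℕ) {n : ℕ} (x : Phase (n + 1)) :
    (todaPencil (-1) 1 0).spectral δ x = weightedTrace δ ((List.range (n + 1)).reverse.map fun k =>
      !![-1 + Polynomial.X * Polynomial.C (x.2 (Fin.ofNat (n + 1) k) : ℂ),
        -(Polynomial.X * Polynomial.C (Complex.exp (-x.1 (Fin.ofNat (n + 1) k))));
        Polynomial.X * Polynomial.C (Complex.exp (-x.1 (Fin.ofNat (n + 1) k)))⁻¹, 0]).prod := by
  rw [Pencil.spectral, ← map_finRange_reverse]
  congr 2
  refine List.map_congr_left fun k _ => ?_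
  have hk : Fin.ofNat (n + 1) k = k := by simp
  simp only [hk]
  ext i j : 1
  fin_cases i <;> fin_cases j <;> simp [todaPencil, ← Complex.exp_neg]

lemma toda_coeff_last (n δ : ℕ) : (weightedTrace δ (Lax.toda.prod (n + 1))).coeff (n : ℤ) =
    (-1 : ℂ) ^ n • ∑ k, pull k mom := by
  refine Obs.ext fun x => ?_
  have h := (todaPencil (-1) 1 0).evalAt_coeff δ toda_mat x 1
  have hk : (todaPencil (-1) 1 0).r * (n + 1 : ℕ) + (todaPencil (-1) 1 0).d * (1 : ℕ) = n := by
    simp [todaPencil]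
  rw [hk, toda_spectral] at h
  obtain ⟨⟨-, h1, -⟩, -, -, -, h2, -⟩ := toda_prod_coeff
    (fun k => Complex.exp (-x.1 (Fin.ofNat (n + 1) k))) (fun k => x.2 (Fin.ofNat (n + 1) k)) n rfl
  refine h.trans ?_
  rw [weightedTrace, Polynomial.coeff_add, h1, ← Polynomial.C_eq_natCast, Polynomial.coeff_C_mul,
    h2, Finset.sum_range]
  change _ = evalAt x ((-1 : ℂ) ^ n • ∑ k, pull k mom)
  rw [evalAt_smul, map_sum]
  simp
  rfl

lemma toda_coeff_penultimate (n δ : ℕ) (x : Phase (n + 2)) :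
    evalAt x ((weightedTrace δ (Lax.toda.prod (n + 2))).coeff (n : ℤ)) = (-1) ^ n *
      ((1 / 2) * (∑ k, (x.2 k : ℂ)) ^ 2 - ((1 / 2) * ∑ k, (x.2 k : ℂ) ^ 2 +
        ∑ k : Fin (n + 1), Complex.exp (x.1 k.castSucc - x.1 k.succ) +
        δ * Complex.exp (x.1 (Fin.last (n + 1)) - x.1 0))) := by
  have h := (todaPencil (-1) 1 0).evalAt_coeff δ toda_mat x 2
  have hk : (todaPencil (-1) 1 0).r * (n + 2 : ℕ) + (todaPencil (-1) 1 0).d * (2 : ℕ) = n := by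
    simp [todaPencil]
  rw [hk, toda_spectral] at h
  obtain ⟨⟨-, -, h1⟩, -, -, -, -, h2⟩ := toda_prod_coeff
    (fun k => Complex.exp (-x.1 (Fin.ofNat (n + 2) k))) (fun k => x.2 (Fin.ofNat (n + 2) k))
    (n + 1) rfl
  have h3 : ∀ k : Fin (n + 1), Fin.ofNat (n + 2) k = k.castSucc := fun k => by
    ext
    simp
  have h4 : ∀ k : Fin (n + 1), Fin.ofNat (n + 2) (k + 1) = k.succ := fun k => by
    ext
    simp
    omega
  have h5 : Fin.ofNat (n + 2) (n + 1) = Fin.last (n + 1) := by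
    ext
    simp
  have h6 : ∀ k : Fin (n + 2), Fin.ofNat (n + 2) k = k := fun k => by simp
  rw [h, weightedTrace, Polynomial.coeff_add, h1, ← Polynomial.C_eq_natCast,
    Polynomial.coeff_C_mul, h2, if_neg n.succ_ne_zero, Finset.sum_range, Finset.sum_range,
    Finset.sum_range]
  have h7 : Fin.ofNat (n + 2) 0 = 0 := rfl
  simp only [h3, h4, h5, h6, h7, ← Complex.exp_neg, ← Complex.exp_add, neg_neg, neg_add_eq_sub]
  ring

lemma evalAt_todaH (n : ℕ) (x : Phase (n + 1)) : evalAt x (todaH (n + 1)) =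
    (1 / 2) * ∑ k, (x.2 k : ℂ) ^ 2 +
      ∑ k : Fin n, Complex.exp (x.1 k.castSucc - x.1 k.succ) := by
  have h : ∀ i : Fin n, (∑ j : Fin (n + 1), if (i.castSucc : ℕ) + 1 = j then
      Real.exp (x.1 i.castSucc - x.1 j) else 0) = Real.exp (x.1 i.castSucc - x.1 i.succ) := by
    intro i
    have hij : ∀ j : Fin (n + 1), (i.castSucc : ℕ) + 1 = j ↔ i.succ = j := by
      simp [Fin.ext_iff]
    simp only [hij, Finset.sum_ite_eq, Finset.mem_univ, if_true]
  have hlast : (∑ j : Fin (n + 1), if (Fin.last n : ℕ) + 1 = j then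
      Real.exp (x.1 (Fin.last n) - x.1 j) else 0) = 0 :=
    Finset.sum_eq_zero fun j _ => if_neg (by simp; omega)
  change (((1 / 2) * ∑ i, x.2 i ^ 2 + ∑ i : Fin (n + 1), ∑ j : Fin (n + 1),
    if (i : ℕ) + 1 = j then Real.exp (x.1 i - x.1 j) else 0 : ℝ) : ℂ) = _
  rw [Fin.sum_univ_castSucc (fun i : Fin (n + 1) => ∑ j : Fin (n + 1), _), hlast, add_zero]
  simp only [h]
  push_cast
  rfl

lemma evalAt_periodicTodaH (n : ℕ) (x : Phase (n + 1)) : evalAt x (periodicTodaH (n + 1)) =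
    (1 / 2) * ∑ k, (x.2 k : ℂ) ^ 2 + ∑ k : Fin n, Complex.exp (x.1 k.castSucc - x.1 k.succ) +
      Complex.exp (x.1 (Fin.last n) - x.1 0) := by
  change (((1 / 2) * ∑ i, x.2 i ^ 2 +
    ∑ i : Fin (n + 1), Real.exp (x.1 i - x.1 (finRotate (n + 1) i)) : ℝ) : ℂ) = _
  rw [Fin.sum_univ_castSucc (fun i : Fin (n + 1) => Real.exp _), finRotate_last]
  simp only [finRotate_apply, Fin.coeSucc_eq_succ]
  push_cast
  rw [add_assoc]

/-- The penultimate coefficient is, up to sign, half the squared total momentum minus H, and the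
total momentum is, up to sign, the last coefficient. The number δ switches the periodic boundary
term on or off. -/
lemma isStarPolynomial_toda_of_eq {n δ : ℕ} {H : Obs (n + 1)} {P : (Obs (n + 1))[T;T⁻¹]}
    (hP : P = weightedTrace δ (Lax.toda.prod (n + 1)))
    (hH : ∀ x, evalAt x H = (1 / 2) * ∑ k, (x.2 k : ℂ) ^ 2 +
      ∑ k : Fin n, Complex.exp (x.1 k.castSucc - x.1 k.succ) +
        δ * Complex.exp (x.1 (Fin.last n) - x.1 0)) : IsStarPolynomial P (cl H) := by
  have hlast := toda_coeff_last n δ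
  rw [← hP] at hlast
  have hdq : ∀ j, dq j (P.coeff n) = 0 := by
    intro j
    rw [hlast, map_smul, map_sum, Finset.sum_eq_zero, smul_zero]
    intro k _
    by_cases hjk : j = k
    · rw [hjk, dq_pull_self, dq_mom, map_zero]
    · exact dq_pull_of_ne hjk mom
  have hsum : ∀ x : Phase (n + 1), evalAt x (P.coeff n * P.coeff n) =
      (∑ k, (x.2 k : ℂ)) ^ 2 := by
    intro x
    have hone : ((-1 : ℂ) ^ n) * (-1) ^ n = 1 := by
      rw [← mul_pow]
      simp
    rw [map_mul, hlast, evalAt_smul, map_sum]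
    change ((-1) ^ n * ∑ k, (x.2 k : ℂ)) * ((-1) ^ n * ∑ k, (x.2 k : ℂ)) = _
    linear_combination (∑ k, (x.2 k : ℂ)) ^ 2 * hone
  rcases n with _ | n
  -- With one site there is no penultimate coefficient; the boundary term is e^0, so H = p²/2 + δ.
  · refine isStarPolynomial_quadratic (k := 0) (l := 0) (a := 0) (c := δ) hdq
      (Obs.ext_evalAt fun x => ?_)
    rw [hH, map_add, map_add, evalAt_smul, evalAt_smul, evalAt_algebraMap]
    have := hsum x
    rw [Nat.cast_zero] at this
    rw [this]
    simp
  · refine isStarPolynomial_quadratic (l := n) (a := -(-1) ^ n) (c := 0) hdq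
      (Obs.ext_evalAt fun x => ?_)
    have hone : ((-1 : ℂ) ^ n) * (-1) ^ n = 1 := by
      rw [← mul_pow]
      simp
    rw [hH, map_add, map_add, evalAt_smul, evalAt_smul, evalAt_algebraMap, hsum, hP,
      toda_coeff_penultimate]
    linear_combination (-(1 / 2) * ∑ k, (x.2 k : ℂ) ^ 2 -
      ∑ k : Fin (n + 1), Complex.exp (x.1 k.castSucc - x.1 k.succ) -
        δ * Complex.exp (x.1 (Fin.last (n + 1)) - x.1 0) +
        (1 / 2) * (∑ k, (x.2 k : ℂ)) ^ 2) * hone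

lemma isStarPolynomial_todaH (n : ℕ) : IsStarPolynomial (chiTilde .toda n) (cl (todaH n)) := by
  rcases n with _ | n
  · have h : cl (todaH 0) = scalar 0 0 := by
      rw [map_zero, cl, ← map_zero PowerSeries.C]
      congr 1
      exact Obs.ext fun x => by simp [todaH]; rfl
    rw [h]
    exact .scalar 0
  · exact isStarPolynomial_toda_of_eq (chiTilde_eq_weightedTrace _ _) fun x => by
      simp [evalAt_todaH]

lemma isStarPolynomial_periodicTodaH (n : ℕ) :
    IsStarPolynomial (chi .toda n) (cl (periodicTodaH n)) := by
  rcases n with _ | n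
  · have h : cl (periodicTodaH 0) = scalar 0 0 := by
      rw [map_zero, cl, ← map_zero PowerSeries.C]
      congr 1
      exact Obs.ext fun x => by simp [periodicTodaH]; rfl
    rw [h]
    exact .scalar 0
  · exact isStarPolynomial_toda_of_eq (chi_eq_weightedTrace _ _) fun x => by
      simp [evalAt_periodicTodaH]

lemma quantumIntegrableBy_toda {n δ : ℕ} {P : (Obs n)[T;T⁻¹]}
    (hP : P = chi .toda n ∨ P = chiTilde .toda n) (hδ : P = weightedTrace δ (Lax.toda.prod n))
    {H : Obs n} (hH : IsStarPolynomial P (cl H)) :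
    QuantumIntegrableBy (weyl n) (cl H) fun i : Fin n => cl (P.coeff (i : ℤ)) := by
  refine quantumIntegrableBy_of_isStarPolynomial (Lax.toda.commute_coeff n hP) hH
    (fun i => .coeff (i : ℤ)) ?_
  have h := functionallyIndependent_toda n δ
  rw [← hδ] at h
  simpa [cl] using h

lemma QuantumIntegrableBy.isQuantumIntegrable {n : ℕ} {H : Obs n} {f : Fin n → Obs n}
    (h : QuantumIntegrableBy (weyl n) (cl H) fun i => cl (f i)) : IsQuantumIntegrable H f :=
  ⟨weyl n, fun i => cl (f i), fun i => by simp [cl], h⟩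

end QToda

end

theorem theorem4p6 :
    -- quantum commutation, with formal spectral parameters
    (∀ (U : QToda.Lax) (n : ℕ) (P : LaurentPolynomial (QToda.Obs n)),
      (P = QToda.chi U n ∨ P = QToda.chiTilde U n) →
        QToda.spectralStar (QToda.atLam P) (QToda.atMu P) =
          QToda.spectralStar (QToda.atMu P) (QToda.atLam P)) ∧
    -- coefficients and star polynomials define quantum integrable systems
    (∀ (U : QToda.Lax), U.Nondegenerate →
      ∀ (n : ℕ) (P : LaurentPolynomial (QToda.Obs n)),
      (P = QToda.chi U n ∨ P = QToda.chiTilde U n) →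
        (∃ e : Fin n → ℤ, Function.Injective e ∧
          (∀ k : ℤ, k ∉ Set.range e → ∃ c : ℂ, P.coeff k = algebraMap ℂ (QToda.Obs n) c) ∧
          ∀ H : QToda.QObs n, QToda.IsStarPolynomial P H →
            QToda.QuantumIntegrableBy (QToda.weyl n) H
              (fun i => QToda.cl (P.coeff (e i)))) ∧
        (∀ (H : QToda.QObs n) (F : Fin n → QToda.QObs n), QToda.IsStarPolynomial P H →
          (∀ i, QToda.IsStarPolynomial P (F i)) →
          QToda.FunctionallyIndependent (fun i => PowerSeries.constantCoeff (F i)) →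
            QToda.QuantumIntegrableBy (QToda.weyl n) H F)) ∧
    -- the nonperiodic and the periodic Toda chain
    (∀ n : ℕ,
      QToda.QuantumIntegrableBy (QToda.weyl n) (QToda.cl (QToda.todaH n))
        (fun i : Fin n => QToda.cl ((QToda.chiTilde .toda n).coeff (i : ℤ))) ∧
      QToda.IsQuantumIntegrable (QToda.todaH n)
        (fun i : Fin n => (QToda.chiTilde .toda n).coeff (i : ℤ)) ∧
      QToda.QuantumIntegrableBy (QToda.weyl n) (QToda.cl (QToda.periodicTodaH n))
        (fun i : Fin n => QToda.cl ((QToda.chi .toda n).coeff (i : ℤ))) ∧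
      QToda.IsQuantumIntegrable (QToda.periodicTodaH n)
        (fun i : Fin n => (QToda.chi .toda n).coeff (i : ℤ))) := by
  refine ⟨fun U n P hP => U.spectralStar_comm n hP, fun U hU n P hP =>
    ⟨U.exists_quantumIntegrableBy hU hP, fun H F hH hF hind =>
      QToda.quantumIntegrableBy_of_isStarPolynomial (U.commute_coeff n hP) hH hF hind⟩,
    fun n => ?_⟩
  have h0 := QToda.quantumIntegrableBy_toda (Or.inr rfl) (QToda.chiTilde_eq_weightedTrace _ n)
    (QToda.isStarPolynomial_todaH n)
  have h1 := QToda.quantumIntegrableBy_toda (Or.inl rfl) (QToda.chi_eq_weightedTrace _ n)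
    (QToda.isStarPolynomial_periodicTodaH n)
  exact ⟨h0, h0.isQuantumIntegrable, h1, h1.isQuantumIntegrable⟩
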